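/- All graphs are finite. Let $D\ge 1$ be an integer, let $G$ be a multigraph (parallel edges allowed), and let $w:V(G)\to\{1,\dots,D+2\}$ be a weighting of its vertices; the capacity of a vertex is $c(v)=D+2-w(v)$. A forest is a multigraph without cycles, where two parallel edges count as a cycle of length $2$. Let $(M,F)$ be a partition of $V(G)$ (parts may be empty) such that $G[M]$ and $G[F]$ are forests. - $(M,F)$ is an $(F_D^{\Delta},F)$-coloring of $(G,w)$ if $w(v)+|N(v)\cap M|\le D+1$ for every $v\in M$. - $(M,F)$ is an $(F_D^{e},F)$-coloring of $(G,w)$ if every connected component $C$ of $G[M]$ satisfies $\sum_{v\in C}w(v)\le D+1$. For either kind of coloring, $(G,w)$ is critical if it has no such coloring but every proper subgraph of $G$, with the weights inherited from $w$, has one. A potential $\rho$ assigns integers to vertices and edges, and $\rho(A)=\sum_{v\in A}\rho(v)-\sum_{e\in E(G[A])}\rho(e)$ for $A\subseteq V(G)$. Define: - $\rho^m_\Delta(v)=2D+1+2c(v)$ and $\rho^m_\Delta(e)=2(D+1)$; - $\rho^s_\Delta(v)=3D+2+3c(v)$ and $\rho^s_\Delta(e)=3(D+1)$; - for odd $D$,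 $\rho^m_e=\rho^m_\Delta$; for even $D$, $\rho^m_e(v)=2D+2c(v)$ if $c(v)\le\frac{D-2}{2}$, $\rho^m_e(v)=2D+2c(v)-1$ if $c(v)\ge\frac D2$, and $\rho^m_e(e)=2D+1$. **Theorem.** Suppose $|V(G)|\ge 3$. 1. For each $D\ge1$, if $(G,w)$ is $(F_D^{\Delta},F)$-critical, then $\rho^m_\Delta(V(G))\le-2$. 2. For each $D\ge2$, if $G$ is simple and $(G,w)$ is $(F_D^{\Delta},F)$-critical, then $\rho^s_\Delta(V(G))\le-3$. 3. For each odd $D\ge1$, if $(G,w)$ is $(F_D^{e},F)$-critical, then $\rho^m_e(V(G))\le-2$. 4. For each even $D\ge2$, if $(G,w)$ is $(F_D^{e},F)$-critical, then $\rho^m_e(V(G))\le-2$. -/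

import Mathlib

open scoped BigOperators

namespace ForestPartition

variable {α β : Type*}

/-- A multigraph is a forest if it has no cycle. Loops are cycles of length one and parallel edges
are cycles of length two, so a forest has neither, and its underlying simple graph is acyclic. -/
def IsForest (G : Graph α β) : Prop :=
  G.Simple ∧ G.toSimpleGraph.IsAcyclic

/-- `(M, F)` is a partition of the vertex set of `G` into two (possibly empty) parts, each of which
induces a forest. -/
structure IsForestPartition (G : Graph α β) (M F : Set α) : Prop where
  union_eq : M ∪ F = G.vertexSet
  disjoint : Disjoint M F
  forest_left : IsForest (G.induce M)
  forest_right : IsForest (G.induce F)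

/-- `(M, F)` is a degree-type coloring of `(G, w)`: both parts induce forests, and
`w(v) + |N(v) ∩ M| ≤ D + 1` for every `v ∈ M`. -/
structure IsDegreeColoring (D : ℕ) (G : Graph α β) (w : α → ℕ) (M F : Set α) : Prop
    extends IsForestPartition G M F where
  degree_le : ∀ v ∈ M, w v + {u | u ∈ M ∧ G.Adj v u}.ncard ≤ D + 1

/-- `(M, F)` is an edge-type coloring of `(G, w)`: both parts induce forests, and every connected
component of `G[M]` has total weight at most `D + 1`. -/
structure IsEdgeColoring (D : ℕ) (G : Graph α β) (w : α → ℕ) (M F : Set α) : Prop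
    extends IsForestPartition G M F where
  component_le : ∀ C : (G.induce M).toSimpleGraph.ConnectedComponent,
    ∑ᶠ v ∈ C.supp, w v.1 ≤ D + 1

/-- `(G, w)` has no degree-type coloring, but every proper subgraph (with the same weights)
has one. -/
def IsDegreeCritical (D : ℕ) (G : Graph α β) (w : α → ℕ) : Prop :=
  (¬ ∃ M F, IsDegreeColoring D G w M F) ∧ ∀ H < G, ∃ M F, IsDegreeColoring D H w M F

/-- `(G, w)` has no edge-type coloring, but every proper subgraph (with the same weights)
has one. -/
def IsEdgeCritical (D : ℕ) (G : Graph α β) (w : α → ℕ) : Prop :=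
  (¬ ∃ M F, IsEdgeColoring D G w M F) ∧ ∀ H < G, ∃ M F, IsEdgeColoring D H w M F

/-- The capacity `c(v) = D + 2 - w(v)` of a vertex of weight `w(v)`. -/
def capacity (D : ℕ) (w : α → ℕ) (v : α) : ℤ := (D : ℤ) + 2 - (w v : ℤ)

/-- The potential of a vertex set `A`, given the potential `ρv` of each vertex and the common
potential `ρe` of the edges: the sum of `ρv` over `A` minus the sum of `ρe` over the edges of
`G[A]`. -/
noncomputable def potential (G : Graph α β) (ρv : α → ℤ) (ρe : ℤ) (A : Set α) : ℤ :=
  (∑ᶠ v ∈ A, ρv v) - ((G.induce A).edgeSet.ncard : ℤ) * ρe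

/-- The potential for multigraphs and degree-type colorings. -/
noncomputable def rhoMultiDegree (D : ℕ) (G : Graph α β) (w : α → ℕ) (A : Set α) : ℤ :=
  potential G (fun v => 2 * (D : ℤ) + 1 + 2 * capacity D w v) (2 * ((D : ℤ) + 1)) A

/-- The potential for simple graphs and degree-type colorings. -/
noncomputable def rhoSimpleDegree (D : ℕ) (G : Graph α β) (w : α → ℕ) (A : Set α) : ℤ :=
  potential G (fun v => 3 * (D : ℤ) + 2 + 3 * capacity D w v) (3 * ((D : ℤ) + 1)) A

/-- The vertex potential for edge-type colorings and even `D`. The condition `2 c ≤ D - 2` says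
`c ≤ (D - 2) / 2`; for even `D` its negation says `c ≥ D / 2`. -/
def evenVertexPotential (D : ℕ) (w : α → ℕ) (v : α) : ℤ :=
  if 2 * capacity D w v ≤ (D : ℤ) - 2 then 2 * (D : ℤ) + 2 * capacity D w v
  else 2 * (D : ℤ) + 2 * capacity D w v - 1

/-- The potential for multigraphs and edge-type colorings. -/
noncomputable def rhoMultiEdge (D : ℕ) (G : Graph α β) (w : α → ℕ) (A : Set α) : ℤ :=
  if Odd D then rhoMultiDegree D G w A
  else potential G (evenVertexPotential D w) (2 * (D : ℤ) + 1) A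

end ForestPartition

set_option linter.unusedSectionVars false

namespace ForestPartition

/-! The proof is an induction on the number of vertices by the potential method. Call a weighted
graph sparse if every nonempty vertex set has potential above `-τ`. It suffices that a critical
graph has potential at most `-τ` whenever all smaller sparse graphs are colorable
(`colors_of_critical`); a counterexample is then a critical graph `V` of potential above `-τ`.

The engine is the gap lemma (`gap_step`, `Critical.gap`). Color a proper subset `A`, contract its
`F`-part to a root of weight `D + 2` (which can only be colored `F`), and record edges to its
`M`-part by larger weights. If the rest, so modified, is sparse, its coloring combines with that of
`A`. Otherwise some set `B` outside `A` has low potential, and for `A` of least potential this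
forces `A ∪ B = V` and makes the potential of `A` much larger than that of `V`. A first gap makes it
possible to raise the weight of a vertex of `A` before coloring it, which gives a larger gap, and so
on. In the simple case the root is a pair of adjacent vertices, so that no parallel edges arise.

With a gap, a vertex `v` of degree three and small weight is reducible: delete it, raise the weights
of its neighbors, color the rest. If at most one edge goes from `v` to `F`, put `v` into `F`;
otherwise at most one edge goes to `M`, and the raised weight leaves room for `v` in `M`. Twice the
potential of `V` is the sum of the charges `2 Φ(w v) - E deg v`. In the degree version with `D ≥ 2`
and in the component version with `D` even, every charge is now negative, which finishes the proof
(`Critical.pot_le_of_degree`, `pot_le_even`).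

For `D = 2h - 1` odd (including the degree version with `D = 1`), vertices of degree three and
weight `h`, called light, keep charge `2`. They are independent (`light_independent`), they have no
neighbor of degree three (`deg_ne_three`), and a vertex of degree four and weight one has at most
two light neighbors (`not_star`, which uses submodularity of the potential). Each light vertex sends
`2/3` along each of its edges. The only graphs that survive the count consist of a triangle and
light vertices, and these are colored by hand (`OddCritical.false`). -/

/-- `m u v` is the number of edges between `u` and `v` in a loopless multigraph. -/
structure IsMult {α : Type*} (m : α → α → ℕ) : Prop where
  symm : ∀ u v, m u v = m v u
  diag : ∀ v, m v v = 0

/-! ### Edge counts in multigraphs given by multiplicities. -/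

section Counting

variable {α : Type*} [DecidableEq α] {m m' : α → α → ℕ} {w w' : α → ℕ}

/-- The number of edges between the vertex `v` and the set `A`. -/
def nb (m : α → α → ℕ) (v : α) (A : Finset α) : ℕ := ∑ u ∈ A, m v u

/-- The number of edges between two disjoint sets of vertices. -/
def cross (m : α → α → ℕ) (A B : Finset α) : ℕ := ∑ v ∈ A, nb m v B

/-- The number of edges inside a set of vertices. -/
def ed (m : α → α → ℕ) (A : Finset α) : ℕ := cross m A A / 2

@[simp] lemma nb_empty (v : α) : nb m v ∅ = 0 := by simp [nb]

@[simp] lemma cross_empty_left (B : Finset α) : cross m ∅ B = 0 := by simp [cross]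

@[simp] lemma cross_empty_right (A : Finset α) : cross m A ∅ = 0 := by simp [cross]

@[simp] lemma ed_empty : ed m (∅ : Finset α) = 0 := by simp [ed]

@[simp] lemma nb_singleton (v u : α) : nb m v {u} = m v u := by simp [nb]

@[simp] lemma cross_singleton_left (v : α) (B : Finset α) : cross m {v} B = nb m v B := by
  simp [cross]

lemma nb_insert {v x : α} {A : Finset α} (hx : x ∉ A) : nb m v (insert x A) = m v x + nb m v A := by
  simp [nb, hx]

lemma nb_union {v : α} {A B : Finset α} (h : Disjoint A B) :
    nb m v (A ∪ B) = nb m v A + nb m v B := by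
  simp [nb, Finset.sum_union h]

lemma nb_mono {v : α} {A B : Finset α} (h : A ⊆ B) : nb m v A ≤ nb m v B :=
  Finset.sum_le_sum_of_subset h

lemma le_nb {v u : α} {A : Finset α} (h : u ∈ A) : m v u ≤ nb m v A :=
  Finset.single_le_sum (f := fun u => m v u) (fun _ _ => Nat.zero_le _) h

lemma nb_erase {v x : α} {A : Finset α} (hx : x ∈ A) :
    nb m v A = m v x + nb m v (A.erase x) := by
  conv_lhs => rw [← Finset.insert_erase hx]
  exact nb_insert (Finset.notMem_erase x A)

lemma IsMult.nb_erase_self (hm : IsMult m) (v : α) (A : Finset α) :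
    nb m v (A.erase v) = nb m v A := by
  by_cases h : v ∈ A
  · rw [nb_erase h, hm.diag, zero_add]
  · rw [Finset.erase_eq_of_notMem h]

lemma cross_union_left {A B C : Finset α} (h : Disjoint A B) :
    cross m (A ∪ B) C = cross m A C + cross m B C := by
  simp [cross, Finset.sum_union h]

lemma cross_union_right {A B C : Finset α} (h : Disjoint B C) :
    cross m A (B ∪ C) = cross m A B + cross m A C := by
  simp [cross, nb_union h, Finset.sum_add_distrib]

lemma IsMult.cross_comm (hm : IsMult m) (A B : Finset α) : cross m A B = cross m B A := by
  unfold cross nb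
  rw [Finset.sum_comm]
  exact Finset.sum_congr rfl fun _ _ => Finset.sum_congr rfl fun _ _ => hm.symm _ _

lemma IsMult.cross_eq_sum (hm : IsMult m) (A B : Finset α) : cross m A B = ∑ v ∈ B, nb m v A := by
  rw [hm.cross_comm]; rfl

lemma cross_mono {A A' B B' : Finset α} (hA : A ⊆ A') (hB : B ⊆ B') :
    cross m A B ≤ cross m A' B' :=
  (Finset.sum_le_sum fun _ _ => nb_mono hB).trans (Finset.sum_le_sum_of_subset hA)

lemma IsMult.cross_insert_self (hm : IsMult m) {v : α} {A : Finset α} (hv : v ∉ A) :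
    cross m (insert v A) (insert v A) = cross m A A + 2 * nb m v A := by
  have h : Disjoint {v} A := Finset.disjoint_singleton_left.2 hv
  rw [Finset.insert_eq, cross_union_left h, cross_union_right h, cross_union_right h,
    hm.cross_comm A {v}]
  simp [hm.diag]; ring

lemma IsMult.two_mul_ed (hm : IsMult m) (A : Finset α) : 2 * ed m A = cross m A A := by
  have : 2 ∣ cross m A A := by
    induction A using Finset.induction_on with
    | empty => simp
    | insert v A hv ih =>
      rw [hm.cross_insert_self hv]
      exact dvd_add ih (dvd_mul_right _ _)
  unfold ed
  omega

lemma IsMult.ed_insert (hm : IsMult m) {v : α} {A : Finset α} (hv : v ∉ A) :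
    ed m (insert v A) = ed m A + nb m v A := by
  have h1 := hm.two_mul_ed A
  have h2 := hm.two_mul_ed (insert v A)
  have h3 := hm.cross_insert_self hv
  omega

lemma IsMult.ed_union (hm : IsMult m) {A B : Finset α} (h : Disjoint A B) :
    ed m (A ∪ B) = ed m A + ed m B + cross m A B := by
  have h1 := hm.two_mul_ed A
  have h2 := hm.two_mul_ed B
  have h3 := hm.two_mul_ed (A ∪ B)
  rw [cross_union_left h, cross_union_right h, cross_union_right h, hm.cross_comm B A] at h3
  omega

lemma IsMult.ed_erase (hm : IsMult m) {v : α} {A : Finset α} (hv : v ∈ A) :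
    ed m A = ed m (A.erase v) + nb m v A := by
  conv_lhs => rw [← Finset.insert_erase hv]
  rw [hm.ed_insert (Finset.notMem_erase v A), hm.nb_erase_self]

lemma IsMult.ed_singleton (hm : IsMult m) (v : α) : ed m {v} = 0 := by
  have := hm.two_mul_ed {v}
  simp [hm.diag] at this
  exact this

lemma IsMult.ed_pair (hm : IsMult m) {u v : α} (h : u ≠ v) : ed m {u, v} = m u v := by
  rw [hm.ed_insert (by simpa using h), hm.ed_singleton]; simp

lemma ed_le_ed {A : Finset α} (h : ∀ u ∈ A, ∀ v ∈ A, m u v ≤ m' u v) : ed m A ≤ ed m' A :=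
  Nat.div_le_div_right (Finset.sum_le_sum fun u hu => Finset.sum_le_sum fun v hv => h u hu v hv)

lemma ed_congr {A : Finset α} (h : ∀ u ∈ A, ∀ v ∈ A, m u v = m' u v) : ed m A = ed m' A :=
  le_antisymm (ed_le_ed fun u hu v hv => (h u hu v hv).le)
    (ed_le_ed fun u hu v hv => (h u hu v hv).ge)

lemma exists_of_nb_pos {v : α} {A : Finset α} (h : 0 < nb m v A) : ∃ u ∈ A, 0 < m v u := by
  by_contra hc
  push Not at hc
  have : nb m v A = 0 := Finset.sum_eq_zero fun u hu => by have := hc u hu; omega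
  omega

lemma exists_of_cross_pos {A B : Finset α} (h : 0 < cross m A B) :
    ∃ u ∈ A, ∃ v ∈ B, 0 < m u v := by
  by_contra hc
  push Not at hc
  have : cross m A B = 0 := Finset.sum_eq_zero fun u hu => Finset.sum_eq_zero fun v hv => by
    have := hc u hu v hv; omega
  omega

/-- The multigraph with an additional edge between `a` and `b`. -/
def addEdge (m : α → α → ℕ) (a b : α) (u v : α) : ℕ :=
  m u v + if (u = a ∧ v = b) ∨ (u = b ∧ v = a) then 1 else 0

lemma IsMult.addEdge (hm : IsMult m) {a b : α} (hab : a ≠ b) : IsMult (addEdge m a b) where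
  symm u v := by
    unfold ForestPartition.addEdge
    rw [hm.symm u v]
    congr 1
    exact if_congr (by tauto) rfl rfl
  diag v := by
    unfold ForestPartition.addEdge
    rw [hm.diag, if_neg]
    rintro (⟨rfl, h⟩ | ⟨rfl, h⟩)
    exacts [hab h, hab h.symm]

lemma le_addEdge (m : α → α → ℕ) (a b u v : α) : m u v ≤ addEdge m a b u v := Nat.le_add_right _ _

lemma addEdge_of_ne {a b u : α} (v : α) (ha : u ≠ a) (hb : u ≠ b) : addEdge m a b u v = m u v := by
  simp [addEdge, ha, hb]

lemma IsMult.ed_addEdge (hm : IsMult m) {a b : α} (hab : a ≠ b) (A : Finset α) :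
    ed (ForestPartition.addEdge m a b) A = ed m A + if a ∈ A ∧ b ∈ A then 1 else 0 := by
  induction A using Finset.induction_on with
  | empty => simp
  | insert v A hv ih =>
    rw [(hm.addEdge hab).ed_insert hv, hm.ed_insert hv, ih]
    have : nb (ForestPartition.addEdge m a b) v A =
        nb m v A + if (v = a ∧ b ∈ A) ∨ (v = b ∧ a ∈ A) then 1 else 0 := by
      unfold nb ForestPartition.addEdge
      rw [Finset.sum_add_distrib]
      congr 1
      by_cases h1 : v = a
      · subst h1
        simp [hab, Finset.sum_ite_eq']
      · by_cases h2 : v = b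
        · subst h2
          simp [h1, Finset.sum_ite_eq']
        · simp [h1, h2]
    rw [this]
    by_cases h1 : v = a
    · subst h1
      have h2 : b ≠ v := hab.symm
      by_cases hb : b ∈ A <;> simp [hv, hab, h2, hb] ; omega
    · by_cases h2 : v = b
      · subst h2
        by_cases ha : a ∈ A <;> simp [hv, hab, ha] ; omega
      · have h1' : a ≠ v := fun h => h1 h.symm
        have h2' : b ≠ v := fun h => h2 h.symm
        simp [h1, h2, h1', h2']; omega

/-! ### Forests, described by edge counts. -/

/-- Every nonempty subset spans fewer edges than vertices: the set induces a forest. -/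
def ForestOn (m : α → α → ℕ) (F : Finset α) : Prop :=
  ∀ S ⊆ F, S.Nonempty → ed m S + 1 ≤ S.card

lemma ForestOn.empty : ForestOn m (∅ : Finset α) := fun S hS hne => by
  simp [Finset.subset_empty.1 hS] at hne

lemma ForestOn.mono {F : Finset α} (h : ForestOn m' F) (hmm : ∀ u ∈ F, ∀ v ∈ F, m u v ≤ m' u v) :
    ForestOn m F := fun S hS hne =>
  le_trans (Nat.add_le_add_right (ed_le_ed fun u hu v hv => hmm u (hS hu) v (hS hv)) 1) (h S hS hne)

lemma ForestOn.subset {F F' : Finset α} (h : ForestOn m F) (hs : F' ⊆ F) : ForestOn m F' :=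
  fun S hS => h S (hS.trans hs)

/-- One crossing edge closes no cycle. In the count, a set that meets both sides has slack two, and
the crossing edge uses up one. -/
lemma ForestOn.union (hm : IsMult m) {A B : Finset α} (hA : ForestOn m A) (hB : ForestOn m B)
    (hd : Disjoint A B) (hc : cross m A B ≤ 1) : ForestOn m (A ∪ B) := by
  intro S hS hne
  have e : S = S ∩ A ∪ S ∩ B := by rw [← Finset.inter_union_distrib_left, Finset.inter_eq_left.2 hS]
  have hd' : Disjoint (S ∩ A) (S ∩ B) :=
    hd.mono Finset.inter_subset_right Finset.inter_subset_right
  have h1 := hm.ed_union hd'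
  have h2 := Finset.card_union_of_disjoint hd'
  rw [← e] at h1 h2
  have h3 : cross m (S ∩ A) (S ∩ B) ≤ cross m A B :=
    cross_mono Finset.inter_subset_right Finset.inter_subset_right
  rcases (S ∩ A).eq_empty_or_nonempty with ha | ha
  · rw [ha, Finset.empty_union] at e
    rw [e] at hne ⊢
    exact hB _ Finset.inter_subset_right hne
  rcases (S ∩ B).eq_empty_or_nonempty with hb | hb
  · rw [hb, Finset.union_empty] at e
    rw [e] at hne ⊢
    exact hA _ Finset.inter_subset_right hne
  have := hA _ Finset.inter_subset_right ha
  have := hB _ Finset.inter_subset_right hb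
  omega

lemma ForestOn.singleton (hm : IsMult m) (v : α) : ForestOn m {v} := by
  intro S hS hne
  rw [(Finset.subset_singleton_iff.1 hS).resolve_left hne.ne_empty]
  simp [hm.ed_singleton]

protected lemma ForestOn.insert (hm : IsMult m) {F : Finset α} {v : α} (hF : ForestOn m F) (hv : v ∉ F)
    (h : nb m v F ≤ 1) : ForestOn m (insert v F) := by
  rw [Finset.insert_eq]
  exact (ForestOn.singleton hm v).union hm hF (Finset.disjoint_singleton_left.2 hv) (by simpa using h)

/-- Subdividing an edge of a forest gives a forest. -/
lemma ForestOn.subdivide (hm : IsMult m) {F : Finset α} {a b t : α} (hab : a ≠ b)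
    (hF : ForestOn (addEdge m a b) F)
    (h : ∀ u ∈ F, m t u ≤ if u = a ∨ u = b then 1 else 0) : ForestOn m (insert t F) := by
  have hF' : ForestOn m F := hF.mono fun u _ v _ => le_addEdge m a b u v
  intro S hS hne
  by_cases hts : t ∈ S
  · have hSF : S.erase t ⊆ F := fun x hx => by
      have := hS (Finset.mem_of_mem_erase hx)
      exact (Finset.mem_insert.1 this).resolve_left (Finset.ne_of_mem_erase hx)
    have h1 := hm.ed_erase hts
    have h2 := Finset.card_erase_add_one hts
    rw [← hm.nb_erase_self] at h1
    rcases (S.erase t).eq_empty_or_nonempty with he | he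
    · rw [he] at h1 h2
      simp at h1 h2
      omega
    have h3 := hF _ hSF he
    rw [hm.ed_addEdge hab] at h3
    -- Only `a` and `b` receive edges from `t`. If both lie in `S`, the edge `ab` counted in `h3`
    -- pays for the second of them.
    have h4 : nb m t (S.erase t) ≤ ∑ u ∈ S.erase t,
        ((if u = a then 1 else 0) + (if u = b then 1 else 0)) := by
      refine Finset.sum_le_sum fun u hu => (h u (hSF hu)).trans ?_
      by_cases h1 : u = a <;> by_cases h2 : u = b <;> simp [h1, h2]
    rw [Finset.sum_add_distrib, Finset.sum_ite_eq', Finset.sum_ite_eq'] at h4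
    by_cases ha : a ∈ S.erase t <;> by_cases hb : b ∈ S.erase t <;> simp only [ha, hb, if_true,
      if_false, and_true, and_false] at h3 h4 <;> omega
  · exact hF' S (fun x hx => (Finset.mem_insert.1 (hS hx)).resolve_left fun e => hts (by rwa [e] at hx)) hne

/-! ### The part `M` and colorings. -/

/-- The two kinds of bounds on the part `M` of a coloring. -/
inductive Kind
  | degree
  | component

/-- The set `M` may be the first part of a coloring. -/
def MOK (t : Kind) (D : ℕ) (m : α → α → ℕ) (w : α → ℕ) (M : Finset α) : Prop :=
  ForestOn m M ∧ match t with
    | .degree => ∀ v ∈ M, w v + nb m v M ≤ D + 1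
    | .component => ∀ S ⊆ M, S.Nonempty → S.card ≤ ed m S + 1 → ∑ v ∈ S, w v ≤ D + 1

/-- Increasing the weights of the ends by `k` and `l` compensates for adding an edge. -/
def JoinOK (t : Kind) (D k l : ℕ) : Prop :=
  match t with
  | .degree => 1 ≤ k ∧ 1 ≤ l
  | .component => D + 1 ≤ k + l

variable {t : Kind} {D : ℕ}

lemma JoinOK.of_add_le {k l : ℕ} (hk : 1 ≤ k) (hl : 1 ≤ l) (h : D + 1 ≤ k + l) : JoinOK t D k l := by
  cases t
  exacts [⟨hk, hl⟩, h]

lemma MOK.empty : MOK t D m w (∅ : Finset α) := by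
  refine ⟨ForestOn.empty, ?_⟩
  cases t
  · simp
  · intro S hS hne
    simp [Finset.subset_empty.1 hS] at hne

lemma MOK.mono {M : Finset α} (h : MOK t D m' w' M) (hmm : ∀ u ∈ M, ∀ v ∈ M, m u v ≤ m' u v)
    (hw : ∀ v ∈ M, w v ≤ w' v) : MOK t D m w M := by
  refine ⟨h.1.mono hmm, ?_⟩
  cases t
  · exact fun v hv => (Nat.add_le_add (hw v hv)
      (Finset.sum_le_sum fun u hu => hmm v hv u hu)).trans (h.2 v hv)
  · intro S hS hne hc
    refine (Finset.sum_le_sum fun v hv => hw v (hS hv)).trans (h.2 S hS hne (hc.trans ?_))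
    exact Nat.add_le_add_right (ed_le_ed fun u hu v hv => hmm u (hS hu) v (hS hv)) 1

lemma MOK.subset {M M' : Finset α} (h : MOK t D m w M) (hs : M' ⊆ M) : MOK t D m w M' := by
  refine ⟨h.1.subset hs, ?_⟩
  cases t
  · exact fun v hv => (Nat.add_le_add_left (nb_mono hs) _).trans (h.2 v (hs hv))
  · exact fun S hS => h.2 S (hS.trans hs)

lemma MOK.weight_le {M : Finset α} (h : MOK t D m w M) {v : α} (hv : v ∈ M) :
    w v ≤ D + 1 := by
  cases t
  · exact le_trans (Nat.le_add_right _ _) (h.2 v hv)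
  · simpa using h.2 {v} (by simpa using hv) (by simp) (by simp)

lemma MOK.singleton (hm : IsMult m) {v : α} (h : w v ≤ D + 1) : MOK t D m w {v} := by
  refine ⟨ForestOn.singleton hm v, ?_⟩
  cases t
  · simpa [hm.diag] using h
  · intro S hS hne _
    rw [(Finset.subset_singleton_iff.1 hS).resolve_left hne.ne_empty]
    simpa using h

/-- The union of two sets with no edge between them. -/
lemma MOK.union (hm : IsMult m) {A B : Finset α} (hA : MOK t D m w A) (hB : MOK t D m w B)
    (hd : Disjoint A B) (hc : cross m A B = 0) : MOK t D m w (A ∪ B) := by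
  refine ⟨hA.1.union hm hB.1 hd (by omega), ?_⟩
  cases t
  · intro v hv
    rw [nb_union hd]
    rcases Finset.mem_union.1 hv with h | h
    · have h1 : nb m v B ≤ cross m A B := by
        rw [← cross_singleton_left]; exact cross_mono (by simpa using h) subset_rfl
      have h2 : w v + nb m v A ≤ D + 1 := hA.2 v h
      omega
    · have h1 : nb m v A ≤ cross m A B := by
        rw [hm.cross_comm, ← cross_singleton_left]; exact cross_mono (by simpa using h) subset_rfl
      have h2 : w v + nb m v B ≤ D + 1 := hB.2 v h
      omega
  · intro S hS hne hcard
    have e : S = S ∩ A ∪ S ∩ B := by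
      rw [← Finset.inter_union_distrib_left, Finset.inter_eq_left.2 hS]
    have hd' : Disjoint (S ∩ A) (S ∩ B) :=
      hd.mono Finset.inter_subset_right Finset.inter_subset_right
    have h1 := hm.ed_union hd'
    have h2 := Finset.card_union_of_disjoint hd'
    rw [← e] at h1 h2
    have h3 : cross m (S ∩ A) (S ∩ B) ≤ cross m A B :=
      cross_mono Finset.inter_subset_right Finset.inter_subset_right
    rcases (S ∩ A).eq_empty_or_nonempty with ha | ha
    · rw [ha, Finset.empty_union] at e
      rw [e] at hne hcard ⊢
      exact hB.2 _ Finset.inter_subset_right hne hcard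
    rcases (S ∩ B).eq_empty_or_nonempty with hb | hb
    · rw [hb, Finset.union_empty] at e
      rw [e] at hne hcard ⊢
      exact hA.2 _ Finset.inter_subset_right hne hcard
    have := hA.1 _ Finset.inter_subset_right ha
    have := hB.1 _ Finset.inter_subset_right hb
    omega

/-- The union of two sets joined by a single edge. -/
lemma MOK.join (hm : IsMult m) {A B : Finset α} {w₁ w₂ : α → ℕ} {x y : α} {k l : ℕ}
    (hA : MOK t D m w₁ A) (hB : MOK t D m w₂ B) (hd : Disjoint A B) (hc : cross m A B ≤ 1)
    (hx : x ∈ A) (hy : y ∈ B) (hxy : 1 ≤ m x y)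
    (hw₁ : ∀ v ∈ A, w v ≤ w₁ v) (hw₂ : ∀ v ∈ B, w v ≤ w₂ v)
    (hk : w x + k ≤ w₁ x) (hl : w y + l ≤ w₂ y) (hj : JoinOK t D k l) :
    MOK t D m w (A ∪ B) := by
  refine ⟨hA.1.union hm hB.1 hd hc, ?_⟩
  have hcross : ∀ v ∈ A, v ≠ x → nb m v B = 0 := by
    intro v hv hvx
    have h1 : cross m ({v} ∪ {x}) B ≤ cross m A B :=
      cross_mono (Finset.union_subset (by simpa using hv) (by simpa using hx)) subset_rfl
    rw [cross_union_left (by simpa using hvx)] at h1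
    have h2 : m x y ≤ nb m x B := le_nb hy
    simp at h1
    omega
  have hcross' : ∀ v ∈ B, v ≠ y → nb m v A = 0 := by
    intro v hv hvy
    have h1 : cross m ({v} ∪ {y}) A ≤ cross m A B := by
      rw [hm.cross_comm A B]
      exact cross_mono (Finset.union_subset (by simpa using hv) (by simpa using hy)) subset_rfl
    rw [cross_union_left (by simpa using hvy)] at h1
    have h2 : m y x ≤ nb m y A := le_nb hx
    rw [hm.symm] at h2
    simp at h1
    omega
  cases t
  · intro v hv
    rw [nb_union hd]
    rcases Finset.mem_union.1 hv with h | h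
    · have h1 : nb m v B ≤ cross m A B := by
        rw [← cross_singleton_left]; exact cross_mono (by simpa using h) subset_rfl
      have h2 : w₁ v + nb m v A ≤ D + 1 := hA.2 v h
      have h3 := hw₁ v h
      have h4 := hj.1
      by_cases hvx : v = x
      · subst hvx; omega
      · have := hcross v h hvx; omega
    · have h1 : nb m v A ≤ cross m A B := by
        rw [hm.cross_comm, ← cross_singleton_left]; exact cross_mono (by simpa using h) subset_rfl
      have h2 : w₂ v + nb m v B ≤ D + 1 := hB.2 v h
      have h3 := hw₂ v h
      have h4 := hj.2
      by_cases hvx : v = y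
      · subst hvx; omega
      · have := hcross' v h hvx; omega
  · intro S hS hne hcard
    have e : S = S ∩ A ∪ S ∩ B := by
      rw [← Finset.inter_union_distrib_left, Finset.inter_eq_left.2 hS]
    have hd' : Disjoint (S ∩ A) (S ∩ B) :=
      hd.mono Finset.inter_subset_right Finset.inter_subset_right
    have h1 := hm.ed_union hd'
    have h2 := Finset.card_union_of_disjoint hd'
    have hs : ∑ v ∈ S, w v = ∑ v ∈ S ∩ A, w v + ∑ v ∈ S ∩ B, w v := by
      rw [← Finset.sum_union hd', ← e]
    rw [← e] at h1 h2
    have h3 : cross m (S ∩ A) (S ∩ B) ≤ cross m A B :=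
      cross_mono Finset.inter_subset_right Finset.inter_subset_right
    have sA : ∑ v ∈ S ∩ A, w v ≤ ∑ v ∈ S ∩ A, w₁ v :=
      Finset.sum_le_sum fun v hv => hw₁ v (Finset.mem_inter.1 hv).2
    have sB : ∑ v ∈ S ∩ B, w v ≤ ∑ v ∈ S ∩ B, w₂ v :=
      Finset.sum_le_sum fun v hv => hw₂ v (Finset.mem_inter.1 hv).2
    rcases (S ∩ A).eq_empty_or_nonempty with ha | ha
    · rw [ha] at hs h1 h2 h3
      rw [ha, Finset.empty_union] at e
      simp at hs h1 h2 h3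
      have := hB.2 (S ∩ B) Finset.inter_subset_right (e ▸ hne) (by omega)
      omega
    rcases (S ∩ B).eq_empty_or_nonempty with hb | hb
    · rw [hb] at hs h1 h2 h3
      rw [hb, Finset.union_empty] at e
      simp at hs h1 h2 h3
      have := hA.2 (S ∩ A) Finset.inter_subset_right (e ▸ hne) (by omega)
      omega
    have fA := hA.1 _ Finset.inter_subset_right ha
    have fB := hB.1 _ Finset.inter_subset_right hb
    have cA : ∑ v ∈ S ∩ A, w₁ v ≤ D + 1 := hA.2 (S ∩ A) Finset.inter_subset_right ha (by omega)
    have cB : ∑ v ∈ S ∩ B, w₂ v ≤ D + 1 := hB.2 (S ∩ B) Finset.inter_subset_right hb (by omega)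
    -- The count `hcard` says that `S` is connected, so `S` uses the only crossing edge and contains
    -- both of its ends. The two raises are then included in the bounds on the sides, and the total
    -- is at most `2 (D + 1) - (k + l)`.
    have hpos : 0 < cross m (S ∩ A) (S ∩ B) := by omega
    obtain ⟨p, hp, q, hq, hpq⟩ := exists_of_cross_pos hpos
    have hpx : p = x := by
      by_contra hne'
      have := hcross p (Finset.mem_inter.1 hp).2 hne'
      have := le_nb (m := m) (v := p) (Finset.mem_inter.1 hq).2
      omega
    have hqy : q = y := by
      by_contra hne'
      have := hcross' q (Finset.mem_inter.1 hq).2 hne'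
      have := le_nb (m := m) (v := q) (Finset.mem_inter.1 hp).2
      rw [hm.symm] at this
      omega
    subst hpx hqy
    have sA' : ∑ v ∈ S ∩ A, w v + k ≤ ∑ v ∈ S ∩ A, w₁ v := by
      rw [← Finset.add_sum_erase _ _ hp, ← Finset.add_sum_erase _ w₁ hp]
      have : ∑ v ∈ (S ∩ A).erase p, w v ≤ ∑ v ∈ (S ∩ A).erase p, w₁ v :=
        Finset.sum_le_sum fun v hv => hw₁ v (Finset.mem_inter.1 (Finset.mem_of_mem_erase hv)).2
      omega
    have sB' : ∑ v ∈ S ∩ B, w v + l ≤ ∑ v ∈ S ∩ B, w₂ v := by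
      rw [← Finset.add_sum_erase _ _ hq, ← Finset.add_sum_erase _ w₂ hq]
      have : ∑ v ∈ (S ∩ B).erase q, w v ≤ ∑ v ∈ (S ∩ B).erase q, w₂ v :=
        Finset.sum_le_sum fun v hv => hw₂ v (Finset.mem_inter.1 (Finset.mem_of_mem_erase hv)).2
      omega
    have : D + 1 ≤ k + l := hj
    omega

lemma MOK.insert_of_nb_eq_zero (hm : IsMult m) {M : Finset α} {v : α} (hM : MOK t D m w M)
    (hv : v ∉ M) (hw : w v ≤ D + 1) (h : nb m v M = 0) : MOK t D m w (insert v M) := by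
  rw [Finset.insert_eq]
  exact (MOK.singleton hm hw).union hm hM (Finset.disjoint_singleton_left.2 hv) (by simpa using h)

lemma MOK.insert_of_nb_le_one (hm : IsMult m) {M : Finset α} {v : α} {k l : ℕ}
    (hM : MOK t D m w' M) (hv : v ∉ M) (hww : ∀ u ∈ M, w u ≤ w' u)
    (hk : ∀ u ∈ M, 1 ≤ m v u → w u + k ≤ w' u) (hw : w v + l ≤ D + 1) (hj : JoinOK t D k l)
    (h : nb m v M ≤ 1) : MOK t D m w (insert v M) := by
  rcases Nat.eq_zero_or_pos (nb m v M) with h0 | h0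
  · exact (hM.mono (fun _ _ _ _ => le_rfl) hww).insert_of_nb_eq_zero hm hv (by omega) h0
  obtain ⟨u, hu, huv⟩ := exists_of_nb_pos h0
  rw [Finset.insert_eq, Finset.union_comm]
  have hv' : MOK t D m (fun z => w z + l) {v} := MOK.singleton hm hw
  refine hM.join hm hv' (Finset.disjoint_singleton_right.2 hv) ?_ hu (Finset.mem_singleton_self v)
    (by rw [hm.symm]; exact huv) hww (fun _ _ => Nat.le_add_right _ _) (hk u hu huv) le_rfl hj
  rw [hm.cross_comm]
  simpa using h

lemma MOK.pair (hm : IsMult m) {u v : α} (huv : u ≠ v) (hmuv : m u v ≤ 1) (hu : 1 ≤ w u)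
    (hv : 1 ≤ w v) (h : w u + w v ≤ D + 1) : MOK t D m w {u, v} := by
  have hs : MOK t D m (fun z => w z + w u) {v} := MOK.singleton hm (by omega)
  -- With `k = w u` and `l = D + 1 - w u` the join condition holds for both kinds; `l ≥ 1` because
  -- `w v ≥ 1`.
  refine hs.insert_of_nb_le_one hm (k := w u) (l := D + 1 - w u) (by simpa using huv) (by simp)
    (by simp) (by omega) (JoinOK.of_add_le hu (by omega) (by omega)) (by simpa using hmuv)

/-- `(M, F)` is a coloring of the weighted multigraph on `V`. -/
structure IsCol (t : Kind) (D : ℕ) (m : α → α → ℕ) (w : α → ℕ) (V M F : Finset α) : Prop where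
  union_eq : M ∪ F = V
  disj : Disjoint M F
  left : MOK t D m w M
  right : ForestOn m F

/-- The weighted multigraph on `V` has a coloring. -/
def Colorable (t : Kind) (D : ℕ) (m : α → α → ℕ) (w : α → ℕ) (V : Finset α) : Prop :=
  ∃ M F, IsCol t D m w V M F

lemma IsCol.left_subset {V M F : Finset α} (h : IsCol t D m w V M F) : M ⊆ V :=
  h.union_eq ▸ Finset.subset_union_left

lemma IsCol.right_subset {V M F : Finset α} (h : IsCol t D m w V M F) : F ⊆ V :=
  h.union_eq ▸ Finset.subset_union_right

lemma IsCol.nb_add {V M F : Finset α} (h : IsCol t D m w V M F) (v : α) :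
    nb m v M + nb m v F = nb m v V := by
  rw [← h.union_eq, nb_union h.disj]

lemma IsCol.mem_or {V M F : Finset α} (h : IsCol t D m w V M F) {v : α} (hv : v ∈ V) :
    v ∈ M ∨ v ∈ F := by
  rw [← h.union_eq] at hv
  exact Finset.mem_union.1 hv

lemma IsCol.mono {V M F : Finset α} (h : IsCol t D m' w' V M F)
    (hmm : ∀ u ∈ V, ∀ v ∈ V, m u v ≤ m' u v) (hw : ∀ v ∈ V, w v ≤ w' v) : IsCol t D m w V M F where
  union_eq := h.union_eq
  disj := h.disj
  left := h.left.mono (fun u hu v hv => hmm u (h.left_subset hu) v (h.left_subset hv))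
    fun v hv => hw v (h.left_subset hv)
  right := h.right.mono (fun u hu v hv => hmm u (h.right_subset hu) v (h.right_subset hv))

lemma IsCol.insert_right (hm : IsMult m) {V M F : Finset α} {v : α} (h : IsCol t D m w V M F)
    (hv : v ∉ V) (hF : nb m v F ≤ 1) : IsCol t D m w (insert v V) M (insert v F) where
  union_eq := by rw [Finset.union_insert, h.union_eq]
  disj := Finset.disjoint_insert_right.2 ⟨fun hM => hv (h.left_subset hM), h.disj⟩
  left := h.left
  right := h.right.insert hm (fun hF => hv (h.right_subset hF)) hF

lemma IsCol.insert_left {V M F : Finset α} {v : α} (h : IsCol t D m w' V M F)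
    (hv : v ∉ V) (hM : MOK t D m w (insert v M)) : IsCol t D m w (insert v V) (insert v M) F where
  union_eq := by rw [Finset.insert_union, h.union_eq]
  disj := Finset.disjoint_insert_left.2 ⟨fun hM => hv (h.right_subset hM), h.disj⟩
  left := hM
  right := h.right

end Counting

/-! ### Potentials and sparse graphs. -/

/-- The data of a potential: the vertex potential `Φ` as a function of the weight, the potential
`E` of an edge, and the threshold `τ`. In the simple case only graphs without parallel edges are
considered. -/
structure Params where
  kind : Kind
  D : ℕ
  Φ : ℕ → ℤ
  E : ℤ
  τ : ℤ
  b : ℤ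
  simple : Bool

namespace Params

/-- The number of vertices that replace a contracted set. -/
def s₀ (P : Params) : ℕ := if P.simple then 2 else 1

/-- The potential of the vertices that replace a contracted set. -/
def f₁ (P : Params) : ℤ := if P.simple then 2 * P.Φ (P.D + 2) - P.E else P.Φ (P.D + 2)

/-- The properties of potentials on which the arguments rely. -/
structure Good (P : Params) : Prop where
  anti : Antitone P.Φ
  const : ∀ n, P.D + 2 ≤ n → P.Φ n = P.Φ (P.D + 2)
  f₁_pos : 0 < P.f₁
  le_E : P.Φ (P.D + 2) ≤ P.E
  τ_pos : 0 < P.τ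
  edge : ∀ n, 1 ≤ n → P.Φ n ≤ P.Φ (P.D + 2) + P.E
  lip : ∀ n k : ℕ, P.Φ n ≤ P.Φ (n + k) + P.b * k
  b_nonneg : 0 ≤ P.b

end Params

section Potential

variable {α : Type*} [DecidableEq α] {m m' : α → α → ℕ} {w w' : α → ℕ} {P : Params}

/-- The potential of a set of vertices. -/
def pot (P : Params) (m : α → α → ℕ) (w : α → ℕ) (A : Finset α) : ℤ :=
  ∑ v ∈ A, P.Φ (w v) - P.E * ed m A

/-- A weighted multigraph to which the potential applies. -/
structure Valid (P : Params) (m : α → α → ℕ) (w : α → ℕ) : Prop where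
  mult : IsMult m
  one_le : ∀ v, 1 ≤ w v
  simple : P.simple = true → ∀ u v, m u v ≤ 1

/-- Sparse weighted multigraphs on fewer than `n` vertices are colorable. -/
def Colors (α : Type*) [DecidableEq α] (P : Params) (n : ℕ) : Prop :=
  ∀ (V : Finset α) (m : α → α → ℕ) (w : α → ℕ), V.card < n → Valid P m w →
    (∀ A ⊆ V, A.Nonempty → -P.τ < pot P m w A) → Colorable P.kind P.D m w V

/-- The weighted multigraph on `V` is not colorable, but all its proper induced subgraphs are. -/
structure Critical (P : Params) (m : α → α → ℕ) (w : α → ℕ) (V : Finset α) : Prop where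
  not_colorable : ¬ Colorable P.kind P.D m w V
  colorable : ∀ A ⊂ V, Colorable P.kind P.D m w A

lemma Params.Good.f₁_le (hP : P.Good) : P.f₁ ≤ P.Φ (P.D + 2) := by
  have := hP.le_E
  unfold Params.f₁
  split_ifs <;> linarith

lemma Params.Good.f₀_pos (hP : P.Good) : 0 < P.Φ (P.D + 2) := hP.f₁_pos.trans_le hP.f₁_le

lemma Params.Good.E_pos (hP : P.Good) : 0 < P.E := hP.f₀_pos.trans_le hP.le_E

lemma Params.Good.f₀_le (hP : P.Good) (n : ℕ) : P.Φ (P.D + 2) ≤ P.Φ n := by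
  rcases le_total n (P.D + 2) with h | h
  · exact hP.anti h
  · exact (hP.const n h).ge

lemma Params.one_le_s₀ (P : Params) : 1 ≤ P.s₀ := by
  unfold Params.s₀; split_ifs <;> omega

@[simp] lemma pot_empty : pot P m w ∅ = 0 := by simp [pot]

lemma pot_union (hm : IsMult m) {A B : Finset α} (h : Disjoint A B) :
    pot P m w (A ∪ B) = pot P m w A + pot P m w B - P.E * cross m A B := by
  unfold pot
  rw [Finset.sum_union h, hm.ed_union h]
  push_cast
  ring

lemma pot_insert (hm : IsMult m) {v : α} {A : Finset α} (hv : v ∉ A) :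
    pot P m w (insert v A) = pot P m w A + P.Φ (w v) - P.E * nb m v A := by
  unfold pot
  rw [Finset.sum_insert hv, hm.ed_insert hv]
  push_cast
  ring

lemma pot_weight (hP : P.Good) {A : Finset α} (δ : α → ℕ) (hw : ∀ v ∈ A, w' v ≤ w v + δ v) :
    pot P m w A - P.b * ∑ v ∈ A, (δ v : ℤ) ≤ pot P m w' A := by
  have : ∑ v ∈ A, P.Φ (w v) ≤ ∑ v ∈ A, (P.Φ (w' v) + P.b * δ v) :=
    Finset.sum_le_sum fun v hv =>
      (hP.lip (w v) (δ v)).trans (add_le_add_left (hP.anti (hw v hv)) _)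
  rw [Finset.sum_add_distrib, ← Finset.mul_sum] at this
  unfold pot
  linarith

/-- Sets of at most `s₀` vertices never violate sparsity. The worst case is a root: one vertex of
weight `D + 2`, or an adjacent pair of such vertices when the graph is simple. -/
lemma f₁_le_pot (hP : P.Good) (hv : Valid P m w) {A : Finset α} (hne : A.Nonempty)
    (hA : A.card ≤ P.s₀) : P.f₁ ≤ pot P m w A := by
  have h1 : A.card = 1 ∨ (A.card = 2 ∧ P.simple = true) := by
    have := hne.card_pos
    unfold Params.s₀ at hA
    split_ifs at hA with h
    · rcases (by omega : A.card = 1 ∨ A.card = 2) with h' | h'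
      exacts [Or.inl h', Or.inr ⟨h', h⟩]
    · left; omega
  rcases h1 with h1 | ⟨h1, hs⟩
  · obtain ⟨v, rfl⟩ := Finset.card_eq_one.1 h1
    simp only [pot, Finset.sum_singleton, hv.mult.ed_singleton]
    have := hP.f₁_le
    have := hP.f₀_le (w v)
    simp; linarith
  · obtain ⟨u, v, huv, rfl⟩ := Finset.card_eq_two.1 h1
    have h2 : (m u v : ℤ) ≤ 1 := by exact_mod_cast hv.simple hs u v
    have h3 := hP.f₀_le (w u)
    have h4 := hP.f₀_le (w v)
    have h5 := hP.E_pos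
    simp only [pot, Finset.sum_pair huv, hv.mult.ed_pair huv, Params.f₁, hs, if_true]
    nlinarith

lemma colorable_of_pot (hP : P.Good) {n : ℕ} (hC : Colors α P n) (hv : Valid P m w) {A : Finset α}
    (hA : A.card < n) (h : ∀ B ⊆ A, P.s₀ < B.card → -P.τ < pot P m w B) :
    Colorable P.kind P.D m w A := by
  refine hC A m w hA hv fun B hB hne => ?_
  by_cases hc : P.s₀ < B.card
  · exact h B hB hc
  · have := f₁_le_pot hP hv hne (not_lt.1 hc)
    have := hP.f₁_pos
    have := hP.τ_pos
    linarith

/-! ### Contraction of a colored part to a root. -/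

/-- The multigraph on `U` with a new vertex `f`, joined to each `v` in `U` by `κ v` edges. -/
def addVertex (m : α → α → ℕ) (U : Finset α) (f : α) (κ : α → ℕ) (u v : α) : ℕ :=
  if u ∈ U ∧ v ∈ U then m u v else if u = f ∧ v ∈ U then κ v else if v = f ∧ u ∈ U then κ u else 0

section AddVertex

variable {U : Finset α} {f : α} {κ : α → ℕ}

lemma IsMult.addVertex (hm : IsMult m) : IsMult (addVertex m U f κ) where
  symm u v := by
    unfold ForestPartition.addVertex
    by_cases hu : u ∈ U <;> by_cases hv : v ∈ U <;> simp [hu, hv, hm.symm u v]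
  diag v := by
    unfold ForestPartition.addVertex
    by_cases hu : v ∈ U <;> simp [hu, hm.diag]

lemma addVertex_of_mem {u v : α} (hu : u ∈ U) (hv : v ∈ U) : addVertex m U f κ u v = m u v := by
  simp [addVertex, hu, hv]

lemma ed_addVertex {A : Finset α} (hA : A ⊆ U) : ed (addVertex m U f κ) A = ed m A :=
  ed_congr fun _ hu _ hv => addVertex_of_mem (hA hu) (hA hv)

lemma nb_addVertex (hf : f ∉ U) {A : Finset α} (hA : A ⊆ U) :
    nb (addVertex m U f κ) f A = ∑ v ∈ A, κ v :=
  Finset.sum_congr rfl fun v hv => by simp [addVertex, hf, hA hv]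

lemma addVertex_le_one (hm : ∀ u v, m u v ≤ 1) (hκ : ∀ v, κ v ≤ 1) (u v : α) :
    addVertex m U f κ u v ≤ 1 := by
  unfold addVertex
  split_ifs
  exacts [hm u v, hκ v, hκ u, Nat.zero_le _]

lemma pot_addVertex {A : Finset α} (hA : A ⊆ U) (hw : ∀ v ∈ U, w v = w' v) :
    pot P (addVertex m U f κ) w A = pot P m w' A := by
  unfold pot
  rw [ed_addVertex hA, Finset.sum_congr rfl fun v hv => by rw [hw v (hA hv)]]

lemma pot_insert_addVertex (hm : IsMult m) (hf : f ∉ U) {A : Finset α} (hA : A ⊆ U)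
    (hw : ∀ v ∈ U, w v = w' v) :
    pot P (addVertex m U f κ) w (insert f A) =
      pot P m w' A + P.Φ (w f) - P.E * ∑ v ∈ A, (κ v : ℤ) := by
  rw [pot_insert (hm.addVertex) (fun h => hf (hA h)), pot_addVertex hA hw, nb_addVertex hf hA]
  push_cast
  rfl

end AddVertex

/-- A set that is sparse together with a contracted part of color `F` has a coloring that is
compatible with the contracted part. -/
lemma exists_rooted_coloring (hP : P.Good) {n : ℕ} (hC : Colors α P n) (hv : Valid P m w)
    {U : Finset α} {f g : α} (hf : f ∉ U) (hg : g ∉ U) (hfg : f ≠ g) (hcard : U.card + P.s₀ < n)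
    (κ : α → ℕ) (h1 : ∀ A ⊆ U, A.Nonempty → -P.τ < pot P m w A)
    (h2 : ∀ A ⊆ U, -P.τ < pot P m w A + P.f₁ - P.E * ∑ v ∈ A, (κ v : ℤ)) :
    ∃ M F, IsCol P.kind P.D m w U M F ∧ ∀ S ⊆ F, ed m S + ∑ v ∈ S, κ v ≤ S.card := by
  set w₁ : α → ℕ := fun v => if v ∈ U then w v else P.D + 2 with hw₁
  have hwU : ∀ v ∈ U, w₁ v = w v := fun v hv => by simp [hw₁, hv]
  have hw₁_one : ∀ v, 1 ≤ w₁ v := fun v => by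
    simp only [hw₁]; split_ifs
    exacts [hv.one_le v, by omega]
  have hw₁f : w₁ f = P.D + 2 := by simp [hw₁, hf]
  have hw₁g : w₁ g = P.D + 2 := by simp [hw₁, hg]
  have hE := hP.E_pos
  by_cases hs : P.simple = true
  · have hs₀ : P.s₀ = 2 := by simp [Params.s₀, hs]
    have hf₁ : P.f₁ = 2 * P.Φ (P.D + 2) - P.E := by simp [Params.f₁, hs]
    -- The root is an edge `fg`, and the value `κ₂ f = 1` encodes this edge. A vertex with at least
    -- two edges to the contracted part is joined to both roots, making a triangle. Multiplicities
    -- above two are cut off.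
    set κ₁ : α → ℕ := fun v => min 1 (κ v) with hκ₁
    set κ₂ : α → ℕ := fun v => if v = f then 1 else if 2 ≤ κ v then 1 else 0 with hκ₂
    have hκ₂U : ∀ A ⊆ U, ∀ v ∈ A, κ₁ v + κ₂ v ≤ κ v := by
      intro A hA v hv
      have : v ≠ f := fun h => hf (h ▸ hA hv)
      simp only [hκ₁, hκ₂, this, if_false]
      split_ifs <;> omega
    set m₁ := addVertex m U f κ₁ with hm₁
    set m₂ := addVertex m₁ (insert f U) g κ₂ with hm₂
    have hg' : g ∉ insert f U := by simp [hg, hfg.symm]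
    have hM₁ : IsMult m₁ := hv.mult.addVertex
    have hM₂ : IsMult m₂ := hM₁.addVertex
    have hvalid : Valid P m₂ w₁ := by
      refine ⟨hM₂, hw₁_one, fun _ => addVertex_le_one (addVertex_le_one (hv.simple hs) ?_) ?_⟩
      · intro v; simp [hκ₁]
      · intro v; simp only [hκ₂]; split_ifs <;> omega
    have hw₂ : ∀ v ∈ insert f U, w₁ v = w₁ v := fun _ _ => rfl
    have hsumf : ∀ A ⊆ U, ∑ v ∈ insert f A, (κ₂ v : ℤ) = 1 + ∑ v ∈ A, (κ₂ v : ℤ) := by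
      intro A hA
      rw [Finset.sum_insert fun h => hf (hA h)]
      simp [hκ₂]
    have hbound : ∀ A ⊆ U, ∑ v ∈ A, (κ₁ v : ℤ) + ∑ v ∈ A, (κ₂ v : ℤ) ≤ ∑ v ∈ A, (κ v : ℤ) := by
      intro A hA
      rw [← Finset.sum_add_distrib]
      exact Finset.sum_le_sum fun v hv => by exact_mod_cast hκ₂U A hA v hv
    have hpos₁ : ∀ A : Finset α, 0 ≤ ∑ v ∈ A, (κ₁ v : ℤ) := fun A =>
      Finset.sum_nonneg fun _ _ => Int.natCast_nonneg _
    have hpos₂ : ∀ A : Finset α, 0 ≤ ∑ v ∈ A, (κ₂ v : ℤ) := fun A =>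
      Finset.sum_nonneg fun _ _ => Int.natCast_nonneg _
    have hf₁le := hP.f₁_le
    have hpot : ∀ A ⊆ U, pot P m₂ w₁ A = pot P m w A := fun A hA => by
      rw [hm₂, pot_addVertex (hA.trans (Finset.subset_insert _ _)) hw₂, pot_addVertex hA hwU]
    have hpotf : ∀ A ⊆ U, pot P m₂ w₁ (insert f A) =
        pot P m w A + P.Φ (P.D + 2) - P.E * ∑ v ∈ A, (κ₁ v : ℤ) := fun A hA => by
      rw [hm₂, pot_addVertex (Finset.insert_subset_insert _ hA) hw₂,
        pot_insert_addVertex hv.mult hf hA hwU, hw₁f]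
    have hpotg : ∀ A ⊆ U, pot P m₂ w₁ (insert g A) =
        pot P m w A + P.Φ (P.D + 2) - P.E * ∑ v ∈ A, (κ₂ v : ℤ) := fun A hA => by
      rw [hm₂, pot_insert_addVertex hM₁ hg' (hA.trans (Finset.subset_insert _ _)) hw₂,
        pot_addVertex hA hwU, hw₁g]
    have hpotfg : ∀ A ⊆ U, pot P m₂ w₁ (insert g (insert f A)) = pot P m w A + P.Φ (P.D + 2) -
        P.E * ∑ v ∈ A, (κ₁ v : ℤ) + P.Φ (P.D + 2) - P.E * (1 + ∑ v ∈ A, (κ₂ v : ℤ)) := fun A hA => by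
      rw [hm₂, pot_insert_addVertex hM₁ hg' (Finset.insert_subset_insert _ hA) hw₂,
        pot_insert_addVertex hv.mult hf hA hwU, hw₁f, hw₁g, hsumf A hA]
    obtain ⟨M, F, hcol⟩ := hC (insert g (insert f U)) m₂ w₁ (by
        rw [Finset.card_insert_of_notMem hg', Finset.card_insert_of_notMem hf]; omega) hvalid (by
      intro A hA hne
      -- Every set with a root reduces to `h2`: one root contributes `Φ (D + 2) ≥ f₁`, and both
      -- together contribute `2 Φ (D + 2) - E = f₁`.
      set B := (A.erase g).erase f with hB
      have hBU : B ⊆ U := by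
        intro v hv'
        simp only [hB, Finset.mem_erase] at hv'
        have := hA hv'.2.2
        simp only [Finset.mem_insert] at this
        tauto
      have hb := hbound B hBU
      have hp1 := hpos₁ B
      have hp2 := hpos₂ B
      have h2' := h2 B hBU
      by_cases hgA : g ∈ A
      · by_cases hfA : f ∈ A
        · have e : A = insert g (insert f B) := by
            rw [hB, Finset.insert_erase (Finset.mem_erase.2 ⟨hfg, hfA⟩), Finset.insert_erase hgA]
          rw [e, hpotfg B hBU]
          nlinarith
        · have e : A = insert g B := by
            rw [hB, Finset.erase_eq_of_notMem (fun h => hfA (Finset.mem_of_mem_erase h)),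
              Finset.insert_erase hgA]
          rw [e, hpotg B hBU]
          nlinarith
      · by_cases hfA : f ∈ A
        · have e : A = insert f B := by
            rw [hB, Finset.erase_eq_of_notMem hgA, Finset.insert_erase hfA]
          rw [e, hpotf B hBU]
          nlinarith
        · have e : A = B := by
            rw [hB, Finset.erase_eq_of_notMem hgA, Finset.erase_eq_of_notMem hfA]
          rw [e, hpot B hBU]
          exact h1 B hBU (e ▸ hne))
    -- The weight `D + 2` is too large for `M`, so both roots are in `F`.
    have hfM : f ∉ M := fun h => by have := hcol.left.weight_le h; omega
    have hgM : g ∉ M := fun h => by have := hcol.left.weight_le h; omega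
    have hfF : f ∈ F := (hcol.mem_or (by simp)).resolve_left hfM
    have hgF : g ∈ F := (hcol.mem_or (by simp)).resolve_left hgM
    have hMU : M ⊆ U := fun v hv' => by
      have := hcol.left_subset hv'
      simp only [Finset.mem_insert] at this
      rcases this with rfl | rfl | h
      exacts [absurd hv' hgM, absurd hv' hfM, h]
    have hFU : (F.erase g).erase f ⊆ U := fun v hv' => by
      simp only [Finset.mem_erase] at hv'
      have := hcol.right_subset hv'.2.2
      simp only [Finset.mem_insert] at this
      tauto
    have hm₂U : ∀ u ∈ U, ∀ v ∈ U, m u v = m₂ u v := fun u hu v hv' => by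
      rw [hm₂, addVertex_of_mem (Finset.mem_insert_of_mem hu) (Finset.mem_insert_of_mem hv'), hm₁,
        addVertex_of_mem hu hv']
    refine ⟨M, (F.erase g).erase f, ⟨?_, ?_, ?_, ?_⟩, ?_⟩
    · ext v
      have := congrArg (v ∈ ·) hcol.union_eq
      simp only [Finset.mem_union, Finset.mem_insert, eq_iff_iff, Finset.mem_erase] at this ⊢
      constructor
      · rintro (h | h)
        exacts [hMU h, hFU (by simp [h])]
      · intro h
        have hvf : v ≠ f := fun e => hf (e ▸ h)
        have hvg : v ≠ g := fun e => hg (e ▸ h)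
        tauto
    · exact hcol.disj.mono_right ((Finset.erase_subset _ _).trans (Finset.erase_subset _ _))
    · exact hcol.left.mono (fun u hu v hv' => (hm₂U u (hMU hu) v (hMU hv')).le)
        fun v hv' => (hwU v (hMU hv')).ge
    · exact (hcol.right.subset ((Finset.erase_subset _ _).trans (Finset.erase_subset _ _))).mono
        fun u hu v hv' => (hm₂U u (hFU hu) v (hFU hv')).le
    · have key : ∀ S ⊆ (F.erase g).erase f, ed m S + ∑ v ∈ S, (κ₁ v + κ₂ v) ≤ S.card := by
        intro S hS
        have hSU := hS.trans hFU
        have hfS : f ∉ S := fun h => hf (hSU h)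
        have hgS : g ∉ insert f S := fun h => hg' (Finset.insert_subset_insert _ hSU h)
        have h3 := hcol.right (insert g (insert f S)) (by
          intro v hv'
          simp only [Finset.mem_insert] at hv'
          rcases hv' with rfl | rfl | h
          · exact hgF
          · exact hfF
          · have := hS h
            simp only [Finset.mem_erase] at this
            exact this.2.2) (by simp)
        rw [hM₂.ed_insert hgS, Finset.card_insert_of_notMem hgS, Finset.card_insert_of_notMem hfS,
          hm₂, ed_addVertex (Finset.insert_subset_insert _ hSU),
          nb_addVertex hg' (Finset.insert_subset_insert _ hSU), Finset.sum_insert hfS,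
          hM₁.ed_insert hfS, hm₁, ed_addVertex hSU, nb_addVertex hf hSU] at h3
        have h4 : κ₂ f = 1 := by simp [hκ₂]
        rw [Finset.sum_add_distrib]
        omega
      intro S hS
      -- For a singleton the count gives `κ₁ v + κ₂ v ≤ 1`. Hence `κ v ≤ 1`, and the truncation has
      -- lost nothing on `F`.
      have hκ : ∀ v ∈ S, κ v = κ₁ v + κ₂ v := by
        intro v hvS
        have h3 := key {v} (by simpa using hS hvS)
        have hvf : v ≠ f := fun e => hf (e ▸ hFU (hS hvS))
        simp only [hκ₁, hκ₂, Finset.sum_singleton, Finset.card_singleton, hvf, if_false] at h3 ⊢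
        split_ifs at h3 ⊢ <;> omega
      rw [Finset.sum_congr rfl hκ]
      exact key S hS
  · have hs₀ : P.s₀ = 1 := by simp [Params.s₀, hs]
    have hf₁ : P.f₁ = P.Φ (P.D + 2) := by simp [Params.f₁, hs]
    set m₁ := addVertex m U f κ with hm₁
    have hM₁ : IsMult m₁ := hv.mult.addVertex
    obtain ⟨M, F, hcol⟩ := hC (insert f U) m₁ w₁ (by
        rw [Finset.card_insert_of_notMem hf]; omega) ⟨hM₁, hw₁_one, fun h => absurd h hs⟩ (by
      intro A hA hne
      by_cases hfA : f ∈ A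
      · have hBU : A.erase f ⊆ U := fun v hv' =>
          (Finset.mem_insert.1 (hA (Finset.mem_of_mem_erase hv'))).resolve_left
            (Finset.ne_of_mem_erase hv')
        rw [← Finset.insert_erase hfA, hm₁, pot_insert_addVertex hv.mult hf hBU hwU, hw₁f, ← hf₁]
        exact h2 _ hBU
      · have hBU : A ⊆ U := (Finset.subset_insert_iff_of_notMem hfA).1 hA
        rw [hm₁, pot_addVertex hBU hwU]
        exact h1 A hBU hne)
    have hfM : f ∉ M := fun h => by have := hcol.left.weight_le h; omega
    have hfF : f ∈ F := (hcol.mem_or (by simp)).resolve_left hfM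
    have hMU : M ⊆ U := fun v hv' =>
      (Finset.mem_insert.1 (hcol.left_subset hv')).resolve_left fun e => hfM (e ▸ hv')
    have hFU : F.erase f ⊆ U := fun v hv' =>
      (Finset.mem_insert.1 (hcol.right_subset (Finset.mem_of_mem_erase hv'))).resolve_left
        (Finset.ne_of_mem_erase hv')
    have hm₂U : ∀ u ∈ U, ∀ v ∈ U, m u v = m₁ u v := fun u hu v hv' => by
      rw [hm₁, addVertex_of_mem hu hv']
    refine ⟨M, F.erase f, ⟨?_, ?_, ?_, ?_⟩, ?_⟩
    · ext v
      have := congrArg (v ∈ ·) hcol.union_eq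
      simp only [Finset.mem_union, Finset.mem_insert, eq_iff_iff, Finset.mem_erase] at this ⊢
      constructor
      · rintro (h | h)
        exacts [hMU h, hFU (by simp [h])]
      · intro h
        have hvf : v ≠ f := fun e => hf (e ▸ h)
        tauto
    · exact hcol.disj.mono_right (Finset.erase_subset _ _)
    · exact hcol.left.mono (fun u hu v hv' => (hm₂U u (hMU hu) v (hMU hv')).le)
        fun v hv' => (hwU v (hMU hv')).ge
    · exact (hcol.right.subset (Finset.erase_subset _ _)).mono
        fun u hu v hv' => (hm₂U u (hFU hu) v (hFU hv')).le
    · intro S hS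
      have hSU := hS.trans hFU
      have hfS : f ∉ S := fun h => hf (hSU h)
      have h3 := hcol.right (insert f S)
        (Finset.insert_subset hfF (hS.trans (Finset.erase_subset _ _))) (by simp)
      rw [hM₁.ed_insert hfS, Finset.card_insert_of_notMem hfS, hm₁, ed_addVertex hSU,
        nb_addVertex hf hSU] at h3
      omega

/-- Two colored parts combine if the second one is compatible with the contraction of the first. -/
lemma forestOn_union_of_rooted (hm : IsMult m) {F₁ F₂ : Finset α} (h1 : ForestOn m F₁)
    (h2 : ForestOn m F₂) (hd : Disjoint F₁ F₂)
    (h : ∀ S ⊆ F₂, ed m S + ∑ v ∈ S, nb m v F₁ ≤ S.card) : ForestOn m (F₁ ∪ F₂) := by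
  intro S hS hne
  have e : S = S ∩ F₁ ∪ S ∩ F₂ := by
    rw [← Finset.inter_union_distrib_left, Finset.inter_eq_left.2 hS]
  have hd' : Disjoint (S ∩ F₁) (S ∩ F₂) :=
    hd.mono Finset.inter_subset_right Finset.inter_subset_right
  have h3 := hm.ed_union hd'
  have h4 := Finset.card_union_of_disjoint hd'
  rw [← e] at h3 h4
  rcases (S ∩ F₁).eq_empty_or_nonempty with ha | ha
  · rw [ha, Finset.empty_union] at e
    rw [e] at hne ⊢
    exact h2 _ Finset.inter_subset_right hne
  have h5 := h1 _ Finset.inter_subset_right ha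
  have h6 := h (S ∩ F₂) Finset.inter_subset_right
  have h7 : cross m (S ∩ F₁) (S ∩ F₂) ≤ ∑ v ∈ S ∩ F₂, nb m v F₁ := by
    rw [hm.cross_comm]
    exact Finset.sum_le_sum fun v _ => nb_mono Finset.inter_subset_right
  omega

end Potential

/-! ### The gap lemma. -/

section Gap

variable {α : Type*} [DecidableEq α] {m m' : α → α → ℕ} {w w' : α → ℕ} {P : Params}

/-- The weight of `x` increased by `k`. -/
def raise (w : α → ℕ) (x : α) (k : ℕ) (v : α) : ℕ := if v = x then w v + k else w v

lemma le_raise (w : α → ℕ) (x : α) (k : ℕ) (v : α) : w v ≤ raise w x k v := by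
  unfold raise; split_ifs <;> omega

@[simp] lemma raise_self (w : α → ℕ) (x : α) (k : ℕ) : raise w x k x = w x + k := by simp [raise]

lemma Valid.of_le (hv : Valid P m w) (h : ∀ v, w v ≤ w' v) : Valid P m w' :=
  ⟨hv.mult, fun v => (hv.one_le v).trans (h v), hv.simple⟩

/-- If the rest of the graph, modified according to a coloring of `A`, were sparse, the two
colorings would combine. So a set `B` of potential at most `-τ` exists, with or without the root,
and `hmin` forces `A ∪ B = V`. The gain is `f₁` if the root is used, and otherwise `E - c`, which
comes from the edge `xy`. -/
lemma gap_step (hP : P.Good) (hv : Valid P m w) {V A : Finset α} (hC : Colors α P V.card)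
    (hcrit : ¬ Colorable P.kind P.D m w V) (hA : A ⊆ V) (hs : P.s₀ < A.card)
    (hmin : ∀ A₂, A ⊂ A₂ → A₂ ⊂ V → pot P m w A - P.τ < pot P m w A₂)
    {x y : α} (hx : x ∈ A) (hy : y ∈ V) (hyA : y ∉ A) (hxy : 1 ≤ m x y) {k l : ℕ} {c : ℤ}
    (hc0 : 0 ≤ c) (hc : ∀ n, 1 ≤ n → P.Φ n ≤ P.Φ (n + l) + c)
    (hkl : P.D + 1 ≤ k ∨ P.D + 1 ≤ l ∨ JoinOK P.kind P.D k l)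
    (hcol : Colorable P.kind P.D m (raise w x k) A) :
    pot P m w V ≤ pot P m w A - P.τ - min P.f₁ (P.E - c) := by
  obtain ⟨M, F, hcol⟩ := hcol
  have hm := hv.mult
  have hE := hP.E_pos
  have hτ := hP.τ_pos
  set U := V \ A with hU
  have hAU : Disjoint A U := Finset.disjoint_sdiff
  have hV : A ∪ U = V := Finset.union_sdiff_of_subset hA
  have hyU : y ∈ U := Finset.mem_sdiff.2 ⟨hy, hyA⟩
  have hMA := hcol.left_subset
  have hFA := hcol.right_subset
  -- Two vertices of `A` are reused as names for the roots, since they lie outside `U`.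
  obtain ⟨f, hf, g, hg, hfg⟩ := Finset.one_lt_card.1 (lt_of_le_of_lt P.one_le_s₀ hs)
  -- Vertices with an edge to `M` are forced into `F` by the weight `D + 2`. The exception is `y`
  -- when `xy` is its only edge to `M`: its weight grows just by `l`, and the raise `k` at `x`
  -- covers the rest.
  set w₁ : α → ℕ := fun v => if nb m v M = 0 then w v
    else if x ∈ M ∧ v = y ∧ nb m y M = 1 then w y + l else P.D + 2 with hw₁
  have hw₁one : ∀ v, 1 ≤ w₁ v := fun v => by
    have h1 := hv.one_le v
    have h2 := hv.one_le y
    simp only [hw₁]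
    split_ifs <;> omega
  have hvalid : Valid P m w₁ := ⟨hm, hw₁one, hv.simple⟩
  have hwnb : ∀ v ∈ U, nb m v A = nb m v M + nb m v F := fun v _ => (hcol.nb_add v).symm

  -- The first edge to `M` already pays for any increase of weight: by `Good.edge`, raising a weight
  -- never costs more than `E`.
  have hpt : ∀ v, P.Φ (w v) - P.E * nb m v M ≤ P.Φ (w₁ v) := by
    intro v
    simp only [hw₁]
    split_ifs with h1 h2
    · simp [h1]
    · obtain ⟨_, rfl, h3⟩ := h2
      have h4 := hP.edge (w v) (hv.one_le v)
      have h5 := hP.f₀_le (w v + l)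
      rw [h3]; push_cast; linarith
    · have h4 := hP.edge (w v) (hv.one_le v)
      have h5 : (1 : ℤ) ≤ nb m v M := by exact_mod_cast Nat.one_le_iff_ne_zero.2 h1
      nlinarith
  -- The vertex `y` gains `E - c`. Its edge to `x` goes to `F`, which `w₁` does not see, or is its
  -- only edge to `M`, with cost `c` instead of `E`, or is one of at least two edges to `M`, of
  -- which only one is needed.
  have hpty : P.Φ (w y) - P.E * nb m y A ≤ P.Φ (w₁ y) - (P.E - c) := by
    rw [hwnb y hyU]
    push_cast
    rcases hcol.mem_or hx with hxM | hxF
    · have h1 : 1 ≤ nb m y M := le_trans (by rw [hm.symm]; exact hxy) (le_nb hxM)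
      have h0 : (0 : ℤ) ≤ nb m y F := Int.natCast_nonneg _
      rcases h1.eq_or_lt with h2 | h2
      · have h3 : w₁ y = w y + l := by simp [hw₁, ← h2, hxM]
        have h4 := hc (w y) (hv.one_le y)
        rw [h3, ← h2]
        push_cast
        nlinarith
      · have h3 : w₁ y = P.D + 2 := by
          simp only [hw₁]
          rw [if_neg (by omega), if_neg (by rintro ⟨_, _, h⟩; omega)]
        have h4 := hP.edge (w y) (hv.one_le y)
        have h5 : (2 : ℤ) ≤ nb m y M := by exact_mod_cast h2
        rw [h3]
        nlinarith
    · have h1 : 1 ≤ nb m y F := le_trans (by rw [hm.symm]; exact hxy) (le_nb hxF)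
      have h2 : (1 : ℤ) ≤ nb m y F := by exact_mod_cast h1
      have h3 := hpt y
      nlinarith
  have hpotU : ∀ B ⊆ U, pot P m w (A ∪ B) = pot P m w A +
      (∑ v ∈ B, (P.Φ (w v) - P.E * nb m v A) - P.E * ed m B) := by
    intro B hB
    rw [pot_union hm (hAU.mono_right hB), hm.cross_eq_sum, Finset.sum_sub_distrib, ← Finset.mul_sum]
    unfold pot
    push_cast
    ring
  have hssub : ∀ B ⊆ U, B.Nonempty → A ⊂ A ∪ B := by
    intro B hB ⟨v, hvB⟩
    refine Finset.ssubset_iff_subset_ne.2 ⟨Finset.subset_union_left, fun e => ?_⟩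
    have : v ∈ A := by rw [e]; exact Finset.mem_union_right _ hvB
    exact (Finset.mem_sdiff.1 (hB hvB)).2 this
  have hsubV : ∀ B ⊆ U, A ∪ B ⊆ V := fun B hB => hV ▸ Finset.union_subset_union_right hB
  have hUcard : U.card + P.s₀ < V.card := by
    have := Finset.card_union_of_disjoint hAU
    rw [hV] at this
    omega
  by_cases h1 : ∀ B ⊆ U, B.Nonempty → -P.τ < pot P m w₁ B
  swap
  · push Not at h1
    obtain ⟨B, hB, hne, hpB⟩ := h1
    have e := hpotU B hB
    by_cases hBV : A ∪ B = V
    · have hyB : y ∈ B := by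
        have : y ∈ A ∪ B := hBV ▸ hy
        exact (Finset.mem_union.1 this).resolve_left hyA
      have h2 : ∑ v ∈ B, (P.Φ (w v) - P.E * nb m v A) ≤ ∑ v ∈ B, P.Φ (w₁ v) - (P.E - c) := by
        rw [← Finset.add_sum_erase _ _ hyB, ← Finset.add_sum_erase _ (fun v => P.Φ (w₁ v)) hyB]
        have : ∑ v ∈ B.erase y, (P.Φ (w v) - P.E * nb m v A) ≤ ∑ v ∈ B.erase y, P.Φ (w₁ v) := by
          refine Finset.sum_le_sum fun v hvB => le_trans ?_ (hpt v)
          rw [hwnb v (hB (Finset.mem_of_mem_erase hvB))]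
          push_cast
          have h0 : (0 : ℤ) ≤ nb m v F := Int.natCast_nonneg _
          nlinarith
        linarith
      rw [hBV] at e
      have h3 := min_le_right P.f₁ (P.E - c)
      unfold pot at hpB
      linarith
    -- A larger proper subset of such low potential contradicts `hmin`.
    · exfalso
      have h2 : ∑ v ∈ B, (P.Φ (w v) - P.E * nb m v A) ≤ ∑ v ∈ B, P.Φ (w₁ v) := by
        refine Finset.sum_le_sum fun v hvB => le_trans ?_ (hpt v)
        rw [hwnb v (hB hvB)]
        push_cast
        have h0 : (0 : ℤ) ≤ nb m v F := Int.natCast_nonneg _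
        nlinarith
      have h3 := hmin _ (hssub B hB hne) (Finset.ssubset_iff_subset_ne.2 ⟨hsubV B hB, hBV⟩)
      unfold pot at hpB
      linarith
  by_cases h2 : ∀ B ⊆ U, -P.τ < pot P m w₁ B + P.f₁ - P.E * ∑ v ∈ B, (nb m v F : ℤ)
  swap
  · push Not at h2
    obtain ⟨B, hB, hpB⟩ := h2
    have e := hpotU B hB
    have hf₁ := hP.f₁_pos
    -- The root alone has potential `f₁ > 0`.
    have hne : B.Nonempty := by
      by_contra hB0
      rw [Finset.not_nonempty_iff_eq_empty.1 hB0] at hpB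
      simp at hpB
      linarith
    have h2 : ∑ v ∈ B, (P.Φ (w v) - P.E * nb m v A) ≤
        ∑ v ∈ B, (P.Φ (w₁ v) - P.E * (nb m v F : ℤ)) := by
      refine Finset.sum_le_sum fun v hvB => ?_
      have := hpt v
      rw [hwnb v (hB hvB)]
      push_cast
      linarith
    rw [Finset.sum_sub_distrib (fun v => P.Φ (w₁ v)), ← Finset.mul_sum] at h2
    by_cases hBV : A ∪ B = V
    · rw [hBV] at e
      have h3 := min_le_left P.f₁ (P.E - c)
      unfold pot at hpB
      linarith
    · exfalso
      have h3 := hmin _ (hssub B hB hne) (Finset.ssubset_iff_subset_ne.2 ⟨hsubV B hB, hBV⟩)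
      unfold pot at hpB
      linarith
  exfalso
  obtain ⟨M', F', hcol', hroot⟩ := exists_rooted_coloring hP hC hvalid (U := U)
    (fun h => (Finset.mem_sdiff.1 h).2 hf) (fun h => (Finset.mem_sdiff.1 h).2 hg) hfg hUcard
    (fun v => nb m v F) h1 h2
  have hM'U := hcol'.left_subset
  have hF'U := hcol'.right_subset
  apply hcrit
  refine ⟨M ∪ M', F ∪ F', ?_, ?_, ?_, ?_⟩
  · rw [← hV, ← hcol.union_eq, ← hcol'.union_eq]
    ext v; simp only [Finset.mem_union]; tauto
  · rw [Finset.disjoint_union_left, Finset.disjoint_union_right, Finset.disjoint_union_right]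
    exact ⟨⟨hcol.disj, hAU.mono hMA hF'U⟩, (hAU.mono hFA hM'U).symm, hcol'.disj⟩
  · have hdM : Disjoint M M' := hAU.mono hMA hM'U
    -- Because of the weight `D + 2`, the only possible edge between the two `M`-parts is `xy`.
    have hnb0 : ∀ v ∈ M', nb m v M ≠ 0 → x ∈ M ∧ v = y ∧ nb m y M = 1 := by
      intro v hvM hne
      by_contra hcon
      have h3 := hcol'.left.weight_le hvM
      simp only [hw₁] at h3
      rw [if_neg hne, if_neg hcon] at h3
      omega
    have hww : ∀ v ∈ M', w v ≤ w₁ v := by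
      intro v hvM
      by_cases h0 : nb m v M = 0
      · simp [hw₁, h0]
      · obtain ⟨h3, rfl, h4⟩ := hnb0 v hvM h0
        simp [hw₁, h3, h4]
    by_cases hcase : y ∈ M' ∧ nb m y M ≠ 0
    · obtain ⟨hyM', hy0⟩ := hcase
      obtain ⟨hxM, -, hy1⟩ := hnb0 y hyM' hy0
      have hwy : w₁ y = w y + l := by simp [hw₁, hxM, hy1]
      have hcr : cross m M M' ≤ 1 := by
        rw [hm.cross_eq_sum, ← Finset.add_sum_erase _ _ hyM', hy1]
        have : ∑ v ∈ M'.erase y, nb m v M = 0 := Finset.sum_eq_zero fun v hvM => by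
          by_contra hne
          exact Finset.ne_of_mem_erase hvM (hnb0 v (Finset.mem_of_mem_erase hvM) hne).2.1
        omega
      have hly := hcol'.left.weight_le hyM'
      have hkx := hcol.left.weight_le hxM
      rw [raise_self] at hkx
      have hx1 := hv.one_le x
      have hy1' := hv.one_le y
      -- If `k` or `l` is at least `D + 1`, then `x` or `y` is too heavy for `M`, and this case does
      -- not occur.
      have hj : JoinOK P.kind P.D k l := by
        rcases hkl with h | h | h
        · omega
        · omega
        · exact h
      exact hcol.left.join hm hcol'.left hdM hcr hxM hyM' hxy (fun v _ => le_raise w x k v) hww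
        (raise_self w x k).ge hwy.ge hj
    · have hcr : cross m M M' = 0 := by
        rw [hm.cross_eq_sum]
        refine Finset.sum_eq_zero fun v hvM => ?_
        by_contra hne
        obtain ⟨-, rfl, h4⟩ := hnb0 v hvM hne
        exact hcase ⟨hvM, hne⟩
      exact (hcol.left.mono (fun _ _ _ _ => le_rfl) fun v _ => le_raise w x k v).union hm
        (hcol'.left.mono (fun _ _ _ _ => le_rfl) hww) hdM hcr
  · exact forestOn_union_of_rooted hm hcol.right hcol'.right (hAU.mono hFA hF'U) hroot

/-- Without such an edge, colorings of `A` and of its complement would combine. -/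
lemma Critical.exists_edge (hv : Valid P m w) {V A : Finset α} (hcrit : Critical P m w V)
    (hA : A ⊂ V) (hne : A.Nonempty) : ∃ x ∈ A, ∃ y ∈ V, y ∉ A ∧ 1 ≤ m x y := by
  by_contra hcon
  push Not at hcon
  have hm := hv.mult
  have hAU : Disjoint A (V \ A) := Finset.disjoint_sdiff
  have hcr : cross m A (V \ A) = 0 := Finset.sum_eq_zero fun x hx => Finset.sum_eq_zero fun y hy => by
    have := hcon x hx y (Finset.mem_sdiff.1 hy).1 (Finset.mem_sdiff.1 hy).2
    omega
  obtain ⟨M, F, h1⟩ := hcrit.colorable A hA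
  obtain ⟨M', F', h2⟩ := hcrit.colorable (V \ A) (Finset.sdiff_ssubset hA.subset hne)
  have hz : ∀ {B B' : Finset α}, B ⊆ A → B' ⊆ V \ A → cross m B B' = 0 := fun hB hB' =>
    Nat.le_zero.1 ((cross_mono hB hB').trans hcr.le)
  refine hcrit.not_colorable ⟨M ∪ M', F ∪ F', ?_, ?_, ?_, ?_⟩
  · ext v
    have e1 := congrArg (v ∈ ·) h1.union_eq
    have e2 := congrArg (v ∈ ·) h2.union_eq
    have e3 : v ∈ A → v ∈ V := fun hvA => hA.subset hvA
    simp only [Finset.mem_union, Finset.mem_sdiff, eq_iff_iff] at e1 e2 ⊢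
    tauto
  · rw [Finset.disjoint_union_left, Finset.disjoint_union_right, Finset.disjoint_union_right]
    exact ⟨⟨h1.disj, hAU.mono h1.left_subset h2.right_subset⟩,
      (hAU.mono h1.right_subset h2.left_subset).symm, h2.disj⟩
  · exact h1.left.union hm h2.left (hAU.mono h1.left_subset h2.left_subset)
      (hz h1.left_subset h2.left_subset)
  · exact h1.right.union hm h2.right (hAU.mono h1.right_subset h2.right_subset)
      ((hz h1.right_subset h2.right_subset).trans_le zero_le_one)

/-- A lower bound for the potential of proper subsets of a critical graph. -/
lemma Critical.gap (hP : P.Good) (hv : Valid P m w) {V : Finset α} (hC : Colors α P V.card)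
    (hcrit : Critical P m w V) {k l : ℕ} {c : ℤ}
    (hc0 : 0 ≤ c) (hc : ∀ n, 1 ≤ n → P.Φ n ≤ P.Φ (n + l) + c)
    (hkl : P.D + 1 ≤ k ∨ P.D + 1 ≤ l ∨ JoinOK P.kind P.D k l)
    (hcol : ∀ A ⊂ V, P.s₀ < A.card → ∀ x ∈ A, Colorable P.kind P.D m (raise w x k) A) :
    ∀ A ⊂ V, P.s₀ < A.card → pot P m w V + P.τ + min P.f₁ (P.E - c) ≤ pot P m w A := by
  intro A₀ hA₀ hs₀
  have hτ := hP.τ_pos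
  obtain ⟨A, hA, hmin⟩ := (V.powerset.filter fun A => A ⊂ V ∧ P.s₀ < A.card).exists_min_image
    (pot P m w) ⟨A₀, by simp [hA₀, hs₀, hA₀.subset]⟩
  simp only [Finset.mem_filter, Finset.mem_powerset] at hA hmin
  obtain ⟨hAV, hA', hs⟩ := hA
  have h0 := hmin A₀ ⟨hA₀.subset, hA₀, hs₀⟩
  obtain ⟨x, hx, y, hy, hyA, hxy⟩ := hcrit.exists_edge hv hA' (Finset.card_pos.1 (by omega))
  have := gap_step hP hv hC hcrit.not_colorable hAV hs (fun A₂ h1 h2 => by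
    have := hmin A₂ ⟨h2.subset, h2, hs.trans_le (Finset.card_le_card h1.subset)⟩
    linarith) hx hy hyA hxy hc0 hc hkl (hcol A hA' hs x hx)
  linarith

lemma pot_raise (hP : P.Good) (A : Finset α) (x : α) (k : ℕ) :
    pot P m w A - P.b * k ≤ pot P m (raise w x k) A := by
  refine le_trans ?_ (pot_weight (w := w) hP (fun v => if v = x then k else 0) fun v _ => ?_)
  · have : ∑ v ∈ A, ((if v = x then k else 0 : ℕ) : ℤ) ≤ k := by
      push_cast
      rw [Finset.sum_ite_eq']
      split_ifs <;> simp
    have := hP.b_nonneg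
    nlinarith
  · simp only [raise]; split_ifs <;> simp

/-- A gap for the potential makes it possible to increase a weight. -/
lemma colorable_raise (hP : P.Good) (hv : Valid P m w) {V : Finset α} (hC : Colors α P V.card)
    {g : ℤ} (hg : ∀ A ⊂ V, P.s₀ < A.card → g ≤ pot P m w A) {k : ℕ} (hk : P.b * k - P.τ < g) :
    ∀ A ⊂ V, P.s₀ < A.card → ∀ x ∈ A, Colorable P.kind P.D m (raise w x k) A := by
  intro A hA _ x _
  refine colorable_of_pot hP hC (hv.of_le (le_raise w x k)) (Finset.card_lt_card hA)
    fun B hB hs => ?_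
  have h1 := hg B (hB.trans_ssubset hA) hs
  have h2 := pot_raise (m := m) (w := w) hP B x k
  linarith

lemma Critical.colorable_raise_zero {V : Finset α} (hcrit : Critical P m w V) :
    ∀ A ⊂ V, P.s₀ < A.card → ∀ x ∈ A, Colorable P.kind P.D m (raise w x 0) A := by
  intro A hA _ x _
  have : raise w x 0 = w := by funext v; simp [raise]
  rw [this]
  exact hcrit.colorable A hA

end Gap

/-! ### Reducible vertices and charges. -/

section Vertices

variable {α : Type*} [DecidableEq α] {m m' : α → α → ℕ} {w w' : α → ℕ} {P : Params}
  {V : Finset α}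

lemma Colors.mono {n n' : ℕ} (h : Colors α P n) (hn : n' ≤ n) : Colors α P n' :=
  fun V m w hV => h V m w (hV.trans_le hn)

lemma two_mul_pot (hm : IsMult m) (A : Finset α) :
    2 * pot P m w A = ∑ v ∈ A, (2 * P.Φ (w v) - P.E * nb m v A) := by
  have h := hm.two_mul_ed A
  have h' : (2 : ℤ) * ed m A = ∑ v ∈ A, (nb m v A : ℤ) := by
    have : ((2 * ed m A : ℕ) : ℤ) = ((∑ v ∈ A, nb m v A : ℕ) : ℤ) := by rw [h]; rfl
    push_cast at this
    exact this
  rw [Finset.sum_sub_distrib, ← Finset.mul_sum, ← Finset.mul_sum, ← h']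
  unfold pot
  ring

/-- It suffices to bound the potential of a critical graph under the assumption that smaller
sparse graphs are colorable. -/
lemma colors_of_critical
    (h : ∀ (V : Finset α) (m : α → α → ℕ) (w : α → ℕ), Valid P m w → Colors α P V.card →
      Critical P m w V → pot P m w V ≤ -P.τ) (n : ℕ) : Colors α P n := by
  induction n with
  | zero => intro V m w hV; omega
  | succ n ih =>
    intro V m w hV hv hs
    by_contra hcon
    classical
    -- A smallest non-colorable subset is critical.
    obtain ⟨V₀, hV₀, hmin⟩ := (V.powerset.filter fun A => ¬ Colorable P.kind P.D m w A).exists_min_image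
      Finset.card ⟨V, by simp [hcon]⟩
    simp only [Finset.mem_filter, Finset.mem_powerset] at hV₀ hmin
    have hcrit : Critical P m w V₀ := ⟨hV₀.2, fun A hA => by
      by_contra hc
      have := hmin A ⟨hA.subset.trans hV₀.1, hc⟩
      have := Finset.card_lt_card hA
      omega⟩
    have hle : V₀.card ≤ n := (Finset.card_le_card hV₀.1).trans (by omega)
    have h1 := h V₀ m w hv (ih.mono hle) hcrit
    rcases V₀.eq_empty_or_nonempty with he | hne
    · exact hV₀.2 ⟨∅, ∅, by simp [he], by simp, MOK.empty, ForestOn.empty⟩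
    · have := hs V₀ hV₀.1 hne
      linarith

lemma Critical.nonempty (h : Critical P m w V) : V.Nonempty := by
  by_contra he
  rw [Finset.not_nonempty_iff_eq_empty] at he
  exact h.not_colorable ⟨∅, ∅, by simp [he], by simp, MOK.empty, ForestOn.empty⟩

lemma Critical.two_le_deg (hm : IsMult m) (h : Critical P m w V) {v : α} (hv : v ∈ V) :
    2 ≤ nb m v V := by
  by_contra hlt
  obtain ⟨M, F, hc⟩ := h.colorable _ (Finset.erase_ssubset hv)
  have h1 := hc.nb_add v
  rw [hm.nb_erase_self] at h1
  have := hc.insert_right hm (Finset.notMem_erase v V) (by omega)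
  rw [Finset.insert_erase hv] at this
  exact h.not_colorable ⟨_, _, this⟩

/-- If both edges of `v` go to `F`, then `v` could be a component of `M` by itself unless it is too
heavy; in all other cases it fits into `F`. -/
lemma Critical.weight_of_deg_two (hm : IsMult m) (h : Critical P m w V) {v : α} (hv : v ∈ V)
    (hd : nb m v V = 2) : P.D + 2 ≤ w v := by
  by_contra hlt
  obtain ⟨M, F, hc⟩ := h.colorable _ (Finset.erase_ssubset hv)
  have h1 := hc.nb_add v
  rw [hm.nb_erase_self] at h1
  rcases Nat.lt_or_ge (nb m v F) 2 with h2 | h2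
  · have := hc.insert_right hm (Finset.notMem_erase v V) (by omega)
    rw [Finset.insert_erase hv] at this
    exact h.not_colorable ⟨_, _, this⟩
  · have hvM : v ∉ M := fun hM => Finset.notMem_erase v V (hc.left_subset hM)
    have := hc.insert_left (Finset.notMem_erase v V)
      (hc.left.insert_of_nb_eq_zero hm hvM (by omega) (by omega))
    rw [Finset.insert_erase hv] at this
    exact h.not_colorable ⟨_, _, this⟩

/-- A vertex of degree three is reducible if the weights of its neighbors can be increased. -/
lemma Critical.not_colorable_erase (hm : IsMult m) (h : Critical P m w V) {v : α} (hv : v ∈ V)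
    (hd : nb m v V = 3) {k l : ℕ} (hj : JoinOK P.kind P.D k l) (hl : w v + l ≤ P.D + 1)
    (hww : ∀ u, w u ≤ w' u) (hk : ∀ u, m v u = 1 → w u + k ≤ w' u) :
    ¬ Colorable P.kind P.D m w' (V.erase v) := by
  rintro ⟨M, F, hc⟩
  have h1 := hc.nb_add v
  rw [hm.nb_erase_self] at h1
  rcases Nat.lt_or_ge (nb m v F) 2 with h2 | h2
  · have := (hc.mono (fun _ _ _ _ => le_rfl) fun u _ => hww u).insert_right hm
      (Finset.notMem_erase v V) (by omega)
    rw [Finset.insert_erase hv] at this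
    exact h.not_colorable ⟨_, _, this⟩
  -- Two edges go to `F`, so at most one goes to `M`. A neighbor in `M` thus has multiplicity one,
  -- and `hk` is needed only there.
  · have hvM : v ∉ M := fun hM => Finset.notMem_erase v V (hc.left_subset hM)
    have := hc.insert_left (Finset.notMem_erase v V)
      (hc.left.insert_of_nb_le_one (w := w) hm hvM (fun u _ => hww u) (fun u hu h1 => hk u (by
        have := le_nb (m := m) (v := v) hu
        omega)) hl hj (by omega))
    rw [Finset.insert_erase hv] at this
    exact h.not_colorable ⟨_, _, this⟩

lemma sum_nb_cast (v : α) (A : Finset α) : ∑ u ∈ A, (m v u : ℤ) = nb m v A := by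
  simp [nb]

lemma Critical.two_le_card (hm : IsMult m) (h : Critical P m w V) : 2 ≤ V.card := by
  obtain ⟨v, hv⟩ := h.nonempty
  have h1 := h.two_le_deg hm hv
  rw [← hm.nb_erase_self] at h1
  obtain ⟨u, hu, -⟩ := exists_of_nb_pos (by omega : 0 < nb m v (V.erase v))
  exact Finset.one_lt_card.2 ⟨v, hv, u, Finset.mem_of_mem_erase hu, (Finset.ne_of_mem_erase hu).symm⟩

lemma Critical.three_le_card (hm : IsMult m) (h1 : ∀ u v, m u v ≤ 1) (h : Critical P m w V) :
    3 ≤ V.card := by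
  obtain ⟨v, hv⟩ := h.nonempty
  have h2 := h.two_le_deg hm hv
  rw [← hm.nb_erase_self] at h2
  have h3 : nb m v (V.erase v) ≤ (V.erase v).card := by
    simpa [nb] using Finset.sum_le_card_nsmul (V.erase v) (fun u => m v u) 1 fun u _ => h1 v u
  have := Finset.card_erase_add_one hv
  omega

/-- Increase the weight of each neighbor of `v` by `k` for each edge. -/
def raiseNb (m : α → α → ℕ) (w : α → ℕ) (v : α) (k : ℕ) (u : α) : ℕ := w u + k * m v u

lemma pot_raiseNb (hP : P.Good) (v : α) (k : ℕ) (B : Finset α) :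
    pot P m w B - P.b * (k * nb m v B) ≤ pot P m (raiseNb m w v k) B := by
  refine le_trans (le_of_eq ?_) (pot_weight (w := w) hP (fun u => k * m v u) fun u _ => le_rfl)
  push_cast
  rw [← Finset.mul_sum, sum_nb_cast]

/-- The bound for the degree version when `D` is not too small. -/
theorem Critical.pot_le_of_degree (hP : P.Good) (hkind : P.kind = .degree)
    (h1 : P.b ≤ P.τ) (h2 : 3 * P.b - P.τ ≤ P.f₁) (h3 : 3 * P.b - P.τ ≤ P.E - P.b)
    (hd2 : 2 * P.Φ (P.D + 2) - 2 * P.E ≤ -2) (hd3 : 2 * P.Φ (P.D + 1) - 3 * P.E ≤ -2)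
    (hd4 : 2 * P.Φ 1 - 4 * P.E ≤ -2) (hn : P.τ ≤ 2 ∨ (P.simple = true ∧ P.τ ≤ 3))
    (hv : Valid P m w) (hC : Colors α P V.card) (h : Critical P m w V) :
    pot P m w V ≤ -P.τ := by
  by_contra hlt
  have hm := hv.mult
  have hf₁ := hP.f₁_pos
  have hE := hP.E_pos
  have hb := hP.b_nonneg
  -- Without raising `x`: the value `l = D + 1` keeps `y` out of `M` at cost `c = E`. The gain is
  -- zero, but potentials become positive.
  have g1 := h.gap hP hv hC (k := 0) (l := P.D + 1) (c := P.E) hE.le (fun n hn => by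
    have := hP.edge n hn
    have := hP.f₀_le (n + (P.D + 1))
    linarith) (by omega) h.colorable_raise_zero
  have e1 : min P.f₁ (P.E - P.E) = 0 := by rw [sub_self]; exact min_eq_right hf₁.le
  -- Positive potential allows a raise by one, as `b ≤ τ`. This yields a gap above `3b - τ`, enough
  -- to raise three neighbors by one.
  have g2 := h.gap hP hv hC (k := 1) (l := 1) (c := P.b) hb (fun n hn => by
    have := hP.lip n 1
    push_cast at this
    linarith) (Or.inr (Or.inr (by rw [hkind]; exact ⟨le_rfl, le_rfl⟩)))
    (colorable_raise hP hv hC (g := 1) (fun A hA hs => by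
      have := g1 A hA hs
      linarith) (by push_cast; linarith))
  have e2 : 3 * P.b - P.τ ≤ min P.f₁ (P.E - P.b) := le_min h2 h3
  have hcharge : ∀ v ∈ V, 2 * P.Φ (w v) - P.E * nb m v V ≤ -2 := by
    intro v hvV
    have h4 := h.two_le_deg hm hvV
    have h5 := hP.anti (hv.one_le v)
    rcases (by omega : nb m v V = 2 ∨ nb m v V = 3 ∨ 4 ≤ nb m v V) with h6 | h6 | h6
    · have h7 := hP.anti (h.weight_of_deg_two hm hvV h6)
      rw [h6]; push_cast; linarith
    · rcases Nat.lt_or_ge P.D (w v) with h7 | h7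
      · have h8 := hP.anti (Nat.succ_le_of_lt h7)
        simp only [Nat.succ_eq_add_one] at h8
        rw [h6]; push_cast; linarith
      · exfalso
        refine h.not_colorable_erase (w' := raiseNb m w v 1) hm hvV h6 (k := 1) (l := 1)
          (by rw [hkind]; exact ⟨le_rfl, le_rfl⟩) (by omega) (fun u => Nat.le_add_right _ _)
          (fun u hu => by simp [raiseNb, hu]) ?_
        refine colorable_of_pot (w := raiseNb m w v 1) hP hC (hv.of_le fun u => Nat.le_add_right _ _)
          (Finset.card_lt_card (Finset.erase_ssubset hvV)) fun B hB hs => ?_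
        have h8 := g2 B (hB.trans_ssubset (Finset.erase_ssubset hvV)) hs
        have h9 := pot_raiseNb (m := m) (w := w) hP v 1 B
        have h10 : nb m v B ≤ 3 := h6 ▸ nb_mono (hB.trans (Finset.erase_subset _ _))
        have h11 : (nb m v B : ℤ) ≤ 3 := by exact_mod_cast h10
        push_cast at h9
        nlinarith
    · have h7 : (4 : ℤ) ≤ nb m v V := by exact_mod_cast h6
      nlinarith
  have hsum := two_mul_pot (P := P) (w := w) hm V
  have hle := Finset.sum_le_card_nsmul V _ _ hcharge
  rw [← hsum] at hle
  simp only [nsmul_eq_mul] at hle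
  -- Charges of at most `-2` give a potential of at most `-|V|`. In the simple case `|V| ≥ 3`, hence
  -- the larger `τ`.
  rcases hn with hn | ⟨hs, hn⟩
  · have : (2 : ℤ) ≤ V.card := by exact_mod_cast h.two_le_card hm
    linarith
  · have : (3 : ℤ) ≤ V.card := by exact_mod_cast h.three_le_card hm (hv.simple hs)
    linarith

/-- A vertex of smaller weight could form `M` alone, leaving the other one for `F`. -/
lemma Critical.weight_of_card_le_two (hv : Valid P m w) (h : Critical P m w V)
    (hV : V.card ≤ 2) : ∀ v ∈ V, P.D + 2 ≤ w v := by
  intro v hvV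
  by_contra hlt
  have hm := hv.mult
  have h1 := Finset.card_erase_add_one hvV
  have h2 := h.two_le_card hm
  obtain ⟨u, hu⟩ := Finset.card_eq_one.1 (by omega : (V.erase v).card = 1)
  refine h.not_colorable ⟨{v}, {u}, ?_, ?_, MOK.singleton hm (by omega), ForestOn.singleton hm u⟩
  · rw [← hu, ← Finset.insert_eq, Finset.insert_erase hvV]
  · rw [← hu]; simp

end Vertices

/-! ### The concrete potentials. -/

/-- The parameters for multigraphs and degree-type colorings. The same potential applies to
component-type colorings when `D` is odd. -/
def multiParams (t : Kind) (D : ℕ) : Params where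
  kind := t
  D := D
  -- The truncated subtraction gives capacity zero to all weights above `D + 2`, so weights may be
  -- raised without limit.
  Φ n := 2 * D + 1 + 2 * ((D + 2 - n : ℕ) : ℤ)
  E := 2 * (D + 1)
  τ := 2
  b := 2
  simple := false

/-- The parameters for simple graphs and degree-type colorings. -/
def simpleParams (D : ℕ) : Params where
  kind := .degree
  D := D
  Φ n := 3 * D + 2 + 3 * ((D + 2 - n : ℕ) : ℤ)
  E := 3 * (D + 1)
  τ := 3
  b := 3
  simple := true

/-- The parameters for multigraphs and component-type colorings when `D = 2 * d`. -/
def evenParams (d : ℕ) : Params where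
  kind := .component
  D := 2 * d
  Φ n := if 2 * d + 2 - n < d then 4 * d + 2 * ((2 * d + 2 - n : ℕ) : ℤ)
    else 4 * d + 2 * ((2 * d + 2 - n : ℕ) : ℤ) - 1
  E := 4 * d + 1
  τ := 2
  b := 2
  simple := false

lemma multiParams_good (t : Kind) (D : ℕ) : (multiParams t D).Good where
  anti a b hab := by simp only [multiParams]; omega
  const n hn := by simp only [multiParams] at hn ⊢; omega
  f₁_pos := by simp [multiParams, Params.f₁]
  le_E := by simp only [multiParams]; omega
  τ_pos := by simp [multiParams]
  edge n hn := by simp only [multiParams]; omega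
  lip n k := by simp only [multiParams]; omega
  b_nonneg := by simp [multiParams]

lemma simpleParams_good (D : ℕ) : (simpleParams D).Good where
  anti a b hab := by simp only [simpleParams]; omega
  const n hn := by simp only [simpleParams] at hn ⊢; omega
  f₁_pos := by simp [simpleParams, Params.f₁]; omega
  le_E := by simp only [simpleParams]; omega
  τ_pos := by simp [simpleParams]
  edge n hn := by simp only [simpleParams]; omega
  lip n k := by simp only [simpleParams]; omega
  b_nonneg := by simp [simpleParams]

lemma evenParams_good {d : ℕ} (hd : 1 ≤ d) : (evenParams d).Good where
  anti a b hab := by simp only [evenParams]; split_ifs <;> omega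
  const n hn := by
    simp only [evenParams] at hn ⊢
    rw [show 2 * d + 2 - n = 2 * d + 2 - (2 * d + 2) by omega]
  f₁_pos := by simp [evenParams, Params.f₁]; split_ifs <;> omega
  le_E := by simp only [evenParams]; split_ifs <;> omega
  τ_pos := by simp [evenParams]
  edge n hn := by simp only [evenParams]; split_ifs <;> omega
  lip n k := by simp only [evenParams]; split_ifs <;> omega
  b_nonneg := by simp [evenParams]

/-! ### Degree version for `D ≥ 2` and component version for even `D`. -/

section Bounds

variable {α : Type*} [DecidableEq α] {m : α → α → ℕ} {w : α → ℕ} {V : Finset α} {D d : ℕ}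

/-- The charge count applies directly; `D ≥ 2` is what `3b - τ = 4 ≤ E - b = 2D` requires. -/
theorem pot_le_multi_degree (hD : 2 ≤ D) (hv : Valid (multiParams .degree D) m w)
    (h : Critical (multiParams .degree D) m w V) : pot (multiParams .degree D) m w V ≤ -2 := by
  have hP := multiParams_good .degree D
  have key : ∀ (V : Finset α) (m : α → α → ℕ) (w : α → ℕ), Valid (multiParams .degree D) m w →
      Colors α (multiParams .degree D) V.card → Critical (multiParams .degree D) m w V →
      pot (multiParams .degree D) m w V ≤ -(multiParams .degree D).τ := by
    intro V m w hv hC h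
    refine h.pot_le_of_degree hP rfl ?_ ?_ ?_ ?_ ?_ ?_ (Or.inl ?_) hv hC <;>
      simp [multiParams, Params.f₁] <;> omega
  exact key V m w hv (colors_of_critical key _) h

theorem pot_le_simple_degree (hD : 2 ≤ D) (hv : Valid (simpleParams D) m w)
    (h : Critical (simpleParams D) m w V) : pot (simpleParams D) m w V ≤ -3 := by
  have hP := simpleParams_good D
  have key : ∀ (V : Finset α) (m : α → α → ℕ) (w : α → ℕ), Valid (simpleParams D) m w →
      Colors α (simpleParams D) V.card → Critical (simpleParams D) m w V →
      pot (simpleParams D) m w V ≤ -(simpleParams D).τ := by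
    intro V m w hv hC h
    refine h.pot_le_of_degree hP rfl ?_ ?_ ?_ ?_ ?_ ?_ (Or.inr ?_) hv hC <;>
      simp [simpleParams, Params.f₁] <;> omega
  exact key V m w hv (colors_of_critical key _) h

/-- The jump of the vertex potential between capacities `d - 1` and `d` makes the charge `-1` at
degree three and weight `d + 1`. Charges of `-1` suffice on three vertices, since the potential is
an integer. On two vertices all weights are at least `D + 2` and the charges are at most `-2`. -/
theorem pot_le_even (hd : 1 ≤ d) (hv : Valid (evenParams d) m w)
    (h : Critical (evenParams d) m w V) : pot (evenParams d) m w V ≤ -2 := by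
  have hP := evenParams_good hd
  have hEe : (evenParams d).E = 4 * d + 1 := rfl
  have hτe : (evenParams d).τ = 2 := rfl
  have hbe : (evenParams d).b = 2 := rfl
  have hDe : (evenParams d).D = 2 * d := rfl
  have hf₁ : (evenParams d).f₁ = 4 * d := by
    simp [evenParams, Params.f₁]
    omega
  have hΦ : ∀ n, (evenParams d).Φ n = if 2 * d + 2 - n < d then
      4 * d + 2 * ((2 * d + 2 - n : ℕ) : ℤ) else 4 * d + 2 * ((2 * d + 2 - n : ℕ) : ℤ) - 1 :=
    fun _ => rfl
  have key : ∀ (V : Finset α) (m : α → α → ℕ) (w : α → ℕ), Valid (evenParams d) m w →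
      Colors α (evenParams d) V.card → Critical (evenParams d) m w V →
      pot (evenParams d) m w V ≤ -(evenParams d).τ := by
    intro V m w hv hC h
    by_contra hlt
    have hm := hv.mult
    have gk : ∀ k, k + 1 ≤ d → ∀ A ⊂ V, (evenParams d).s₀ < A.card →
        2 * (k : ℤ) + 1 ≤ pot (evenParams d) m w A := by
      intro k
      induction k with
      | zero =>
        intro hk A hA hs
        have := h.gap hP hv hC (k := 0) (l := 2 * d + 1) (c := 4 * d + 1) (by omega)
          (fun n hn => by rw [hΦ, hΦ]; split_ifs <;> omega) (by omega) h.colorable_raise_zero A hA hs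
        rw [hf₁, hEe, hτe] at this
        push_cast
        omega
      | succ k ih =>
        intro hk A hA hs
        -- Here `l ≥ d + 2`. Such a raise crosses the jump or starts below it, so it costs at most
        -- `c = 2l - 1`, which gives `E - c = 2k + 2`.
        have := h.gap hP hv hC (k := k + 1) (l := 2 * d - k) (c := 4 * d - 1 - 2 * k) (by omega)
          (fun n hn => by rw [hΦ, hΦ]; split_ifs <;> omega)
          (Or.inr (Or.inr (JoinOK.of_add_le (by omega) (by omega) (by omega))))
          (colorable_raise hP hv hC (ih (by omega)) (by rw [hbe, hτe]; push_cast; linarith)) A hA hs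
        rw [hf₁, hEe, hτe] at this
        push_cast
        omega
    have g : ∀ A ⊂ V, (evenParams d).s₀ < A.card → 2 * (d : ℤ) ≤ pot (evenParams d) m w A := by
      intro A hA hs
      -- Now `l = d + 1` can lower the capacity from `2d + 1` to `d` without crossing the jump, so
      -- `c = 2l` and the gain is `E - c = 2d - 1`.
      have := h.gap hP hv hC (k := d) (l := d + 1) (c := 2 * d + 2) (by omega)
        (fun n hn => by rw [hΦ, hΦ]; split_ifs <;> omega)
        (Or.inr (Or.inr (JoinOK.of_add_le (by omega) (by omega) (by omega))))
        (colorable_raise hP hv hC (gk (d - 1) (by omega)) (by rw [hbe, hτe]; omega)) A hA hs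
      rw [hf₁, hEe, hτe] at this
      omega
    have hdeg3 : ∀ v ∈ V, nb m v V = 3 → d + 1 ≤ w v := by
      intro v hvV h3
      by_contra hwv
      refine h.not_colorable_erase (w' := raiseNb m w v (w v)) hm hvV h3 (k := w v)
        (l := 2 * d + 1 - w v)
        (JoinOK.of_add_le (hv.one_le v) (by omega) (by omega)) (by omega)
        (fun u => Nat.le_add_right _ _) (fun u hu => by simp [raiseNb, hu]) ?_
      refine colorable_of_pot (w := raiseNb m w v (w v)) hP hC
        (hv.of_le fun u => Nat.le_add_right _ _)
        (Finset.card_lt_card (Finset.erase_ssubset hvV)) fun B hB hs => ?_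
      have hvB : v ∉ B := fun hmem => Finset.notMem_erase v V (hB hmem)
      have h1 := g B (hB.trans_ssubset (Finset.erase_ssubset hvV)) hs
      have h2 := pot_raiseNb (m := m) (w := w) hP v (w v) B
      have h3' : nb m v B ≤ 3 := h3 ▸ nb_mono (hB.trans (Finset.erase_subset _ _))
      have h4 := pot_insert (P := evenParams d) (w := w) hm hvB
      have h5 : (evenParams d).Φ (w v) = 8 * d + 3 - 2 * w v := by
        rw [hΦ]; split_ifs <;> omega
      have hsub : insert v B ⊆ V := Finset.insert_subset hvV (hB.trans (Finset.erase_subset _ _))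
      rw [h5, hEe] at h4
      rw [hbe] at h2
      rw [hτe] at hlt ⊢
      -- When `v` sends at least two edges to `B`, the gap for `B` alone is too weak. The potential
      -- of `B ∪ {v}` then gives a better bound for `B`.
      by_cases hBV : insert v B = V
      · have h6 : nb m v B = 3 := by
          rw [← h3, ← hBV, nb_insert hvB, hm.diag, zero_add]
        rw [hBV, h6] at h4
        rw [h6] at h2
        push_cast at h2 h4
        omega
      · have h7 := g _ (Finset.ssubset_iff_subset_ne.2 ⟨hsub, hBV⟩) (by
          rw [Finset.card_insert_of_notMem hvB]; omega)
        interval_cases hr : nb m v B <;> push_cast at h2 h4 <;> omega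
    have hcharge : ∀ v ∈ V, 2 * (evenParams d).Φ (w v) - (evenParams d).E * nb m v V ≤ -1 ∧
        (2 * d + 2 ≤ w v → 2 * (evenParams d).Φ (w v) - (evenParams d).E * nb m v V ≤ -2) := by
      intro v hvV
      have h4 := h.two_le_deg hm hvV
      have h5 := hv.one_le v
      have h6 := h.weight_of_deg_two hm hvV
      have h7 := hdeg3 v hvV
      rw [hDe] at h6
      rw [hΦ, hEe]
      rcases (by omega : nb m v V = 2 ∨ nb m v V = 3 ∨ 4 ≤ nb m v V) with h8 | h8 | h8
      · rw [h8]; push_cast; split_ifs <;> omega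
      · rw [h8]; push_cast; split_ifs <;> omega
      · have h9 : (4 : ℤ) ≤ nb m v V := by exact_mod_cast h8
        have h10 : (4 * (d : ℤ) + 1) * 4 ≤ (4 * d + 1) * nb m v V := by gcongr
        split_ifs <;> omega
    have hsum := two_mul_pot (P := evenParams d) (w := w) hm V
    have hcard := h.two_le_card hm
    rw [hτe] at hlt
    rcases Nat.lt_or_ge 2 V.card with hc | hc
    · have hle := Finset.sum_le_card_nsmul V _ _ fun v hvV => (hcharge v hvV).1
      rw [← hsum] at hle
      simp only [nsmul_eq_mul] at hle
      omega
    · have hle := Finset.sum_le_card_nsmul V _ _ fun v hvV =>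
        (hcharge v hvV).2 (h.weight_of_card_le_two hv hc v hvV)
      rw [← hsum] at hle
      simp only [nsmul_eq_mul] at hle
      omega
  exact key V m w hv (colors_of_critical key _) h

end Bounds

/-! ### Odd `D`: the gap, light vertices and their independence. -/

/-- The parameters `multiParams` for `D = 2 * h - 1`. -/
abbrev oddParams (t : Kind) (h : ℕ) : Params := multiParams t (2 * h - 1)

/-- A critical graph of large potential, for odd `D = 2 * h - 1`. -/
structure OddCritical {α : Type*} [DecidableEq α] (t : Kind) (h : ℕ) (m : α → α → ℕ) (w : α → ℕ)
    (V : Finset α) : Prop where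
  one_le : 1 ≤ h
  valid : Valid (oddParams t h) m w
  colors : Colors α (oddParams t h) V.card
  crit : Critical (oddParams t h) m w V
  pot_ge : -1 ≤ pot (oddParams t h) m w V

section Odd

variable {α : Type*} [DecidableEq α] {m m' : α → α → ℕ} {w w' : α → ℕ} {V : Finset α}
  {t : Kind} {h : ℕ}

lemma oddParams_Φ (hh : 1 ≤ h) (n : ℕ) :
    (oddParams t h).Φ n = 4 * h - 1 + 2 * ((2 * h + 1 - n : ℕ) : ℤ) := by
  simp only [multiParams]; omega

lemma oddParams_E (hh : 1 ≤ h) : (oddParams t h).E = 4 * h := by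
  simp only [multiParams]; omega

lemma oddParams_f₁ (hh : 1 ≤ h) : (oddParams t h).f₁ = 4 * h - 1 := by
  simp [multiParams, Params.f₁]; omega

lemma oddParams_D (hh : 1 ≤ h) : (oddParams t h).D + 1 = 2 * h := by
  simp only [multiParams]; omega

/-- The strict form of `pot_weight` supplies the one unit by which a vertex of degree three and
weight `h` misses being reducible. -/
lemma pot_weight_lt {P : Params} (hP : P.Good) {A : Finset α} (δ : α → ℕ)
    (hw : ∀ v ∈ A, w' v ≤ w v + δ v) {u : α} (hu : u ∈ A)
    (hlt : P.Φ (w u) < P.Φ (w' u) + P.b * δ u) :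
    pot P m w A - P.b * ∑ v ∈ A, (δ v : ℤ) < pot P m w' A := by
  have : ∑ v ∈ A, P.Φ (w v) < ∑ v ∈ A, (P.Φ (w' v) + P.b * δ v) :=
    Finset.sum_lt_sum (fun v hv =>
      (hP.lip (w v) (δ v)).trans (add_le_add_left (hP.anti (hw v hv)) _)) ⟨u, hu, hlt⟩
  rw [Finset.sum_add_distrib, ← Finset.mul_sum] at this
  unfold pot
  linarith

lemma nb_eq_two {u : α} {W : Finset α} (hW : nb m u W = 2) :
    (∃ q ∈ W, m u q = 2) ∨ ∃ p ∈ W, ∃ q ∈ W, p ≠ q ∧ m u p = 1 ∧ m u q = 1 ∧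
      ∀ x ∈ W, m u x ≤ if x = p ∨ x = q then 1 else 0 := by
  obtain ⟨p, hp, hp1⟩ := exists_of_nb_pos (by omega : 0 < nb m u W)
  have h1 := nb_erase (m := m) (v := u) hp
  by_cases h2 : m u p = 2
  · exact Or.inl ⟨p, hp, h2⟩
  obtain ⟨q, hq, hq1⟩ := exists_of_nb_pos (by omega : 0 < nb m u (W.erase p))
  have h3 := nb_erase (m := m) (v := u) hq
  refine Or.inr ⟨p, hp, q, Finset.mem_of_mem_erase hq, (Finset.ne_of_mem_erase hq).symm, by omega,
    by omega, fun x hx => ?_⟩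
  split_ifs with h4
  · rcases h4 with rfl | rfl <;> omega
  · have : x ∈ (W.erase p).erase q := by
      simp only [Finset.mem_erase]; tauto
    have := le_nb (m := m) (v := u) this
    omega

namespace OddCritical

/-- Raises by `k = 0, 1, …, 2h - 1` with `k + l = 2h` give gaps `2k + 1`. Finally `k = 2h` forces
`x` into `F`, so `l = c = 0` and the gain is the full `f₁ = 4h - 1`. -/
lemma gap (H : OddCritical t h m w V) {A : Finset α} (hA : A ⊂ V) (hs : 1 < A.card) :
    4 * (h : ℤ) ≤ pot (oddParams t h) m w A := by
  obtain ⟨hh, hv, hC, hcr, hp⟩ := H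
  have hP : (oddParams t h).Good := multiParams_good t (2 * h - 1)
  have hτe : (oddParams t h).τ = 2 := rfl
  have hbe : (oddParams t h).b = 2 := rfl
  have hD := oddParams_D (t := t) hh
  have gk : ∀ k, k + 1 ≤ 2 * h → ∀ A ⊂ V, (oddParams t h).s₀ < A.card →
      2 * (k : ℤ) + 1 ≤ pot (oddParams t h) m w A := by
    intro k
    induction k with
    | zero =>
      intro _ A hA hs
      have := hcr.gap hP hv hC (k := 0) (l := 2 * h) (c := 4 * h) (by omega)
        (fun n hn => by rw [oddParams_Φ hh, oddParams_Φ hh]; omega) (by omega)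
        hcr.colorable_raise_zero A hA hs
      rw [oddParams_f₁ hh, oddParams_E hh, hτe] at this
      push_cast
      omega
    | succ k ih =>
      intro hk A hA hs
      have := hcr.gap hP hv hC (k := k + 1) (l := 2 * h - (k + 1)) (c := 4 * h - 2 * (k + 1))
        (by omega) (fun n hn => by rw [oddParams_Φ hh, oddParams_Φ hh]; omega)
        (Or.inr (Or.inr (JoinOK.of_add_le (by omega) (by omega) (by omega))))
        (colorable_raise hP hv hC (ih (by omega)) (by rw [hbe, hτe]; push_cast; linarith)) A hA hs
      rw [oddParams_f₁ hh, oddParams_E hh, hτe] at this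
      push_cast
      omega
  have := hcr.gap hP hv hC (k := 2 * h) (l := 0) (c := 0) le_rfl
    (fun n hn => by simp) (by omega)
    (colorable_raise hP hv hC (gk (2 * h - 1) (by omega)) (by rw [hbe, hτe]; omega)) A hA hs
  rw [oddParams_f₁ hh, oddParams_E hh, hτe] at this
  omega

lemma gap_of_nonempty (H : OddCritical t h m w V) {A : Finset α} (hA : A ⊂ V) (hne : A.Nonempty) :
    4 * (h : ℤ) - 1 ≤ pot (oddParams t h) m w A := by
  rcases Nat.lt_or_ge 1 A.card with h1 | h1
  · have := H.gap hA h1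
    linarith
  · have := f₁_le_pot (multiParams_good t (2 * h - 1)) H.valid hne h1
    rwa [oddParams_f₁ H.one_le] at this

lemma colorable_of_pot (H : OddCritical t h m w V) (hv : Valid (oddParams t h) m' w') {A : Finset α}
    (hA : A ⊂ V) (hB : ∀ B ⊆ A, 1 < B.card → -1 ≤ pot (oddParams t h) m' w' B) :
    Colorable t (2 * h - 1) m' w' A :=
  ForestPartition.colorable_of_pot (multiParams_good t (2 * h - 1)) H.colors hv
    (Finset.card_lt_card hA) fun B hBA hs => by
      have hτe : (oddParams t h).τ = 2 := rfl
      have := hB B hBA hs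
      linarith

lemma joinOK (hh : 1 ≤ h) : JoinOK t (2 * h - 1) h h :=
  JoinOK.of_add_le hh hh (by omega)

/-- Raising each neighbor by `w v` works for `w v < h`. For `w v = h` the count on all of `V` fails
by one, and each alternative in `hex` recovers it: a double neighbor need not be raised, and a
neighbor of weight at least `h + 2` has capacity below `h`, so its raise costs less than `2h`. -/
lemma not_deg_three (H : OddCritical t h m w V) {v : α} (hv : v ∈ V) (hd : nb m v V = 3)
    (hw : w v ≤ h) (hex : w v < h ∨ ∃ u ∈ V, 1 ≤ m v u ∧ (2 ≤ m v u ∨ h + 2 ≤ w u)) : False := by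
  have hh := H.one_le
  have hm := H.valid.mult
  have hP : (oddParams t h).Good := multiParams_good t (2 * h - 1)
  have hbe : (oddParams t h).b = 2 := rfl
  have hD := oddParams_D (t := t) hh
  have hw1 := H.valid.one_le v
  set w' : α → ℕ := fun u => if m v u = 1 then w u + w v else w u with hw'
  have hle : ∀ u, w u ≤ w' u := fun u => by simp only [hw']; split_ifs <;> omega
  refine H.crit.not_colorable_erase (w' := w') hm hv hd (k := w v) (l := 2 * h - w v)
    (JoinOK.of_add_le hw1 (by omega) (by omega)) (by omega) hle
    (fun u hu => by simp [hw', hu]) ?_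
  refine H.colorable_of_pot (H.valid.of_le hle) (Finset.erase_ssubset hv) fun B hB hs => ?_
  have hvB : v ∉ B := fun hmem => Finset.notMem_erase v V (hB hmem)
  have hδ : ∀ u ∈ B, w' u ≤ w u + w v * m v u := fun u _ => by
    simp only [hw']
    split_ifs with h1
    · simp [h1]
    · exact Nat.le_add_right _ _
  have hsum : ∑ u ∈ B, ((w v * m v u : ℕ) : ℤ) = w v * nb m v B := by
    push_cast; rw [← Finset.mul_sum, sum_nb_cast]
  have h1 := H.gap (hB.trans_ssubset (Finset.erase_ssubset hv)) hs
  have h2 := pot_weight (P := oddParams t h) (m := m) hP _ hδ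
  rw [hsum, hbe] at h2
  have h3 : nb m v B ≤ 3 := hd ▸ nb_mono (hB.trans (Finset.erase_subset _ _))
  have h4 := pot_insert (P := oddParams t h) (w := w) hm hvB
  have h5 : (oddParams t h).Φ (w v) = 8 * h + 1 - 2 * w v := by
    rw [oddParams_Φ hh]; omega
  have hsub : insert v B ⊆ V := Finset.insert_subset hv (hB.trans (Finset.erase_subset _ _))
  rw [h5, oddParams_E hh] at h4
  by_cases hBV : insert v B = V
  · have h6 : nb m v B = 3 := by
      rw [← hd, ← hBV, nb_insert hvB, hm.diag, zero_add]
    have h7 := H.pot_ge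
    rw [hBV, h6] at h4
    rcases (or_iff_not_imp_left.2 fun h8 => ⟨by omega, hex.resolve_left h8⟩ :
        w v < h ∨ (w v = h ∧ ∃ u ∈ V, 1 ≤ m v u ∧ (2 ≤ m v u ∨ h + 2 ≤ w u))) with
      h8 | ⟨h8, u, huV, hu1, hu2⟩
    · rw [h6] at h2
      push_cast at h2 h4
      omega
    · have huB : u ∈ B := by
        have : u ∈ insert v B := hBV ▸ huV
        refine (Finset.mem_insert.1 this).resolve_left fun e => ?_
        rw [e, hm.diag] at hu1
        omega
      have h9 := pot_weight_lt (P := oddParams t h) (m := m) hP _ hδ huB (by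
        rw [oddParams_Φ hh, oddParams_Φ hh, hbe]
        simp only [hw']
        split_ifs with h10
        · rw [h10]; push_cast; omega
        · have : 0 < w v * m v u := Nat.mul_pos hw1 hu1
          push_cast
          have h11 : (0 : ℤ) < w v * m v u := by exact_mod_cast this
          linarith)
      rw [hsum, hbe, h6] at h9
      push_cast at h4 h9
      omega
  · have h7 := H.gap (Finset.ssubset_iff_subset_ne.2 ⟨hsub, hBV⟩) (by
      rw [Finset.card_insert_of_notMem hvB]; omega)
    interval_cases hr : nb m v B <;> push_cast at h2 h4 <;> omega

lemma le_weight (H : OddCritical t h m w V) {v : α} (hv : v ∈ V) (hd : nb m v V = 3) : h ≤ w v := by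
  by_contra hlt
  exact H.not_deg_three hv hd (by omega) (Or.inl (by omega))

/-- The vertices of positive charge. -/
structure Light (h : ℕ) (m : α → α → ℕ) (w : α → ℕ) (V : Finset α) (v : α) : Prop where
  mem : v ∈ V
  deg : nb m v V = 3
  weight : w v = h

lemma mult_le_one (H : OddCritical t h m w V) {v u : α} (hv : Light h m w V v) (hu : u ∈ V) :
    m v u ≤ 1 := by
  by_contra hlt
  exact H.not_deg_three hv.mem hv.deg hv.weight.le (Or.inr ⟨u, hu, by omega, Or.inl (by omega)⟩)

lemma weight_le (H : OddCritical t h m w V) {v u : α} (hv : Light h m w V v) (hu : u ∈ V)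
    (huv : 1 ≤ m v u) : w u ≤ h + 1 := by
  by_contra hlt
  exact H.not_deg_three hv.mem hv.deg hv.weight.le (Or.inr ⟨u, hu, huv, Or.inr (by omega)⟩)

/-- The vertices of positive charge are independent. -/
lemma light_independent (H : OddCritical t h m w V) {v v' : α} (hv : Light h m w V v)
    (hv' : Light h m w V v') : m v v' = 0 := by
  by_contra hne
  have hh := H.one_le
  have hm := H.valid.mult
  have hP : (oddParams t h).Good := multiParams_good t (2 * h - 1)
  have hbe : (oddParams t h).b = 2 := rfl
  have hvv' : m v v' = 1 := by have := H.mult_le_one hv hv'.mem; omega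
  have hne' : v ≠ v' := fun e => by rw [e, hm.diag] at hvv'; omega
  -- All neighbors of `v` except `v'` are raised. The cost `2 · 2h` is exactly the gap.
  set δ : α → ℕ := fun u => if u = v' then 0 else h * m v u with hδ
  obtain ⟨M, F, hc⟩ : Colorable t (2 * h - 1) m (fun u => w u + δ u) (V.erase v) := by
    refine H.colorable_of_pot (H.valid.of_le fun u => Nat.le_add_right _ _)
      (Finset.erase_ssubset hv.mem) fun B hB hs => ?_
    have h1 := H.gap (hB.trans_ssubset (Finset.erase_ssubset hv.mem)) hs
    have h2 := pot_weight (P := oddParams t h) (m := m) (w := w) (A := B) hP δ fun u _ => le_rfl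
    have h3 : ∑ u ∈ B, δ u ≤ h * 2 := by
      have e : nb m v (V.erase v') = 2 := by
        have := nb_erase (m := m) (v := v) hv'.mem
        have := hv.deg
        omega
      calc ∑ u ∈ B, δ u ≤ ∑ u ∈ V, δ u := Finset.sum_le_sum_of_subset
            (hB.trans (Finset.erase_subset _ _))
        _ = ∑ u ∈ V.erase v', h * m v u := by
            rw [← Finset.add_sum_erase _ _ hv'.mem]
            simp only [hδ, if_true, zero_add]
            exact Finset.sum_congr rfl fun u hu => if_neg (Finset.ne_of_mem_erase hu)
        _ = h * 2 := by rw [← Finset.mul_sum, ← e]; rfl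
    have h3' : ∑ u ∈ B, (δ u : ℤ) ≤ h * 2 := by exact_mod_cast h3
    rw [hbe] at h2
    linarith
  have hvV := Finset.notMem_erase v V
  have hvM : v ∉ M := fun hM => hvV (hc.left_subset hM)
  have h1 := hc.nb_add v
  rw [hm.nb_erase_self, hv.deg] at h1
  have hcw := hc.mono (m := m) (w := w) (fun _ _ _ _ => le_rfl) fun u _ => Nat.le_add_right _ _
  rcases Nat.lt_or_ge (nb m v F) 2 with h2 | h2
  · have := hcw.insert_right hm hvV (by omega)
    rw [Finset.insert_erase hv.mem] at this
    exact H.crit.not_colorable ⟨_, _, this⟩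
  by_cases hM' : v' ∈ M
  swap
  · have := hc.insert_left hvV (hc.left.insert_of_nb_le_one (w := w) (k := h) (l := h) hm hvM
      (fun u _ => Nat.le_add_right _ _) (fun u hu hvu => by
        have e : u ≠ v' := fun e => hM' (e ▸ hu)
        simp only [hδ, e, if_false]
        nlinarith) (by rw [hv.weight]; omega) (joinOK hh) (by omega))
    rw [Finset.insert_erase hv.mem] at this
    exact H.crit.not_colorable ⟨_, _, this⟩
  have h3 := nb_erase (m := m) (v := v) hM'
  have h4 := hc.nb_add v'
  have h5 := nb_erase (m := m) (v := v') hv.mem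
  rw [hm.symm v' v, hvv', hv'.deg] at h5
  have hMe := hcw.left.subset (Finset.erase_subset v' M)
  -- Now `v'` is the only neighbor of `v` in `M`. If it has no other neighbor there, `{v, v'}` is a
  -- component of weight `2h = D + 1`. Otherwise `v'` has at most one edge to `F` and trades places:
  -- `v'` moves to `F` and `v` enters `M`.
  by_cases h6 : nb m v' M = 0
  · refine H.crit.not_colorable ⟨{v, v'} ∪ M.erase v', F, ?_, ?_, ?_, hc.right⟩
    · rw [Finset.insert_union, ← Finset.insert_eq, Finset.insert_erase hM', Finset.insert_union,
        hc.union_eq, Finset.insert_erase hv.mem]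
    · rw [Finset.insert_union, ← Finset.insert_eq, Finset.insert_erase hM',
        Finset.disjoint_insert_left]
      exact ⟨fun hF => hvV (hc.right_subset hF), hc.disj⟩
    · refine (MOK.pair hm hne' hvv'.le (H.valid.one_le v) (H.valid.one_le v')
        (by rw [hv.weight, hv'.weight]; simp only [multiParams]; omega)).union hm hMe ?_ ?_
      · simp [hvM]
      · rw [Finset.insert_eq, cross_union_left (by simpa using hne')]
        simp only [cross_singleton_left, hm.nb_erase_self]
        omega
  · refine H.crit.not_colorable ⟨insert v (M.erase v'), insert v' F, ?_, ?_, ?_, ?_⟩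
    · rw [Finset.insert_union, Finset.union_insert, ← Finset.insert_union, Finset.insert_erase hM',
        hc.union_eq, Finset.insert_erase hv.mem]
    · have := hc.disj
      have hvF : v ∉ F := fun hF => hvV (hc.right_subset hF)
      rw [Finset.disjoint_insert_left, Finset.disjoint_insert_right]
      refine ⟨by simp [hne', hvF], by simp, this.mono_left (Finset.erase_subset _ _)⟩
    · exact hMe.insert_of_nb_eq_zero hm (fun hM => hvM (Finset.mem_of_mem_erase hM))
        (by rw [hv.weight]; omega) (by omega)
    · exact hc.right.insert hm (Finset.disjoint_left.1 hc.disj hM') (by omega)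

end OddCritical

end Odd

/-! ### Odd `D`: neighbors of light vertices. -/

section Odd

variable {α : Type*} [DecidableEq α] {m m' : α → α → ℕ} {w w' : α → ℕ} {V : Finset α}
  {t : Kind} {h : ℕ}

lemma pot_addEdge {P : Params} (hm : IsMult m) {a b : α} (hab : a ≠ b) (A : Finset α) :
    pot P (addEdge m a b) w A = pot P m w A - if a ∈ A ∧ b ∈ A then P.E else 0 := by
  unfold pot
  rw [hm.ed_addEdge hab]
  split_ifs <;> push_cast <;> ring

/-- However large the raise, it costs at most `E`; this is for forcing `s` into `F`. -/
lemma pot_raise_ge {P : Params} (hP : P.Good) (hv : ∀ v, 1 ≤ w v) (A : Finset α) (s : α) (k : ℕ) :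
    pot P m w A - (if s ∈ A then P.E else 0) ≤ pot P m (raise w s k) A := by
  have : ∑ v ∈ A, P.Φ (w v) ≤ ∑ v ∈ A, (P.Φ (raise w s k v) + if v = s then P.E else 0) := by
    refine Finset.sum_le_sum fun v _ => ?_
    split_ifs with h1
    · have := hP.edge (w v) (hv v)
      have := hP.f₀_le (raise w s k v)
      linarith
    · simp [raise, h1]
  rw [Finset.sum_add_distrib, Finset.sum_ite_eq'] at this
  unfold pot
  linarith

/-- The edges between `A \ B` and `B \ A` count only in the union. -/
lemma pot_submodular {P : Params} (hE : 0 ≤ P.E) (hm : IsMult m) (A B : Finset α) :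
    pot P m w (A ∪ B) + pot P m w (A ∩ B) ≤ pot P m w A + pot P m w B := by
  have d1 : Disjoint A (B \ A) := Finset.disjoint_sdiff
  have d2 : Disjoint (A ∩ B) (B \ A) := d1.mono_left Finset.inter_subset_left
  have h1 := pot_union (P := P) (w := w) hm d1
  have h2 := pot_union (P := P) (w := w) hm d2
  have e1 : A ∪ B \ A = A ∪ B := Finset.union_sdiff_self_eq_union
  have e2 : A ∩ B ∪ B \ A = B := by
    ext x; simp only [Finset.mem_union, Finset.mem_inter, Finset.mem_sdiff]; tauto
  rw [e1] at h1
  rw [e2] at h2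
  have h3 : (cross m (A ∩ B) (B \ A) : ℤ) ≤ cross m A (B \ A) := by
    exact_mod_cast cross_mono Finset.inter_subset_left subset_rfl
  nlinarith

namespace OddCritical

lemma nb_light_eq_two (H : OddCritical t h m w V) {v : α} (hv : Light h m w V v) {W : Finset α}
    (hWV : W ⊆ V) (hW : nb m v W = 2) : ∃ p ∈ W, ∃ q ∈ W, p ≠ q ∧ m v p = 1 ∧ m v q = 1 ∧
      ∀ x ∈ W, m v x ≤ if x = p ∨ x = q then 1 else 0 := by
  rcases nb_eq_two hW with ⟨q, hq, h2⟩ | h1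
  · have := H.mult_le_one hv (hWV hq)
    omega
  · exact h1

lemma Φ_light (H : OddCritical t h m w V) {v : α} (hv : Light h m w V v) :
    (oddParams t h).Φ (w v) = 6 * h + 1 := by
  have := H.one_le
  rw [oddParams_Φ this, hv.weight]; omega

/-- A neighbor of a vertex of positive charge does not have degree three. -/
lemma deg_ne_three (H : OddCritical t h m w V) {v u : α} (hv : Light h m w V v) (hu : u ∈ V)
    (hvu : 1 ≤ m v u) : nb m u V ≠ 3 := by
  intro hdu
  have hh := H.one_le
  have hm := H.valid.mult
  have hP : (oddParams t h).Good := multiParams_good t (2 * h - 1)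
  have hbe : (oddParams t h).b = 2 := rfl
  have hE := oddParams_E (t := t) hh
  have hvu1 : m v u = 1 := by have := H.mult_le_one hv hu; omega
  have huv1 : m u v = 1 := by rw [hm.symm, hvu1]
  have hne : v ≠ u := fun e => by rw [e, hm.diag] at hvu; omega
  have hwu : w u = h + 1 := by
    have h1 := H.weight_le hv hu hvu
    have h2 := H.le_weight hu hdu
    by_contra h3
    have := H.light_independent hv ⟨hu, hdu, by omega⟩
    omega
  set W := (V.erase u).erase v with hW
  have hWV : W ⊆ V := (Finset.erase_subset _ _).trans (Finset.erase_subset _ _)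
  have hvVu : v ∈ V.erase u := Finset.mem_erase.2 ⟨hne, hv.mem⟩
  have hVW : insert u (insert v W) = V := by
    rw [hW, Finset.insert_erase hvVu, Finset.insert_erase hu]
  have hvW : v ∉ W := Finset.notMem_erase v _
  have huvW : u ∉ insert v W := by
    rw [hW, Finset.insert_erase hvVu]; exact Finset.notMem_erase u V
  have huW : u ∉ W := fun hmem => huvW (Finset.mem_insert_of_mem hmem)
  have hvuW : v ∉ insert u W := by simp [hne, hvW]
  have hVW' : insert v (insert u W) = V := by rw [Finset.insert_comm, hVW]
  have hWss : W ⊂ V := Finset.ssubset_iff_subset_ne.2 ⟨hWV, fun e => huW (e ▸ hu)⟩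
  have hnu : nb m u W = 2 := by
    have h1 := hdu
    rw [← hVW, nb_insert huvW, hm.diag, nb_insert hvW] at h1
    omega
  have hnv : nb m v W = 2 := by
    have h1 := hv.deg
    rw [← hVW', nb_insert hvuW, hm.diag, nb_insert huW] at h1
    omega
  obtain ⟨p₁, hp₁, p₂, hp₂, hpne, -, -, hp⟩ := H.nb_light_eq_two hv hWV hnv
  rcases nb_eq_two hnu with ⟨q, hq, hq2⟩ | ⟨q₁, hq₁, q₂, hq₂, hqne, mq₁, mq₂, hqs⟩
  -- A double edge joins `u` to `q`. The added edge `p₁p₂` makes it possible to insert `v` into `F`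
  -- by subdivision, which is needed if `q` is in `F` and `u` goes to `M`. If `q` is in `M`, then
  -- `u` goes to `F`.
  · obtain ⟨M, F, hc⟩ : Colorable t (2 * h - 1) (addEdge m p₁ p₂) w W := by
      refine H.colorable_of_pot ⟨hm.addEdge hpne, H.valid.one_le, fun hs => by cases hs⟩ hWss
        fun B hB hs => ?_
      rw [pot_addEdge hm hpne, hE]
      have := H.gap (hB.trans_ssubset hWss) hs
      split_ifs <;> linarith
    have hcw : IsCol t (2 * h - 1) m w W M F :=
      hc.mono (fun _ _ _ _ => le_addEdge _ _ _ _ _) fun _ _ => le_rfl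
    have huM : u ∉ M := fun hM => huW (hc.left_subset hM)
    have huF : u ∉ F := fun hF => huW (hc.right_subset hF)
    have hvM : v ∉ M := fun hM => hvW (hc.left_subset hM)
    have hvF : v ∉ F := fun hF => hvW (hc.right_subset hF)
    have hu1 := hcw.nb_add u
    have hv1 := hcw.nb_add v
    rcases hcw.mem_or hq with hqM | hqF
    · have hu2 := le_nb (m := m) (v := u) hqM
      rcases Nat.lt_or_ge (nb m v F) 2 with h3 | h3
      · have h4 := hcw.insert_right hm hvW (by omega)
        have h5 := h4.insert_right hm huvW (by rw [nb_insert hvF]; omega)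
        rw [hVW] at h5
        exact H.crit.not_colorable ⟨_, _, h5⟩
      · have h4 := hcw.insert_right hm huW (by omega)
        have h5 := h4.insert_left hvuW (h4.left.insert_of_nb_eq_zero hm hvM
          (by rw [hv.weight]; omega) (by omega))
        rw [hVW'] at h5
        exact H.crit.not_colorable ⟨_, _, h5⟩
    · have hu2 := le_nb (m := m) (v := u) hqF
      have h4 := hcw.insert_left huW (hcw.left.insert_of_nb_eq_zero hm huM
          (by rw [hwu]; omega) (by omega))
      refine H.crit.not_colorable ⟨insert u M, insert v F, ?_, ?_, h4.left, ?_⟩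
      · rw [Finset.union_insert, h4.union_eq, hVW']
      · rw [Finset.disjoint_insert_right]
        exact ⟨by simp [hne, hvM], h4.disj⟩
      · exact hc.right.subdivide hm hpne fun x hx => hp x (hc.right_subset hx)
  -- Here `u` always enters `F` by subdividing `q₁q₂`, while the raises at the neighbors of `v`
  -- prepare `v` for `M`.
  · obtain ⟨M, F, hc⟩ : Colorable t (2 * h - 1) (addEdge m q₁ q₂) (raiseNb m w v h) W := by
      refine H.colorable_of_pot (w' := raiseNb m w v h) ⟨hm.addEdge hqne, fun x => (H.valid.one_le x).trans
        (Nat.le_add_right _ _), fun hs => by cases hs⟩ hWss fun B hB hs => ?_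
      rw [pot_addEdge hm hqne, hE]
      have h1 := H.gap (hB.trans_ssubset hWss) hs
      have h2 := pot_raiseNb (m := m) (w := w) hP v h B
      have h3 : nb m v B ≤ 2 := hnv ▸ nb_mono hB
      have huB : u ∉ B := fun hmem => huW (hB hmem)
      have hvB : v ∉ insert u B := fun hmem => hvuW (Finset.insert_subset_insert _ hB hmem)
      rw [hbe] at h2
      split_ifs with hqB
      · have h4 : nb m u B = 2 := by
          refine le_antisymm (hnu ▸ nb_mono hB) ?_
          have h5 := nb_mono (m := m) (v := u) (A := {q₁, q₂}) (B := B) (by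
            intro x hx
            simp only [Finset.mem_insert, Finset.mem_singleton] at hx
            rcases hx with rfl | rfl
            exacts [hqB.1, hqB.2])
          have h6 : nb m u {q₁, q₂} = 2 := by
            rw [nb_insert (by simpa using hqne), nb_singleton]; omega
          omega
        have h5 := pot_insert (P := oddParams t h) (w := w) hm huB
        have h6 := pot_insert (P := oddParams t h) (w := w) hm hvB
        rw [hwu, oddParams_Φ hh, hE, h4] at h5
        rw [H.Φ_light hv, hE, nb_insert huB, hvu1] at h6
        have hsub : insert v (insert u B) ⊆ V := by
          rw [← hVW']
          exact Finset.insert_subset_insert _ (Finset.insert_subset_insert _ hB)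
        have h7 : insert u B ⊂ V := Finset.ssubset_iff_subset_ne.2
          ⟨(Finset.subset_insert _ _).trans hsub, fun e => hvB (e ▸ hv.mem)⟩
        have h8 := H.gap h7 (by rw [Finset.card_insert_of_notMem huB]; omega)
        -- The critical case has two edges from `v` to `B`. The potential of `B ∪ {u, v}` is `8h`
        -- less than that of `B`, and `8h` is also the total cost, so `pot_ge` is just enough.
        by_cases h9 : insert v (insert u B) = V
        · have h10 := H.pot_ge
          rw [← h9] at h10
          interval_cases hr : nb m v B <;> push_cast at h2 h5 h6 <;> omega
        · have h10 := H.gap (Finset.ssubset_iff_subset_ne.2 ⟨hsub, h9⟩) (by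
            rw [Finset.card_insert_of_notMem hvB, Finset.card_insert_of_notMem huB]; omega)
          interval_cases hr : nb m v B <;> push_cast at h2 h5 h6 <;> omega
      · interval_cases hr : nb m v B <;> push_cast at h2 <;> omega
    have hcw : IsCol t (2 * h - 1) m (raiseNb m w v h) W M F :=
      hc.mono (fun _ _ _ _ => le_addEdge _ _ _ _ _) fun _ _ => le_rfl
    have huM : u ∉ M := fun hM => huW (hc.left_subset hM)
    have huF : u ∉ F := fun hF => huW (hc.right_subset hF)
    have hvM : v ∉ M := fun hM => hvW (hc.left_subset hM)
    have hv1 := hcw.nb_add v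
    have hww : ∀ x ∈ W, w x ≤ raiseNb m w v h x := fun x _ => Nat.le_add_right _ _
    have h4 : IsCol t (2 * h - 1) m (raiseNb m w v h) (insert u W) M (insert u F) :=
      ⟨by rw [Finset.union_insert, hcw.union_eq], Finset.disjoint_insert_right.2 ⟨huM, hcw.disj⟩,
        hcw.left, hc.right.subdivide hm hqne fun x hx => hqs x (hc.right_subset hx)⟩
    have h4w : IsCol t (2 * h - 1) m w (insert u W) M (insert u F) :=
      h4.mono (fun _ _ _ _ => le_rfl) fun x _ => Nat.le_add_right _ _
    rcases Nat.eq_zero_or_pos (nb m v F) with h5 | h5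
    · have h6 := h4w.insert_right hm hvuW (by rw [nb_insert huF]; omega)
      rw [hVW'] at h6
      exact H.crit.not_colorable ⟨_, _, h6⟩
    · have h6 := h4.insert_left hvuW (hcw.left.insert_of_nb_le_one (w := w) (k := h) (l := h) hm hvM
        (fun x hx => hww x (hcw.left_subset hx)) (fun x hx hvx => by unfold raiseNb; nlinarith)
        (by rw [hv.weight]; omega) (joinOK hh) (by omega))
      rw [hVW'] at h6
      exact H.crit.not_colorable ⟨_, _, h6⟩

/-- A configuration of a vertex of degree four and weight one with three light neighbors. -/
structure Star (h : ℕ) (m : α → α → ℕ) (w : α → ℕ) (V : Finset α) (u s t₁ t₂ t₃ : α) : Prop where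
  mem : u ∈ V
  weight : w u = 1
  deg : nb m u V = 4
  light₁ : Light h m w V t₁
  light₂ : Light h m w V t₂
  light₃ : Light h m w V t₃
  adj₁ : m u t₁ = 1
  adj₂ : m u t₂ = 1
  adj₃ : m u t₃ = 1
  ne₁₂ : t₁ ≠ t₂
  ne₁₃ : t₁ ≠ t₃
  ne₂₃ : t₂ ≠ t₃
  mem_s : s ∈ V
  adj_s : m u s = 1
  ne₁ : s ≠ t₁
  ne₂ : s ≠ t₂
  ne₃ : s ≠ t₃

lemma Star.swap₁₂ {u s t₁ t₂ t₃ : α} (S : Star h m w V u s t₁ t₂ t₃) :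
    Star h m w V u s t₂ t₁ t₃ :=
  ⟨S.mem, S.weight, S.deg, S.light₂, S.light₁, S.light₃, S.adj₂, S.adj₁, S.adj₃, S.ne₁₂.symm,
    S.ne₂₃, S.ne₁₃, S.mem_s, S.adj_s, S.ne₂, S.ne₁, S.ne₃⟩

lemma Star.swap₂₃ {u s t₁ t₂ t₃ : α} (S : Star h m w V u s t₁ t₂ t₃) :
    Star h m w V u s t₁ t₃ t₂ :=
  ⟨S.mem, S.weight, S.deg, S.light₁, S.light₃, S.light₂, S.adj₁, S.adj₃, S.adj₂, S.ne₁₃,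
    S.ne₁₂, S.ne₂₃.symm, S.mem_s, S.adj_s, S.ne₁, S.ne₃, S.ne₂⟩

lemma Star.nb_le {u s t₁ t₂ t₃ : α} (S : Star h m w V u s t₁ t₂ t₃) {A : Finset α} (hA : A ⊆ V)
    (h₁ : t₁ ∉ A) (h₂ : t₂ ∉ A) (h₃ : t₃ ∉ A) : nb m u A ≤ if s ∈ A then 1 else 0 := by
  have hd : Disjoint {s, t₁, t₂, t₃} (A.erase s) := by
    rw [Finset.disjoint_left]
    intro x hx hxA
    simp only [Finset.mem_insert, Finset.mem_singleton] at hx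
    rcases hx with rfl | rfl | rfl | rfl
    · exact Finset.notMem_erase x A hxA
    · exact h₁ (Finset.mem_of_mem_erase hxA)
    · exact h₂ (Finset.mem_of_mem_erase hxA)
    · exact h₃ (Finset.mem_of_mem_erase hxA)
  have hsub : {s, t₁, t₂, t₃} ∪ A.erase s ⊆ V := by
    intro x hx
    simp only [Finset.mem_union, Finset.mem_insert, Finset.mem_singleton] at hx
    rcases hx with (rfl | rfl | rfl | rfl) | hx
    exacts [S.mem_s, S.light₁.mem, S.light₂.mem, S.light₃.mem, hA (Finset.mem_of_mem_erase hx)]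
  have h4 := nb_mono (m := m) (v := u) hsub
  rw [nb_union hd, S.deg, nb_insert (by simp [S.ne₁, S.ne₂, S.ne₃]), S.adj_s,
    nb_insert (by simp [S.ne₁₂, S.ne₁₃]), S.adj₁, nb_insert (by simp [S.ne₂₃]), S.adj₂,
    nb_singleton, S.adj₃] at h4
  split_ifs with hs
  · rw [nb_erase hs, S.adj_s]; omega
  · rw [Finset.erase_eq_of_notMem hs] at h4; omega

lemma Φ_one (hh : 1 ≤ h) : (oddParams t h).Φ 1 = 8 * h - 1 := by
  rw [oddParams_Φ hh]; omega

/-- At most one of the light neighbors obstructs the reduction of a star. -/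
lemma star_obstruction (H : OddCritical t h m w V) {u s t₁ t₂ t₃ : α}
    (S : Star h m w V u s t₁ t₂ t₃) {U₁ U₂ : Finset α} (hU₁ : U₁ ⊆ V) (hU₂ : U₂ ⊆ V)
    (hu₁ : u ∈ U₁) (hs₁ : s ∈ U₁) (h₁₂ : t₂ ∉ U₁) (h₁₃ : t₃ ∉ U₁)
    (hu₂ : u ∈ U₂) (hs₂ : s ∈ U₂) (h₂₁ : t₁ ∉ U₂) (h₂₃ : t₃ ∉ U₂)
    (hp₁ : pot (oddParams t h) m w U₁ < 6 * h - 1) :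
    6 * (h : ℤ) - 1 ≤ pot (oddParams t h) m w U₂ := by
  have hh := H.one_le
  have hm := H.valid.mult
  have hE := oddParams_E (t := t) hh
  -- The union misses `t₃`, so it has potential at least `4h`. The intersection consists of `u` with
  -- at most one edge and a nonempty rest, hence at least `8h - 2`. The two sets cannot both lie
  -- below `6h - 1`.
  have h1 := pot_submodular (P := oddParams t h) (w := w) (by rw [hE]; omega) hm U₁ U₂
  have hus : u ≠ s := fun e => by have := S.adj_s; rw [e, hm.diag] at this; omega
  have h2 := H.gap (A := U₁ ∪ U₂) (Finset.ssubset_iff_subset_ne.2 ⟨Finset.union_subset hU₁ hU₂,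
    fun e => by
      have := S.light₃.mem
      rw [← e, Finset.mem_union] at this
      tauto⟩) (Finset.one_lt_card.2 ⟨u, by simp [hu₁], s, by simp [hs₁], hus⟩)
  have huI : u ∈ U₁ ∩ U₂ := Finset.mem_inter.2 ⟨hu₁, hu₂⟩
  have h3 := pot_insert (P := oddParams t h) (w := w) hm (Finset.notMem_erase u (U₁ ∩ U₂))
  rw [Finset.insert_erase huI, S.weight, Φ_one hh, hE, hm.nb_erase_self] at h3
  have h4 := S.nb_le (A := U₁ ∩ U₂) (Finset.inter_subset_left.trans hU₁) (by simp [h₂₁])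
    (by simp [h₁₂]) (by simp [h₁₃])
  have h5 : nb m u (U₁ ∩ U₂) ≤ 1 := h4.trans (by split_ifs <;> omega)
  have h6 : (nb m u (U₁ ∩ U₂) : ℤ) ≤ 1 := by exact_mod_cast h5
  have h7 := H.gap_of_nonempty (A := (U₁ ∩ U₂).erase u) (Finset.ssubset_iff_subset_ne.2
    ⟨(Finset.erase_subset _ _).trans (Finset.inter_subset_left.trans hU₁), fun e =>
      Finset.notMem_erase u (U₁ ∩ U₂) (by rw [e]; exact S.mem)⟩)
    ⟨s, by simp [hus.symm, hs₁, hs₂]⟩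
  have hh' : (1 : ℤ) ≤ h := by exact_mod_cast hh
  nlinarith

-- Delete `u` and its light neighbors, force `s` into `F`, and replace `t₁` and `t₂` by edges
-- between their other neighbors. After coloring, `t₁` and `t₂` subdivide these edges in `F`, and
-- `u` goes to `M`, with `t₃` as its only possible neighbor there.
set_option maxHeartbeats 800000 in
lemma star_reducible (H : OddCritical t h m w V) {u s t₁ t₂ t₃ : α}
    (S : Star h m w V u s t₁ t₂ t₃)
    (hb₁ : ∀ U ⊆ V, u ∈ U → s ∈ U → t₂ ∉ U → t₃ ∉ U → 6 * (h : ℤ) - 1 ≤ pot (oddParams t h) m w U)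
    (hb₂ : ∀ U ⊆ V, u ∈ U → s ∈ U → t₁ ∉ U → t₃ ∉ U → 6 * (h : ℤ) - 1 ≤ pot (oddParams t h) m w U) :
    False := by
  have hh := H.one_le
  have hm := H.valid.mult
  have hP : (oddParams t h).Good := multiParams_good t (2 * h - 1)
  have hE := oddParams_E (t := t) hh
  have hus : u ≠ s := fun e => by have := S.adj_s; rw [e, hm.diag] at this; omega
  have hu₁ : t₁ ≠ u := fun e => by have := S.adj₁; rw [e, hm.diag] at this; omega
  have hu₂ : t₂ ≠ u := fun e => by have := S.adj₂; rw [e, hm.diag] at this; omega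
  have hu₃ : t₃ ≠ u := fun e => by have := S.adj₃; rw [e, hm.diag] at this; omega
  have h₁₂ := H.light_independent S.light₁ S.light₂
  have h₁₃ := H.light_independent S.light₁ S.light₃
  have h₂₃ := H.light_independent S.light₂ S.light₃
  have h₂₁ := H.light_independent S.light₂ S.light₁
  have h₃₁ := H.light_independent S.light₃ S.light₁
  have h₃₂ := H.light_independent S.light₃ S.light₂
  have a₁ : m t₁ u = 1 := by rw [hm.symm, S.adj₁]
  have a₂ : m t₂ u = 1 := by rw [hm.symm, S.adj₂]
  have a₃ : m t₃ u = 1 := by rw [hm.symm, S.adj₃]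
  set W := V \ {u, t₁, t₂, t₃} with hW
  have hWV : W ⊆ V := Finset.sdiff_subset
  have hmemW : ∀ x, x ∈ W ↔ x ∈ V ∧ x ≠ u ∧ x ≠ t₁ ∧ x ≠ t₂ ∧ x ≠ t₃ := fun x => by
    simp [hW]
  have huW : u ∉ W := by simp [hmemW]
  have h₁W : t₁ ∉ W := by simp [hmemW]
  have h₂W : t₂ ∉ W := by simp [hmemW]
  have h₃W : t₃ ∉ W := by simp [hmemW]
  have hsW : s ∈ W := (hmemW s).2 ⟨S.mem_s, hus.symm, S.ne₁, S.ne₂, S.ne₃⟩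
  have hVW : insert u (insert t₁ (insert t₂ (insert t₃ W))) = V := by
    ext x
    simp only [Finset.mem_insert, hmemW]
    constructor
    · rintro (rfl | rfl | rfl | rfl | hx)
      exacts [S.mem, S.light₁.mem, S.light₂.mem, S.light₃.mem, hx.1]
    · tauto
  have hWss : W ⊂ V := Finset.ssubset_iff_subset_ne.2 ⟨hWV, fun e => huW (e ▸ S.mem)⟩
  have hdeg : ∀ x, nb m x V = m x u + (m x t₁ + (m x t₂ + (m x t₃ + nb m x W))) := fun x => by
    rw [← hVW, nb_insert (by simp [hu₁.symm, hu₂.symm, hu₃.symm, huW]),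
      nb_insert (by simp [S.ne₁₂, S.ne₁₃, h₁W]), nb_insert (by simp [S.ne₂₃, h₂W]), nb_insert h₃W]
  have n₁ : nb m t₁ W = 2 := by
    have := hdeg t₁; rw [S.light₁.deg, hm.diag] at this; omega
  have n₂ : nb m t₂ W = 2 := by
    have := hdeg t₂; rw [S.light₂.deg, hm.diag] at this; omega
  have n₃ : nb m t₃ W = 2 := by
    have := hdeg t₃; rw [S.light₃.deg, hm.diag] at this; omega
  obtain ⟨p₁, hp₁, q₁, hq₁, hpq₁, mp₁, mq₁, hs₁⟩ := H.nb_light_eq_two S.light₁ hWV n₁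
  obtain ⟨p₂, hp₂, q₂, hq₂, hpq₂, mp₂, mq₂, hs₂⟩ := H.nb_light_eq_two S.light₂ hWV n₂
  have full : ∀ {x p q : α} {B : Finset α}, B ⊆ W → nb m x W = 2 → p ≠ q → m x p = 1 →
      m x q = 1 → p ∈ B → q ∈ B → nb m x B = 2 := by
    intro x p q B hB hx hpq hp hq hpB hqB
    refine le_antisymm (hx ▸ nb_mono hB) ?_
    have h5 := nb_mono (m := m) (v := x) (A := {p, q}) (B := B) (by
      intro y hy
      simp only [Finset.mem_insert, Finset.mem_singleton] at hy
      rcases hy with rfl | rfl <;> assumption)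
    rw [nb_insert (by simpa using hpq), nb_singleton, hp, hq] at h5
    exact h5
  set m₂ := addEdge m p₂ q₂ with hm₂
  have hM₂ : IsMult m₂ := hm.addEdge hpq₂
  obtain ⟨M, F, hc⟩ : Colorable t (2 * h - 1) (addEdge m₂ p₁ q₁) (raise w s (2 * h + 1)) W := by
    refine H.colorable_of_pot (w' := raise w s (2 * h + 1)) ⟨hM₂.addEdge hpq₁, fun x => (H.valid.one_le x).trans
      (le_raise _ _ _ _), fun hs => by cases hs⟩ hWss fun B hB hs => ?_
    rw [pot_addEdge hM₂ hpq₁, hm₂, pot_addEdge hm hpq₂, hE]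
    have h1 := H.gap (hB.trans_ssubset hWss) hs
    have h2 := pot_raise_ge (P := oddParams t h) (m := m) hP H.valid.one_le B s (2 * h + 1)
    rw [hE] at h2
    have huB : u ∉ B := fun hx => huW (hB hx)
    have h₁B : t₁ ∉ B := fun hx => h₁W (hB hx)
    have h₂B : t₂ ∉ B := fun hx => h₂W (hB hx)
    have h₃B : t₃ ∉ B := fun hx => h₃W (hB hx)
    have hBV := hB.trans hWV
    have hnu : (if s ∈ B then 1 else 0 : ℤ) ≤ nb m u B := by
      split_ifs with hsB
      · have := le_nb (m := m) (v := u) hsB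
        rw [S.adj_s] at this
        exact_mod_cast this
      · positivity
    have pu := pot_insert (P := oddParams t h) (w := w) hm huB
    rw [S.weight, Φ_one hh, hE] at pu
    have huBV : insert u B ⊆ V := Finset.insert_subset S.mem hBV
    have hh' : (1 : ℤ) ≤ h := by exact_mod_cast hh
    have hmul := mul_le_mul_of_nonneg_left hnu (by linarith : 0 ≤ 4 * (h : ℤ))
    by_cases hf₁ : p₁ ∈ B ∧ q₁ ∈ B
    · have k₁ := full hB n₁ hpq₁ mp₁ mq₁ hf₁.1 hf₁.2
      have h₁u : t₁ ∉ insert u B := by simp [hu₁, h₁B]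
      have pt₁ := pot_insert (P := oddParams t h) (w := w) hm h₁u
      rw [H.Φ_light S.light₁, hE, nb_insert huB, a₁, k₁] at pt₁
      push_cast at pt₁
      -- With both new edges in `B`, add `u, t₁, t₂` to `B` and use the gap, as `t₃` is missing.
      -- With one of them and `s` in `B`, the total cost is `8h`, and only `hb₁` or `hb₂` helps. In
      -- all other cases the cost is at most `4h`.
      by_cases hf₂ : p₂ ∈ B ∧ q₂ ∈ B
      · have k₂ := full hB n₂ hpq₂ mp₂ mq₂ hf₂.1 hf₂.2
        have h₂u : t₂ ∉ insert t₁ (insert u B) := by simp [hu₂, h₂B, S.ne₁₂.symm]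
        have pt₂ := pot_insert (P := oddParams t h) (w := w) hm h₂u
        rw [H.Φ_light S.light₂, hE, nb_insert h₁u, nb_insert huB, a₂, k₂, h₂₁] at pt₂
        push_cast at pt₂
        have h3 := H.gap (A := insert t₂ (insert t₁ (insert u B)))
          (Finset.ssubset_iff_subset_ne.2 ⟨Finset.insert_subset S.light₂.mem
            (Finset.insert_subset S.light₁.mem huBV), fun e => by
              have := S.light₃.mem
              rw [← e] at this
              simp [S.ne₂₃.symm, S.ne₁₃.symm, hu₃, h₃B] at this⟩)
          (hs.trans_le (Finset.card_le_card fun x hx => by simp [hx]))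
        simp only [hf₁, hf₂, and_self, if_true]
        split_ifs at h2 hmul <;> linarith
      · simp only [hf₁, hf₂, and_self, if_true, if_false]
        by_cases hsB : s ∈ B
        · have h3 := hb₁ (insert t₁ (insert u B)) (Finset.insert_subset S.light₁.mem huBV)
            (by simp) (by simp [hsB]) (by simp [S.ne₁₂.symm, hu₂, h₂B])
            (by simp [S.ne₁₃.symm, hu₃, h₃B])
          rw [if_pos hsB] at h2 hmul
          linarith
        · rw [if_neg hsB] at h2
          linarith
    · by_cases hf₂ : p₂ ∈ B ∧ q₂ ∈ B
      · simp only [hf₁, hf₂, and_self, if_true, if_false]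
        have k₂ := full hB n₂ hpq₂ mp₂ mq₂ hf₂.1 hf₂.2
        have h₂u : t₂ ∉ insert u B := by simp [hu₂, h₂B]
        have pt₂ := pot_insert (P := oddParams t h) (w := w) hm h₂u
        rw [H.Φ_light S.light₂, hE, nb_insert huB, a₂, k₂] at pt₂
        push_cast at pt₂
        by_cases hsB : s ∈ B
        · have h3 := hb₂ (insert t₂ (insert u B)) (Finset.insert_subset S.light₂.mem huBV)
            (by simp) (by simp [hsB]) (by simp [S.ne₁₂, hu₁, h₁B])
            (by simp [S.ne₂₃.symm, hu₃, h₃B])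
          rw [if_pos hsB] at h2 hmul
          linarith
        · rw [if_neg hsB] at h2
          linarith
      · simp only [hf₁, hf₂, if_false]
        split_ifs at h2 <;> linarith
  have hcw : IsCol t (2 * h - 1) m w W M F := hc.mono
    (fun _ _ _ _ => (le_addEdge _ _ _ _ _).trans (le_addEdge _ _ _ _ _)) fun _ _ => le_raise _ _ _ _
  have hsM : s ∉ M := fun hM => by
    have h1 := hc.left.weight_le hM
    rw [raise_self] at h1
    omega
  have hsF : s ∈ F := (hc.mem_or hsW).resolve_left hsM
  have hFW := hc.right_subset
  have hMW := hc.left_subset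
  have f₁ : ForestOn m₂ (insert t₁ F) := hc.right.subdivide hM₂ hpq₁
    fun x hx => by
      have e₁ : t₁ ≠ p₂ := fun e => h₁W (e ▸ hp₂)
      have e₂ : t₁ ≠ q₂ := fun e => h₁W (e ▸ hq₂)
      rw [hm₂, addEdge_of_ne _ e₁ e₂]
      exact hs₁ x (hFW hx)
  have f₂ : ForestOn m (insert t₂ (insert t₁ F)) := f₁.subdivide hm hpq₂
    fun x hx => by
      rcases Finset.mem_insert.1 hx with rfl | hx
      · rw [h₂₁]; exact Nat.zero_le _
      · exact hs₂ x (hFW hx)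
  have huM0 : nb m u M = 0 := by
    have := S.nb_le (hMW.trans hWV) (fun hx => h₁W (hMW hx)) (fun hx => h₂W (hMW hx))
      (fun hx => h₃W (hMW hx))
    rw [if_neg hsM] at this
    omega
  have huM : u ∉ M := fun hx => huW (hMW hx)
  have h₃M : t₃ ∉ M := fun hx => h₃W (hMW hx)
  have h₁F : t₁ ∉ F := fun hx => h₁W (hFW hx)
  have h₂F : t₂ ∉ F := fun hx => h₂W (hFW hx)
  have h₃F : t₃ ∉ F := fun hx => h₃W (hFW hx)
  have huF : u ∉ F := fun hx => huW (hFW hx)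
  have hd : Disjoint M (insert t₂ (insert t₁ F)) := by
    rw [Finset.disjoint_insert_right, Finset.disjoint_insert_right]
    exact ⟨fun hx => h₂W (hMW hx), fun hx => h₁W (hMW hx), hcw.disj⟩
  have h₃add := hcw.nb_add t₃
  -- Independence gives `t₃` no edges to `t₁, t₂`, so it fits into `F` unless both remaining edges
  -- go there. In that case `{u, t₃}` is a component of `M` of weight `h + 1 ≤ 2h`.
  rcases Nat.lt_or_ge (nb m t₃ F) 2 with h5 | h5
  · refine H.crit.not_colorable ⟨insert u M, insert t₃ (insert t₂ (insert t₁ F)), ?_, ?_, ?_, ?_⟩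
    · rw [← hVW, ← hcw.union_eq]
      ext x; simp only [Finset.mem_union, Finset.mem_insert]; tauto
    · rw [Finset.disjoint_insert_left, Finset.disjoint_insert_right]
      exact ⟨by simp [hu₁.symm, hu₂.symm, hu₃.symm, huF], h₃M, hd⟩
    · exact hcw.left.insert_of_nb_eq_zero hm huM (by rw [S.weight]; omega) huM0
    · refine f₂.insert hm (by simp [S.ne₂₃.symm, S.ne₁₃.symm, h₃F]) ?_
      rw [nb_insert (by simp [S.ne₁₂.symm, h₂F]), nb_insert h₁F, h₃₁, h₃₂]
      omega
  · refine H.crit.not_colorable ⟨{u, t₃} ∪ M, insert t₂ (insert t₁ F), ?_, ?_, ?_, f₂⟩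
    · rw [← hVW, ← hcw.union_eq]
      ext x; simp only [Finset.mem_union, Finset.mem_insert, Finset.mem_singleton]; tauto
    · rw [Finset.disjoint_union_left]
      refine ⟨?_, hd⟩
      rw [Finset.disjoint_insert_left, Finset.disjoint_singleton_left]
      exact ⟨by simp [hu₁.symm, hu₂.symm, huF], by simp [S.ne₂₃.symm, S.ne₁₃.symm, h₃F]⟩
    · refine (MOK.pair hm hu₃.symm S.adj₃.le (H.valid.one_le _) (H.valid.one_le _)
        (by rw [S.weight, S.light₃.weight]; simp only [multiParams]; omega)).union hm hcw.left ?_ ?_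
      · rw [Finset.disjoint_insert_left, Finset.disjoint_singleton_left]
        exact ⟨huM, h₃M⟩
      · rw [Finset.insert_eq, cross_union_left (by simpa using hu₃.symm)]
        simp only [cross_singleton_left]
        omega

/-- By `star_obstruction` at most one of the three light neighbors is obstructed; that one is given
the role of `t₃`. -/
lemma not_star (H : OddCritical t h m w V) {u s t₁ t₂ t₃ : α} (S : Star h m w V u s t₁ t₂ t₃) :
    False := by
  by_cases h₁ : ∃ U ⊆ V, u ∈ U ∧ s ∈ U ∧ t₂ ∉ U ∧ t₃ ∉ U ∧ pot (oddParams t h) m w U < 6 * h - 1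
  · obtain ⟨U, hU, hu, hs, ht₂, ht₃, hp⟩ := h₁
    refine H.star_reducible S.swap₁₂.swap₂₃ (fun U' hU' hu' hs' hx hy => ?_)
      (fun U' hU' hu' hs' hx hy => ?_)
    · exact H.star_obstruction S hU hU' hu hs ht₂ ht₃ hu' hs' hy hx hp
    · exact H.star_obstruction S.swap₂₃ hU hU' hu hs ht₃ ht₂ hu' hs' hy hx hp
  push Not at h₁
  by_cases h₂ : ∃ U ⊆ V, u ∈ U ∧ s ∈ U ∧ t₁ ∉ U ∧ t₃ ∉ U ∧ pot (oddParams t h) m w U < 6 * h - 1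
  · obtain ⟨U, hU, hu, hs, ht₁, ht₃, hp⟩ := h₂
    refine H.star_reducible S.swap₂₃ (fun U' hU' hu' hs' hx hy => h₁ U' hU' hu' hs' hy hx)
      (fun U' hU' hu' hs' hx hy => ?_)
    exact H.star_obstruction S.swap₁₂.swap₂₃ hU hU' hu hs ht₃ ht₁ hu' hs' hy hx hp
  push Not at h₂
  exact H.star_reducible S h₁ h₂

end OddCritical

end Odd

/-! ### Discharging for odd `D`. -/

section Discharging

variable {α : Type*} [DecidableEq α] {m : α → α → ℕ} {w : α → ℕ} {V : Finset α}
  {t : Kind} {h : ℕ}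

lemma forestOn_of_independent (hm : IsMult m) {I : Finset α} (hI : ∀ x ∈ I, ∀ y ∈ I, m x y = 0)
    {r : α} (hr : r ∉ I) (h : ∀ x ∈ I, m x r ≤ 1) : ForestOn m (insert r I) := by
  induction I using Finset.induction_on with
  | empty => exact ForestOn.singleton hm r
  | insert x I hx ih =>
    rw [Finset.mem_insert, not_or] at hr
    rw [Finset.insert_comm]
    refine (ih (fun x hx y hy => hI x (Finset.mem_insert_of_mem hx) y (Finset.mem_insert_of_mem hy))
      hr.2 fun x hx => h x (Finset.mem_insert_of_mem hx)).insert hm (by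
        simp [hx, Ne.symm hr.1]) ?_
    have h0 : nb m x I = 0 := Finset.sum_eq_zero fun y hy =>
      hI x (Finset.mem_insert_self _ _) y (Finset.mem_insert_of_mem hy)
    have := h x (Finset.mem_insert_self _ _)
    rw [nb_insert hr.2]
    omega

namespace OddCritical

lemma nb_light_le (H : OddCritical t h m w V) {I : Finset α} (hI : ∀ x ∈ I, Light h m w V x) {u : α}
    (hu : u ∈ V) (hw : w u = 1) (hd : nb m u V = 4) : nb m u I ≤ 2 := by
  by_contra hlt
  have hm := H.valid.mult
  have one : ∀ x ∈ I, m u x ≤ 1 := fun x hx => by rw [hm.symm]; exact H.mult_le_one (hI x hx) hu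
  obtain ⟨t₁, h₁, k₁⟩ := exists_of_nb_pos (by omega : 0 < nb m u I)
  have e₁ := nb_erase (m := m) (v := u) h₁
  have o₁ := one _ h₁
  obtain ⟨t₂, h₂, k₂⟩ := exists_of_nb_pos (by omega : 0 < nb m u (I.erase t₁))
  have e₂ := nb_erase (m := m) (v := u) h₂
  have o₂ := one _ (Finset.mem_of_mem_erase h₂)
  obtain ⟨t₃, h₃, k₃⟩ := exists_of_nb_pos (by omega : 0 < nb m u ((I.erase t₁).erase t₂))
  simp only [Finset.mem_erase] at h₂ h₃
  have o₃ := one _ h₃.2.2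
  have f₁ := nb_erase (m := m) (v := u) (hI _ h₁).mem
  have f₂ := nb_erase (m := m) (v := u) (A := V.erase t₁) (x := t₂)
    (Finset.mem_erase.2 ⟨h₂.1, (hI _ h₂.2).mem⟩)
  have f₃ := nb_erase (m := m) (v := u) (A := (V.erase t₁).erase t₂) (x := t₃)
    (Finset.mem_erase.2 ⟨h₃.1, Finset.mem_erase.2 ⟨h₃.2.1, (hI _ h₃.2.2).mem⟩⟩)
  obtain ⟨s, hs, ks⟩ :=
    exists_of_nb_pos (by omega : 0 < nb m u (((V.erase t₁).erase t₂).erase t₃))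
  have hs' := le_nb (m := m) (v := u) hs
  simp only [Finset.mem_erase] at hs
  exact H.not_star ⟨hu, hw, hd, hI _ h₁, hI _ h₂.2, hI _ h₃.2.2, by omega, by omega, by omega,
    h₂.1.symm, h₃.2.1.symm, h₃.1.symm, hs.2.2.2, by omega, hs.2.2.1, hs.2.1, hs.1⟩

/-- This is three times the charge after each light vertex has sent `2/3` along each edge. Vertices
of degree two or three receive nothing, being too heavy or excluded by `deg_ne_three`. The extremal
case is degree four, weight one and two light neighbors. -/
lemma charge_le (H : OddCritical t h m w V) {I : Finset α} (hI : ∀ x ∈ I, Light h m w V x) {u : α}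
    (hu : u ∈ V) (hl : ¬ Light h m w V u) :
    (w u = 1 ∧ nb m u V = 4 ∧ nb m u I = 2 ∧
      3 * (2 * (oddParams t h).Φ (w u) - (oddParams t h).E * nb m u V) + 2 * nb m u I = -2) ∨
      3 * (2 * (oddParams t h).Φ (w u) - (oddParams t h).E * nb m u V) + 2 * nb m u I ≤ -4 := by
  have hm := H.valid.mult
  have hh := H.one_le
  have h1 := H.valid.one_le u
  have hD := oddParams_D (t := t) hh
  have h2 := H.crit.two_le_deg hm hu
  have h3 : nb m u I ≤ nb m u V := nb_mono fun x hx => (hI x hx).mem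
  have hno : (∀ x ∈ I, m x u = 0) → nb m u I = 0 := fun hx =>
    Finset.sum_eq_zero fun x hxI => by rw [hm.symm]; exact hx x hxI
  rw [oddParams_Φ hh, oddParams_E hh]
  rcases (by omega : nb m u V = 2 ∨ nb m u V = 3 ∨ nb m u V = 4 ∨ 5 ≤ nb m u V) with h4 | h4 | h4 | h4
  · have h5 := H.crit.weight_of_deg_two hm hu h4
    have h6 := hno fun x hx => by
      by_contra hne
      have := H.weight_le (hI x hx) hu (by omega)
      omega
    rw [h4, h6]
    push_cast
    omega
  · have h5 := H.le_weight hu h4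
    have h6 : w u ≠ h := fun e => hl ⟨hu, h4, e⟩
    have h7 := hno fun x hx => by
      by_contra hne
      exact H.deg_ne_three (hI x hx) hu (by omega) h4
    rw [h4, h7]
    push_cast
    omega
  · by_cases h5 : w u = 1
    · have h6 := H.nb_light_le hI hu h5 h4
      rw [h4, h5]
      rcases Nat.lt_or_ge (nb m u I) 2 with h7 | h7
      · right
        push_cast
        omega
      · exact Or.inl ⟨rfl, rfl, by omega, by push_cast; omega⟩
    · right
      rw [h4]
      push_cast
      omega
  · right
    have h6 : (4 : ℤ) * h * nb m u V ≥ 4 * (h * 5) + 4 * (nb m u V - 5) := by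
      have a : (1 : ℤ) ≤ h := by exact_mod_cast hh
      have b : (5 : ℤ) ≤ nb m u V := by exact_mod_cast h4
      nlinarith [mul_nonneg (sub_nonneg.2 a) (sub_nonneg.2 b)]
    omega

lemma false (H : OddCritical t h m w V) : False := by
  classical
  have hm := H.valid.mult
  have hh := H.one_le
  have hE := oddParams_E (t := t) hh
  obtain ⟨I, hI⟩ : ∃ I : Finset α, ∀ x, x ∈ I ↔ Light h m w V x :=
    ⟨V.filter (Light h m w V), fun x => by
      simp only [Finset.mem_filter, and_iff_right_iff_imp]
      exact fun hx => hx.mem⟩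
  have hIV : I ⊆ V := fun x hx => ((hI x).1 hx).mem
  have hd : Disjoint I (V \ I) := Finset.disjoint_sdiff
  have hIR : I ∪ V \ I = V := Finset.union_sdiff_of_subset hIV
  have hind : ∀ x ∈ I, nb m x I = 0 := fun x hx => Finset.sum_eq_zero fun y hy =>
    H.light_independent ((hI x).1 hx) ((hI y).1 hy)
  have hnbR : ∀ x ∈ I, nb m x (V \ I) = 3 := fun x hx => by
    have h1 := ((hI x).1 hx).deg
    rw [← hIR, nb_union hd, hind x hx] at h1
    omega
  have hcross : ∑ r ∈ V \ I, nb m r I = 3 * I.card := by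
    rw [← hm.cross_eq_sum, cross, Finset.sum_congr rfl hnbR]
    simp [mul_comm]
  have hsum := two_mul_pot (P := oddParams t h) (w := w) hm V
  rw [← Finset.sum_sdiff hIV] at hsum
  have hIsum : ∑ v ∈ I, (2 * (oddParams t h).Φ (w v) - (oddParams t h).E * nb m v V) =
      2 * I.card := by
    rw [Finset.sum_congr rfl (g := fun _ => (2 : ℤ)) fun v hv => ?_]
    · simp [mul_comm]
    · rw [H.Φ_light ((hI v).1 hv), ((hI v).1 hv).deg, hE]
      push_cast
      ring
  have hcross' : ∑ r ∈ V \ I, (nb m r I : ℤ) = 3 * I.card := by exact_mod_cast hcross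
  -- A light vertex has charge `2` and three edges, all leaving `I`, so it ends with zero and the
  -- whole sum lies on `V \ I`.
  set g : α → ℤ := fun v => 3 * (2 * (oddParams t h).Φ (w v) - (oddParams t h).E * nb m v V) +
    2 * nb m v I with hg
  have hgsum : ∑ v ∈ V \ I, g v = 6 * pot (oddParams t h) m w V := by
    simp only [hg]
    rw [Finset.sum_add_distrib, ← Finset.mul_sum, ← Finset.mul_sum, hcross']
    linarith
  have hch : ∀ v ∈ V \ I, (w v = 1 ∧ nb m v V = 4 ∧ nb m v I = 2 ∧ g v = -2) ∨ g v ≤ -4 :=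
    fun v hv => by
      rw [Finset.mem_sdiff] at hv
      exact H.charge_le (fun x hx => (hI x).1 hx) hv.1 fun hl => hv.2 ((hI v).2 hl)
  have hp := H.pot_ge
  rcases I.eq_empty_or_nonempty with h0 | ⟨x, hx⟩
  · have h1 : ∑ v ∈ V \ I, g v ≤ (V \ I).card • (-4 : ℤ) := Finset.sum_le_card_nsmul _ _ _
      fun v hv => (hch v hv).resolve_left fun h2 => by
        rw [h0] at h2
        simp at h2
    rw [hgsum] at h1
    have h2 := H.crit.two_le_card hm
    rw [h0] at h1
    simp only [Finset.sdiff_empty, nsmul_eq_mul] at h1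
    omega
  -- A light vertex has three distinct neighbors outside `I`. With `g ≤ -2` and total at least `-6`
  -- there are exactly three vertices outside `I`, all extremal; each sends two edges to the other
  -- two, which makes them a triangle.
  · have hone : ∀ y ∈ I, ∀ z ∈ V, m y z ≤ 1 := fun y hy z hz => H.mult_le_one ((hI y).1 hy) hz
    have hcard : 3 ≤ (V \ I).card := by
      have h1 : nb m x (V \ I) ≤ (V \ I).card := by
        simpa [nb] using Finset.sum_le_card_nsmul (V \ I) (fun u => m x u) 1 fun u hu =>
          hone x hx u (Finset.sdiff_subset hu)
      rwa [hnbR x hx] at h1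
    have hle : ∀ v ∈ V \ I, g v ≤ -2 := fun v hv => by
      rcases hch v hv with h1 | h1
      exacts [h1.2.2.2.le, by linarith]
    have hle' : ∑ v ∈ V \ I, g v ≤ (V \ I).card • (-2 : ℤ) := Finset.sum_le_card_nsmul _ _ _ hle
    rw [hgsum, nsmul_eq_mul] at hle'
    have hcard3 : (V \ I).card = 3 := by omega
    have heq : ∀ v ∈ V \ I, w v = 1 ∧ nb m v (V \ I) = 2 := fun v hv => by
      have h1 : ∑ u ∈ (V \ I).erase v, g u ≤ ((V \ I).erase v).card • (-2 : ℤ) :=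
        Finset.sum_le_card_nsmul _ _ _ fun u hu => hle u (Finset.mem_of_mem_erase hu)
      rw [Finset.card_erase_of_mem hv, hcard3] at h1
      have h2 := Finset.add_sum_erase _ g hv
      rw [hgsum] at h2
      simp only [nsmul_eq_mul] at h1
      norm_num at h1
      obtain ⟨h3, h4, h5, -⟩ := (hch v hv).resolve_right (by omega)
      rw [← hIR, nb_union hd, h5] at h4
      exact ⟨h3, by omega⟩
    obtain ⟨r₁, r₂, r₃, h₁₂, h₁₃, h₂₃, hR⟩ := Finset.card_eq_three.1 hcard3
    rw [hR] at heq
    have hnb : ∀ v, nb m v {r₁, r₂, r₃} = m v r₁ + (m v r₂ + m v r₃) := fun v => by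
      rw [nb_insert (by simp [h₁₂, h₁₃]), nb_insert (by simp [h₂₃]), nb_singleton]
    obtain ⟨w₁, d₁⟩ := heq r₁ (by simp)
    obtain ⟨w₂, d₂⟩ := heq r₂ (by simp)
    obtain ⟨w₃, d₃⟩ := heq r₃ (by simp)
    rw [hnb, hm.diag] at d₁ d₂ d₃
    rw [hm.symm r₂ r₁] at d₂
    rw [hm.symm r₃ r₁, hm.symm r₃ r₂] at d₃
    have hRI : ∀ r, r = r₁ ∨ r = r₂ ∨ r = r₃ → r ∈ V ∧ r ∉ I := fun r hr => by
      rw [← Finset.mem_sdiff, hR]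
      simpa using hr
    have n₁ := hRI r₁ (by simp)
    have n₂ := hRI r₂ (by simp)
    have n₃ := hRI r₃ (by simp)
    -- An edge of the triangle has weight `2 ≤ D + 1` and forms `M`; the third vertex with the
    -- independent light vertices induces a forest.
    refine H.crit.not_colorable ⟨{r₁, r₂}, insert r₃ I, ?_, ?_, ?_, ?_⟩
    · rw [← hIR, hR]
      ext y; simp only [Finset.mem_union, Finset.mem_insert, Finset.mem_singleton]; tauto
    · rw [Finset.disjoint_insert_right, Finset.disjoint_insert_left,
        Finset.disjoint_singleton_left]
      exact ⟨by simp [h₁₃.symm, h₂₃.symm], n₁.2, n₂.2⟩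
    · exact MOK.pair hm h₁₂ (by omega) w₁.ge w₂.ge (by rw [w₁, w₂]; simp only [multiParams]; omega)
    · exact forestOn_of_independent hm (fun y hy z hz =>
        H.light_independent ((hI y).1 hy) ((hI z).1 hz)) n₃.2 fun y hy => hone y hy r₃ n₃.1

end OddCritical

theorem pot_le_odd (hh : 1 ≤ h) (hv : Valid (oddParams t h) m w)
    (hc : Critical (oddParams t h) m w V) : pot (oddParams t h) m w V ≤ -2 := by
  have key : ∀ (V : Finset α) (m : α → α → ℕ) (w : α → ℕ), Valid (oddParams t h) m w →
      Colors α (oddParams t h) V.card → Critical (oddParams t h) m w V →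
      pot (oddParams t h) m w V ≤ -(oddParams t h).τ := by
    intro V m w hv hC hc
    by_contra hlt
    have hτ : (oddParams t h).τ = 2 := rfl
    exact OddCritical.false ⟨hh, hv, hC, hc, by omega⟩
  exact key V m w hv (colors_of_critical key _) hc

end Discharging

/-! ### Edge counts compared with acyclicity and components of simple graphs. -/

section SimpleGraph

variable {α ι : Type*} [DecidableEq α] {m : α → α → ℕ}

/-- The multiplicities `m` restricted to the range of `f` are given by the simple graph `H`. -/
def Represents (m : α → α → ℕ) (f : ι ↪ α) (H : SimpleGraph ι) : Prop :=
  ∀ i j, (H.Adj i j → m (f i) (f j) = 1) ∧ (¬ H.Adj i j → m (f i) (f j) = 0)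

lemma Represents.induce {f : ι ↪ α} {H : SimpleGraph ι} (h : Represents m f H) (s : Set ι) :
    Represents m ((Function.Embedding.subtype (· ∈ s)).trans f) (H.induce s) :=
  fun i j => h i j

lemma Represents.nb_map [Fintype ι] {f : ι ↪ α} {H : SimpleGraph ι} [DecidableRel H.Adj]
    (h : Represents m f H) (i : ι) (T : Finset ι) :
    nb m (f i) (T.map f) = (T.filter (H.Adj i)).card := by
  rw [nb, Finset.sum_map, Finset.card_filter]
  refine Finset.sum_congr rfl fun j _ => ?_
  split_ifs with hj
  exacts [(h i j).1 hj, (h i j).2 hj]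

lemma Represents.ed_map [Fintype ι] {f : ι ↪ α} {H : SimpleGraph ι} (hm : IsMult m)
    (h : Represents m f H) : ed m (Finset.univ.map f) = Nat.card H.edgeSet := by
  classical
  have h1 := hm.two_mul_ed (Finset.univ.map f)
  have h2 := H.sum_degrees_eq_twice_card_edges
  have h3 : cross m (Finset.univ.map f) (Finset.univ.map f) = ∑ i, H.degree i := by
    rw [cross, Finset.sum_map]
    refine Finset.sum_congr rfl fun i _ => ?_
    rw [h.nb_map, ← SimpleGraph.card_neighborFinset_eq_degree, H.neighborFinset_eq_filter]
  rw [Nat.card_eq_fintype_card, ← SimpleGraph.edgeFinset_card]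
  omega

/-- An acyclic graph on a nonempty vertex set extends to a spanning tree of the complete graph. -/
lemma Represents.forestOn [Fintype ι] {f : ι ↪ α} {H : SimpleGraph ι} (hm : IsMult m)
    (h : Represents m f H) (hH : H.IsAcyclic) : ForestOn m (Finset.univ.map f) := by
  classical
  intro S hS hne
  set T : Set ι := {i | f i ∈ S} with hT
  have hmap : Finset.univ.map ((Function.Embedding.subtype (· ∈ T)).trans f) = S := by
    ext x
    simp only [Finset.mem_map, Finset.mem_univ, true_and]
    constructor
    · rintro ⟨i, rfl⟩
      exact i.2
    · intro hx
      obtain ⟨i, -, rfl⟩ := Finset.mem_map.1 (hS hx)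
      exact ⟨⟨i, hx⟩, rfl⟩
  have : Nonempty T := by
    obtain ⟨x, hx⟩ := hne
    rw [← hmap] at hx
    obtain ⟨i, -, -⟩ := Finset.mem_map.1 hx
    exact ⟨i⟩
  obtain ⟨K, hK, -, hKt⟩ := (SimpleGraph.connected_top (V := T)).exists_isTree_le_of_le_of_isAcyclic
    le_top (hH.induce T)
  have h1 := (h.induce T).ed_map hm
  have h2 := hKt.card_edgeFinset
  have h3 := Finset.card_le_card (SimpleGraph.edgeFinset_mono hK)
  rw [hmap, Nat.card_eq_fintype_card, ← SimpleGraph.edgeFinset_card] at h1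
  have h4 : Fintype.card {x // x ∈ T} = Fintype.card T := Fintype.card_congr (Equiv.refl _)
  rw [← hmap, Finset.card_map, hmap, Finset.card_univ, h1]
  omega

/-- The vertices of a cycle span minimum degree two, hence at least as many edges as vertices. -/
lemma Represents.isAcyclic [Fintype ι] {f : ι ↪ α} {H : SimpleGraph ι} (hm : IsMult m)
    (h : Represents m f H) (hF : ForestOn m (Finset.univ.map f)) : H.IsAcyclic := by
  classical
  intro v p hp
  have h1 := hF (p.support.toFinset.map f) (Finset.map_subset_map.2 (Finset.subset_univ _))
    ⟨f v, by simp⟩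
  have h2 := hm.two_mul_ed (p.support.toFinset.map f)
  have h3 : (p.support.toFinset.map f).card • 2 ≤
      cross m (p.support.toFinset.map f) (p.support.toFinset.map f) := by
    refine Finset.card_nsmul_le_sum _ _ _ fun x hx => ?_
    obtain ⟨i, hi, rfl⟩ := Finset.mem_map.1 hx
    rw [List.mem_toFinset] at hi
    rw [h.nb_map, ← hp.ncard_neighborSet_toSubgraph_eq_two hi, ← Set.ncard_coe_finset]
    refine Set.ncard_le_ncard (fun j hj => ?_) (Finset.finite_toSet _)
    have hadj : p.toSubgraph.Adj i j := hj
    simp only [Finset.coe_filter, List.mem_toFinset]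
    exact ⟨(SimpleGraph.Walk.mem_verts_toSubgraph p).1 hadj.snd_mem, hadj.adj_sub⟩
  rw [smul_eq_mul] at h3
  omega

lemma Represents.sum_component_le [Fintype ι] {f : ι ↪ α} {H : SimpleGraph ι} (hm : IsMult m)
    (h : Represents m f H) {w : α → ℕ} {k : ℕ} (hS : ∀ S ⊆ Finset.univ.map f, S.Nonempty →
      S.card ≤ ed m S + 1 → ∑ v ∈ S, w v ≤ k) (C : H.ConnectedComponent) :
    ∑ᶠ i ∈ C.supp, w (f i) ≤ k := by
  classical
  have h1 := (h.induce C.supp).ed_map hm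
  have h2 := C.connected_toSimpleGraph.card_vert_le_card_edgeSet_add_one
  have h3 := hS (Finset.univ.map ((Function.Embedding.subtype (· ∈ C.supp)).trans f))
    (fun x hx => by
      obtain ⟨i, -, rfl⟩ := Finset.mem_map.1 hx
      exact Finset.mem_map_of_mem f (Finset.mem_univ _))
    (by
      obtain ⟨i, hi⟩ := C.nonempty_supp
      exact ⟨f i, Finset.mem_map.2 ⟨⟨i, hi⟩, Finset.mem_univ _, rfl⟩⟩)
    (by
      rw [h1, Finset.card_map, Finset.card_univ, ← Nat.card_eq_fintype_card]
      exact h2)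
  rw [Finset.sum_map] at h3
  rw [← finsum_set_coe_eq_finsum_mem, finsum_eq_sum_of_fintype]
  exact h3

/-- A set with this edge count lies in a single component: otherwise it splits into two forests with
no edge between them, which together have at most `|S| - 2` edges. -/
lemma Represents.sum_le_of_component [Fintype ι] {f : ι ↪ α} {H : SimpleGraph ι} (hm : IsMult m)
    (h : Represents m f H) {w : α → ℕ} {k : ℕ} (hF : ForestOn m (Finset.univ.map f))
    (hC : ∀ C : H.ConnectedComponent, ∑ᶠ i ∈ C.supp, w (f i) ≤ k) {S : Finset α}
    (hS : S ⊆ Finset.univ.map f) (hne : S.Nonempty) (hed : S.card ≤ ed m S + 1) :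
    ∑ v ∈ S, w v ≤ k := by
  classical
  obtain ⟨x, hx⟩ := hne
  obtain ⟨i, -, rfl⟩ := Finset.mem_map.1 (hS hx)
  set C := H.connectedComponentMk i with hCdef
  set T := (Finset.univ.filter (· ∈ C.supp)).map f with hT
  have hiT : f i ∈ T := Finset.mem_map_of_mem f (by simp [hCdef])
  have hST : S ⊆ T := by
    by_contra hnot
    obtain ⟨y, hy, hyT⟩ := Finset.not_subset.1 hnot
    have hd : Disjoint (S ∩ T) (S \ T) := Finset.disjoint_left.2 fun z hz hz' =>
      (Finset.mem_sdiff.1 hz').2 (Finset.mem_inter.1 hz).2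
    have hu : S ∩ T ∪ S \ T = S := by
      ext z; simp only [Finset.mem_union, Finset.mem_inter, Finset.mem_sdiff]; tauto
    have h1 := hF (S ∩ T) (Finset.inter_subset_left.trans hS)
      ⟨f i, Finset.mem_inter.2 ⟨hx, hiT⟩⟩
    have h2 := hF (S \ T) (Finset.sdiff_subset.trans hS) ⟨y, Finset.mem_sdiff.2 ⟨hy, hyT⟩⟩
    have h3 : cross m (S ∩ T) (S \ T) = 0 := by
      by_contra hne
      obtain ⟨a, ha, b, hb, hab⟩ := exists_of_cross_pos (Nat.pos_of_ne_zero hne)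
      rw [Finset.mem_inter] at ha
      rw [Finset.mem_sdiff] at hb
      obtain ⟨a, ha', rfl⟩ := Finset.mem_map.1 ha.2
      obtain ⟨b, -, rfl⟩ := Finset.mem_map.1 (hS hb.1)
      have hadj : H.Adj a b := by
        by_contra hadj
        rw [(h a b).2 hadj] at hab
        omega
      refine hb.2 (Finset.mem_map_of_mem f ?_)
      rw [Finset.mem_filter] at ha' ⊢
      exact ⟨Finset.mem_univ _, C.mem_supp_of_adj_mem_supp ha'.2 hadj⟩
    have h4 := hm.ed_union hd
    have h5 := Finset.card_union_of_disjoint hd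
    rw [hu] at h4 h5
    omega
  refine (Finset.sum_le_sum_of_subset hST).trans ?_
  rw [hT, Finset.sum_map]
  refine le_trans (le_of_eq ?_) (hC C)
  rw [finsum_mem_eq_finite_toFinset_sum _ (Set.toFinite _)]
  refine Finset.sum_congr ?_ fun _ _ => rfl
  ext j
  simp

end SimpleGraph

/-! ### From graphs to multiplicities. -/

section Translation

variable {α β : Type*} [DecidableEq α] {G : Graph α β}

/-- The number of edges of `G` between `u` and `v`. -/
noncomputable def mult (G : Graph α β) (u v : α) : ℕ := {e | G.IsLink e u v}.ncard

lemma finite_isLink (hE : G.edgeSet.Finite) (u v : α) : {e | G.IsLink e u v}.Finite :=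
  hE.subset fun _ he => he.edge_mem

lemma isMult_mult [G.Loopless] : IsMult (mult G) where
  symm u v := by
    unfold mult
    congr 1
    ext e
    exact G.isLink_comm
  diag v := by
    have : {e | G.IsLink e v v} = ∅ :=
      Set.eq_empty_iff_forall_notMem.2 fun e he => G.not_isLoopAt e v he
    rw [mult, this, Set.ncard_empty]

lemma mult_pos_iff (hE : G.edgeSet.Finite) {u v : α} : 0 < mult G u v ↔ G.Adj u v := by
  rw [mult, Set.ncard_pos (finite_isLink hE u v)]
  rfl

lemma nb_mult (hE : G.edgeSet.Finite) (v : α) (A : Finset α) :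
    nb (mult G) v A = {e | ∃ u ∈ A, G.IsLink e v u}.ncard := by
  induction A using Finset.induction_on with
  | empty => simp
  | insert x A hx ih =>
    have hd : Disjoint {e | G.IsLink e v x} {e | ∃ u ∈ A, G.IsLink e v u} :=
      Set.disjoint_left.2 fun e he ⟨u, hu, he'⟩ => hx (he.right_unique he' ▸ hu)
    have hu : {e | ∃ u ∈ insert x A, G.IsLink e v u} =
        {e | G.IsLink e v x} ∪ {e | ∃ u ∈ A, G.IsLink e v u} := by
      ext e; simp
    rw [nb_insert hx, ih, hu, Set.ncard_union_eq hd (finite_isLink hE v x)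
      (hE.subset fun e ⟨u, _, he⟩ => he.edge_mem), mult]

lemma ncard_edgeSet_induce [G.Loopless] (hE : G.edgeSet.Finite) (A : Finset α) :
    (G.induce A).edgeSet.ncard = ed (mult G) A := by
  induction A using Finset.induction_on with
  | empty => simp [Graph.edgeSet_induce]
  | insert v A hv ih =>
    have hd : Disjoint (G.induce A).edgeSet {e | ∃ u ∈ A, G.IsLink e v u} := by
      refine Set.disjoint_left.2 fun e ⟨x, y, he, hx, hy⟩ ⟨u, _, he'⟩ => ?_
      rcases he'.left_eq_or_eq he with rfl | rfl
      exacts [hv hx, hv hy]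
    have hu : (G.induce ↑(insert v A)).edgeSet =
        (G.induce A).edgeSet ∪ {e | ∃ u ∈ A, G.IsLink e v u} := by
      ext e
      simp only [Graph.edgeSet_induce, Finset.coe_insert, Set.mem_insert_iff, Finset.mem_coe,
        Set.mem_union, Set.mem_ofPred_eq]
      constructor
      · rintro ⟨x, y, he, rfl | hx, rfl | hy⟩
        exacts [(G.not_isLoopAt e _ he).elim, Or.inr ⟨y, hy, he⟩, Or.inr ⟨x, hx, he.symm⟩,
          Or.inl ⟨x, y, he, hx, hy⟩]
      · rintro (⟨x, y, he, hx, hy⟩ | ⟨u, hu, he⟩)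
        exacts [⟨x, y, he, Or.inr hx, Or.inr hy⟩, ⟨v, u, he, Or.inl rfl, Or.inr hu⟩]
    rw [isMult_mult.ed_insert hv, hu, Set.ncard_union_eq hd
      (hE.subset fun e ⟨x, y, he, _, _⟩ => he.edge_mem)
      (hE.subset fun e ⟨u, _, he⟩ => he.edge_mem), ih, nb_mult hE]

lemma mult_le_one_of_simple (hE : G.edgeSet.Finite) {M : Finset α} (h : (G.induce M).Simple) {u v : α} (hu : u ∈ M)
    (hv : v ∈ M) : mult G u v ≤ 1 := by
  refine (Set.ncard_le_one (finite_isLink hE u v)).2 fun e he f hf => ?_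
  exact h.eq_of_isLink (x := u) (y := v) ⟨he, hu, hv⟩ ⟨hf, hu, hv⟩

lemma simple_induce [G.Loopless] (hE : G.edgeSet.Finite) {M : Finset α}
    (h : ∀ u ∈ M, ∀ v ∈ M, mult G u v ≤ 1) : (G.induce M).Simple where
  not_isLoopAt e x he := G.not_isLoopAt e x he.1
  eq_of_isLink e f x y he hf := (Set.ncard_le_one (finite_isLink hE x y)).1
    (h x he.2.1 y he.2.2) e he.1 f hf.1

/-- The vertices of an induced subgraph, embedded into all vertices. -/
abbrev inducedEmbedding (G : Graph α β) (M : Finset α) : (G.induce M).vertexSet ↪ α :=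
  Function.Embedding.subtype _

instance (M : Finset α) : Fintype (G.induce M).vertexSet :=
  inferInstanceAs (Fintype (M : Set α))

lemma map_inducedEmbedding (M : Finset α) : Finset.univ.map (inducedEmbedding G M) = M := by
  ext x
  simp

lemma represents [G.Loopless] (hE : G.edgeSet.Finite) {M : Finset α}
    (h : ∀ u ∈ M, ∀ v ∈ M, mult G u v ≤ 1) :
    Represents (mult G) (inducedEmbedding G M) (G.induce M).toSimpleGraph := by
  intro i j
  have hadj : (G.induce M).toSimpleGraph.Adj i j ↔ 0 < mult G i j := by
    rw [mult_pos_iff hE]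
    constructor
    · rintro ⟨-, e, he⟩
      exact ⟨e, he.1⟩
    · rintro ⟨e, he⟩
      exact ⟨fun hij => G.not_isLoopAt e i (by rw [← hij] at he; exact he), e, he, i.2, j.2⟩
  have := h i i.2 j j.2
  rw [hadj]
  change (_ → mult G i j = 1) ∧ (_ → mult G i j = 0)
  omega

lemma ForestOn.mult_le_one {m : α → α → ℕ} (hm : IsMult m) {M : Finset α} (h : ForestOn m M)
    {u v : α} (hu : u ∈ M) (hv : v ∈ M) : m u v ≤ 1 := by
  by_cases huv : u = v
  · rw [huv, hm.diag]; omega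
  · have h1 := h {u, v} (by
      intro x hx
      simp only [Finset.mem_insert, Finset.mem_singleton] at hx
      rcases hx with rfl | rfl <;> assumption) ⟨u, by simp⟩
    rw [hm.ed_pair huv, Finset.card_pair huv] at h1
    omega

lemma isForest_induce_iff [G.Loopless] (hE : G.edgeSet.Finite) (M : Finset α) :
    IsForest (G.induce M) ↔ ForestOn (mult G) M := by
  constructor
  · rintro ⟨hs, ha⟩
    have := (represents hE fun u hu v hv => mult_le_one_of_simple hE hs hu hv).forestOn isMult_mult ha
    rwa [map_inducedEmbedding] at this
  · intro h
    have h1 : ∀ u ∈ M, ∀ v ∈ M, mult G u v ≤ 1 := fun u hu v hv => h.mult_le_one isMult_mult hu hv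
    exact ⟨simple_induce hE h1, (represents hE h1).isAcyclic isMult_mult
      (by rwa [map_inducedEmbedding])⟩

lemma induce_induce {A M : Set α} (h : M ⊆ A) : (G.induce A).induce M = G.induce M := by
  refine Graph.ext rfl fun e x y => ?_
  simp only [Graph.induce_isLink]
  constructor
  · exact fun he => ⟨he.1.1, he.2⟩
  · exact fun he => ⟨⟨he.1, h he.2.1, h he.2.2⟩, he.2⟩

/-- Counting neighbors and counting edges agree, because there are no parallel edges within `M`. -/
lemma ncard_adj_eq_nb (hE : G.edgeSet.Finite) {M : Finset α}
    (h : ∀ u ∈ M, ∀ v ∈ M, mult G u v ≤ 1) {v : α} (hv : v ∈ M) :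
    {u | u ∈ (M : Set α) ∧ G.Adj v u}.ncard = nb (mult G) v M := by
  classical
  have : {u | u ∈ (M : Set α) ∧ G.Adj v u} = ↑(M.filter fun u => G.Adj v u) := by
    ext u; simp
  rw [this, Set.ncard_coe_finset, nb, Finset.card_filter]
  refine Finset.sum_congr rfl fun u hu => ?_
  have h1 := h v hv u hu
  have h2 := mult_pos_iff hE (u := v) (v := u)
  split_ifs with h3
  · rw [← h2] at h3; omega
  · rw [← h2] at h3; omega

lemma mok_degree_iff [G.Loopless] (hE : G.edgeSet.Finite) (D : ℕ) (w : α → ℕ) (M : Finset α) :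
    MOK .degree D (mult G) w M ↔ IsForest (G.induce M) ∧
      ∀ v ∈ (M : Set α), w v + {u | u ∈ (M : Set α) ∧ G.Adj v u}.ncard ≤ D + 1 := by
  rw [MOK, isForest_induce_iff hE]
  refine and_congr_right fun h => forall₂_congr fun v hv => ?_
  rw [ncard_adj_eq_nb hE (fun u hu v hv => h.mult_le_one isMult_mult hu hv) hv]

lemma mok_component_iff [G.Loopless] (hE : G.edgeSet.Finite) (D : ℕ) (w : α → ℕ) (M : Finset α) :
    MOK .component D (mult G) w M ↔ IsForest (G.induce M) ∧
      ∀ C : (G.induce M).toSimpleGraph.ConnectedComponent, ∑ᶠ v ∈ C.supp, w v.1 ≤ D + 1 := by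
  rw [MOK, isForest_induce_iff hE]
  refine and_congr_right fun h => ?_
  have hr := represents hE fun u hu v hv => h.mult_le_one isMult_mult hu hv
  have hmap := map_inducedEmbedding (G := G) M
  constructor
  · intro hS C
    exact hr.sum_component_le isMult_mult (by rwa [hmap]) C
  · intro hC S hS hne hed
    exact hr.sum_le_of_component isMult_mult (by rwa [hmap]) hC (by rwa [hmap]) hne hed

end Translation

/-! ### From critical graphs to critical multiplicity functions. -/

section Critical

variable {α β : Type*} [DecidableEq α] {G : Graph α β} {D : ℕ} {w : α → ℕ}

lemma IsForestPartition.exists_finset {A : Finset α} {M F : Set α}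
    (h : IsForestPartition (G.induce A) M F) : ∃ M' F' : Finset α, M' = M ∧ F' = F := by
  have hu : M ∪ F = A := h.union_eq
  have hM : M.Finite := A.finite_toSet.subset (hu ▸ Set.subset_union_left)
  have hF : F.Finite := A.finite_toSet.subset (hu ▸ Set.subset_union_right)
  exact ⟨hM.toFinset, hF.toFinset, by simp, by simp⟩

lemma isCol_iff [G.Loopless] (hE : G.edgeSet.Finite) {t : Kind} {A M F : Finset α} :
    IsCol t D (mult G) w A M F ↔
      IsForestPartition (G.induce A) M F ∧ MOK t D (mult G) w M := by
  have hu : ((M : Set α) ∪ F = (G.induce A).vertexSet) ↔ M ∪ F = A := by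
    rw [← Finset.coe_union]
    exact Finset.coe_inj
  constructor
  · intro h
    have hM : (M : Set α) ⊆ A := Finset.coe_subset.2 h.left_subset
    have hF : (F : Set α) ⊆ A := Finset.coe_subset.2 h.right_subset
    refine ⟨⟨hu.2 h.union_eq, Finset.disjoint_coe.2 h.disj, ?_, ?_⟩, h.left⟩
    · rw [induce_induce hM, isForest_induce_iff hE]
      exact h.left.1
    · rw [induce_induce hF, isForest_induce_iff hE]
      exact h.right
  · rintro ⟨h, hM⟩
    have hF : (F : Set α) ⊆ A := Set.subset_union_right.trans_eq h.union_eq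
    refine ⟨hu.1 h.union_eq, Finset.disjoint_coe.1 h.disjoint, hM, ?_⟩
    rw [← isForest_induce_iff hE, ← induce_induce hF]
    exact h.forest_right

lemma exists_isDegreeColoring_iff [G.Loopless] (hE : G.edgeSet.Finite) (A : Finset α) :
    (∃ M F, IsDegreeColoring D (G.induce A) w M F) ↔ Colorable .degree D (mult G) w A := by
  have hadj : ∀ M : Finset α, (M : Set α) ⊆ A → ∀ v ∈ (M : Set α),
      {u | u ∈ (M : Set α) ∧ (G.induce A).Adj v u} = {u | u ∈ (M : Set α) ∧ G.Adj v u} := by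
    intro M hM v hv
    ext u
    exact and_congr_right fun hu =>
      ⟨fun ⟨e, he⟩ => ⟨e, he.1⟩, fun ⟨e, he⟩ => ⟨e, he, hM hv, hM hu⟩⟩
  constructor
  · rintro ⟨M, F, h⟩
    obtain ⟨M, F, rfl, rfl⟩ := h.toIsForestPartition.exists_finset
    have hM : (M : Set α) ⊆ A := Set.subset_union_left.trans_eq h.union_eq
    refine ⟨M, F, (isCol_iff hE).2 ⟨h.toIsForestPartition, (mok_degree_iff hE D w M).2 ⟨?_, ?_⟩⟩⟩
    · rw [← induce_induce hM]
      exact h.forest_left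
    · intro v hv
      rw [← hadj M hM v hv]
      exact h.degree_le v hv
  · rintro ⟨M, F, h⟩
    have hM : (M : Set α) ⊆ A := Finset.coe_subset.2 h.left_subset
    refine ⟨M, F, ((isCol_iff hE).1 h).1, fun v hv => ?_⟩
    rw [hadj M hM v hv]
    exact ((mok_degree_iff hE D w M).1 h.left).2 v hv

lemma exists_isEdgeColoring_iff [G.Loopless] (hE : G.edgeSet.Finite) (A : Finset α) :
    (∃ M F, IsEdgeColoring D (G.induce A) w M F) ↔ Colorable .component D (mult G) w A := by
  constructor
  · rintro ⟨M, F, h⟩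
    obtain ⟨M, F, rfl, rfl⟩ := h.toIsForestPartition.exists_finset
    have hM : (M : Set α) ⊆ A := Set.subset_union_left.trans_eq h.union_eq
    have h1 := And.intro h.forest_left h.component_le
    rw [induce_induce hM] at h1
    exact ⟨M, F, (isCol_iff hE).2 ⟨h.toIsForestPartition, (mok_component_iff hE D w M).2 h1⟩⟩
  · rintro ⟨M, F, h⟩
    have hM : (M : Set α) ⊆ A := Finset.coe_subset.2 h.left_subset
    have h1 := (mok_component_iff hE D w M).1 h.left
    rw [← induce_induce hM] at h1
    exact ⟨M, F, ((isCol_iff hE).1 h).1, h1.2⟩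

/-- The subgraph induced by a vertex with a loop is proper, as there are at least two vertices, and
it cannot be partitioned into forests. -/
lemma loopless_of_exists (hcard : 2 ≤ G.vertexSet.ncard)
    (h : ∀ H < G, ∃ M F, IsForestPartition H M F) : G.Loopless where
  not_isLoopAt e x he := by
    have he : G.IsLink e x x := he
    have hne : G.induce {x} ≠ G := fun heq => by
      have : G.vertexSet = {x} := by rw [← heq]; rfl
      rw [this, Set.ncard_singleton] at hcard
      omega
    obtain ⟨M, F, hp⟩ := h (G.induce {x})
      (lt_of_le_of_ne (Graph.induce_le (by simpa using he.left_mem)) hne)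
    have hx : x ∈ M ∪ F := by rw [hp.union_eq]; exact rfl
    rcases hx with hx | hx
    · exact hp.forest_left.1.not_isLoopAt e x ⟨⟨he, rfl, rfl⟩, hx, hx⟩
    · exact hp.forest_right.1.not_isLoopAt e x ⟨⟨he, rfl, rfl⟩, hx, hx⟩

lemma colorable_congr {t : Kind} {m : α → α → ℕ} {w' : α → ℕ} {A : Finset α}
    (h : ∀ v ∈ A, w v = w' v) : Colorable t D m w A ↔ Colorable t D m w' A :=
  ⟨fun ⟨M, F, hc⟩ => ⟨M, F, hc.mono (fun _ _ _ _ => le_rfl) fun v hv => (h v hv).ge⟩,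
    fun ⟨M, F, hc⟩ => ⟨M, F, hc.mono (fun _ _ _ _ => le_rfl) fun v hv => (h v hv).le⟩⟩

/-- Only proper induced subgraphs are used of all the proper subgraphs that are colorable by
criticality. -/
lemma critical_of_forall_lt {P : Params} (hV : G.vertexSet.Finite) {w' : α → ℕ}
    (hw : ∀ v ∈ G.vertexSet, w v = w' v) {X : Graph α β → Prop}
    (hX : ∀ A : Finset α, X (G.induce A) ↔ Colorable P.kind P.D (mult G) w A)
    (hG : ¬ X G) (hlt : ∀ H < G, X H) : Critical P (mult G) w' hV.toFinset := by
  refine ⟨fun hc => hG ?_, fun A hA => ?_⟩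
  · rw [← colorable_congr fun v hv => hw v (hV.mem_toFinset.1 hv), ← hX, hV.coe_toFinset,
      G.induce_vertexSet] at hc
    exact hc
  · have hA' : (A : Set α) ⊂ G.vertexSet := by
      rw [← hV.coe_toFinset]
      exact Finset.coe_ssubset.2 hA
    rw [← colorable_congr fun v hv => hw v (hA'.1 hv), ← hX]
    exact hlt _ (lt_of_le_of_ne (Graph.induce_le hA'.1) fun heq =>
      hA'.ne (congrArg Graph.vertexSet heq))

lemma potential_eq_pot [G.Loopless] {P : Params} (hV : G.vertexSet.Finite)
    (hE : G.edgeSet.Finite) {ρ : α → ℤ} {e : ℤ} (hρ : ∀ v ∈ G.vertexSet, ρ v = P.Φ (w v))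
    (he : e = P.E) : potential G ρ e G.vertexSet = pot P (mult G) w hV.toFinset := by
  have h1 := ncard_edgeSet_induce hE hV.toFinset
  rw [hV.coe_toFinset] at h1
  rw [potential, pot, h1, finsum_mem_eq_finite_toFinset_sum _ hV, he, mul_comm,
    Finset.sum_congr rfl fun v hv => hρ v (hV.mem_toFinset.1 hv)]

lemma capacity_eq {v : α} (h : w v ≤ D + 2) : capacity D w v = ((D + 2 - w v : ℕ) : ℤ) := by
  rw [capacity]; omega

end Critical

end ForestPartition

/-! ### The four parts of the theorem. -/

theorem mainTheorem4 {α β : Type*} (D : ℕ) (G : Graph α β)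
    (hV : G.vertexSet.Finite) (hE : G.edgeSet.Finite) (hcard : 3 ≤ G.vertexSet.ncard)
    (w : α → ℕ) (hw : ∀ v ∈ G.vertexSet, 1 ≤ w v ∧ w v ≤ D + 2) :
    (1 ≤ D → ForestPartition.IsDegreeCritical D G w →
      ForestPartition.rhoMultiDegree D G w G.vertexSet ≤ -2) ∧
    (2 ≤ D → G.Simple → ForestPartition.IsDegreeCritical D G w →
      ForestPartition.rhoSimpleDegree D G w G.vertexSet ≤ -3) ∧
    (Odd D → 1 ≤ D → ForestPartition.IsEdgeCritical D G w →
      ForestPartition.rhoMultiEdge D G w G.vertexSet ≤ -2) ∧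
    (Even D → 2 ≤ D → ForestPartition.IsEdgeCritical D G w →
      ForestPartition.rhoMultiEdge D G w G.vertexSet ≤ -2) := by
  classical
  open ForestPartition in
  -- `Valid` asks for positive weights everywhere, while `w` is controlled only on the vertices of
  -- `G`.
  set w' : α → ℕ := fun v => max (w v) 1 with hw'
  have hw₁ : ∀ v, 1 ≤ w' v := fun v => le_max_right _ _
  have hww : ∀ v ∈ G.vertexSet, w v = w' v := fun v hv => (max_eq_left (hw v hv).1).symm
  have hmulti : ∀ t, G.Loopless → rhoMultiDegree D G w G.vertexSet =
      pot (multiParams t D) (mult G) w' hV.toFinset := fun t _ =>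
    potential_eq_pot hV hE (fun v hv => by
      simp only [multiParams, ← hww v hv, capacity_eq (hw v hv).2]) rfl
  have hdeg : IsDegreeCritical D G w → G.Loopless := fun h =>
    loopless_of_exists (by omega) fun H hH => by
      obtain ⟨M, F, hc⟩ := h.2 H hH
      exact ⟨M, F, hc.toIsForestPartition⟩
  have hedge : IsEdgeCritical D G w → G.Loopless := fun h =>
    loopless_of_exists (by omega) fun H hH => by
      obtain ⟨M, F, hc⟩ := h.2 H hH
      exact ⟨M, F, hc.toIsForestPartition⟩
  refine ⟨fun hD h => ?_, fun hD hs h => ?_, fun hodd hD h => ?_, fun heven hD h => ?_⟩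
  · have hl := hdeg h
    rw [hmulti .degree hl]
    have hv : Valid (multiParams .degree D) (mult G) w' :=
      ⟨isMult_mult, hw₁, fun hs => by cases hs⟩
    have hc : Critical (multiParams .degree D) (mult G) w' hV.toFinset :=
      critical_of_forall_lt hV hww (exists_isDegreeColoring_iff hE) h.1 h.2
    -- For `D = 1` the simple charge count fails, and the argument for odd `D` with `h = 1` takes
    -- over; it covers both kinds of colorings.
    rcases Nat.lt_or_ge D 2 with h1 | h1
    · obtain rfl : D = 2 * 1 - 1 := by omega
      exact pot_le_odd le_rfl hv hc
    · exact pot_le_multi_degree h1 hv hc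
  · have hl := hdeg h
    have hp : rhoSimpleDegree D G w G.vertexSet = pot (simpleParams D) (mult G) w' hV.toFinset :=
      potential_eq_pot hV hE (fun v hv => by
        simp only [simpleParams, ← hww v hv, capacity_eq (hw v hv).2]) rfl
    rw [hp]
    exact pot_le_simple_degree hD ⟨isMult_mult, hw₁, fun _ u v =>
      (Set.ncard_le_one (finite_isLink hE u v)).2 fun e he f hf => he.eq hf⟩
      (critical_of_forall_lt hV hww (exists_isDegreeColoring_iff hE) h.1 h.2)
  · have hl := hedge h
    rw [rhoMultiEdge, if_pos hodd, hmulti .component hl]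
    obtain ⟨k, hk⟩ := hodd
    obtain rfl : D = 2 * (k + 1) - 1 := by omega
    exact pot_le_odd (Nat.le_add_left 1 k) ⟨isMult_mult, hw₁, fun hs => by cases hs⟩
      (critical_of_forall_lt hV hww (exists_isEdgeColoring_iff hE) h.1 h.2)
  · have hl := hedge h
    obtain ⟨d, rfl⟩ : ∃ d, D = 2 * d := heven.two_dvd
    rw [rhoMultiEdge, if_neg (Nat.not_odd_iff_even.2 heven)]
    have hp : potential G (evenVertexPotential (2 * d) w) (2 * ((2 * d : ℕ) : ℤ) + 1) G.vertexSet =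
        pot (evenParams d) (mult G) w' hV.toFinset :=
      potential_eq_pot hV hE (fun v hv => by
        have h1 := (hw v hv).2
        simp only [evenParams, evenVertexPotential, ← hww v hv, capacity_eq h1]
        split_ifs <;> push_cast <;> omega) (by simp only [evenParams]; push_cast; ring)
    rw [hp]
    exact pot_le_even (by omega) ⟨isMult_mult, hw₁, fun hs => by cases hs⟩
      (critical_of_forall_lt hV hww (exists_isEdgeColoring_iff hE) h.1 h.2)
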